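/- Let $K$ be a field and let $X=\{L=Q=0\}\subset\mathbb P^2_K\times\mathbb P^2_K\times\mathbb P^2_K$ (homogeneous coordinates $x,y,z$), where $$L=\sum_{i,j,k=0}^{2}a_{ijk}\,x_iy_jz_k,\qquad Q=\sum_{i,j,k,l,m,n=0}^{2}b_{ijklmn}\,x_ix_l\,y_jy_m\,z_kz_n .$$ Assume that $X$ is an integral complete intersection of dimension $4$, i.e. that the ideal $(L,Q)$ is prime of height $2$. Let $p_1=p_{yz}$, $p_2=p_{xz}$, $p_3=p_{xy}\colon X\to\mathbb P^2\times\mathbb P^2$ be the projections; let $H,H'\subset\mathbb P^2\times\mathbb P^2$ be the divisors on which the first coordinate of the first, respectively second, factor vanishes; and let $D_x,D_y,D_z$ be the divisors of $x_0,y_0,z_0$ on $X$. Write $\sim$ for linear equivalence of Weil divisors. For the projection $p_1$ write $L=\sum_i L_i\,x_i$ and $Q=\sum_{i\le j}Q_{ij}\,x_ix_j$ with $L_i,Q_{ij}$ forms in $y,z$, and for $\{i,j,k\}=\{0,1,2\}$ put $$G_k=L_i^2Q_{jj}-L_iL_jQ_{ij}+L_j^2Q_{ii},\qquad H_{ij}=2L_iL_jQ_{kk}-L_iL_kQ_{jk}-L_jL_kQ_{ik}+L_k^2Q_{ij};$$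 write $G^{y,z}_k,H^{y,z}_{ij}$ for these forms, and define $G^{x,z}_k,H^{x,z}_{ij}$ (for $p_2$) and $G^{x,y}_k,H^{x,y}_{ij}$ (for $p_3$) in the same way. Let $U_1\subset X$ be the complement of the common zero locus of all $G^{y,z}_k$ and $H^{y,z}_{ij}$ (the union of the positive-dimensional fibres of $p_1$), and define $U_2,U_3$ similarly for $p_2,p_3$. Let $\sigma_i\colon U_i\to U_i$ be the involution interchanging the two points (counted with multiplicity) of the fibres of $p_i$, and for a prime divisor $Y$ on $X$ let $\sigma_i^*Y$ be the closure of $\sigma_i^{-1}(Y\cap U_i)$, extended linearly to Weil divisors. (a) The forms $G_0^{y,z},G_0^{x,z},G_0^{x,y}$ are nonzero and bihomogeneous of bidegree $(4,4)$. In $\mathbb P^2\times\mathbb P^2$, $$p_{1*}p_2^*H=\operatorname{div}(G_0^{y,z})\sim 4H+4H',\qquad p_{2*}p_1^*H=\operatorname{div}(G_0^{x,z})\sim 4H+4H',\qquad p_{3*}p_1^*H'=\operatorname{div}(G_0^{x,y})\sim 4H+4H'.$$ The same equalities and equivalences hold for the other expressions of the same divisors: with $p_3^*H$ in place of $p_2^*H$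 in the first, $p_3^*H'$ in place of $p_1^*H$ in the second, and $p_2^*H'$ in place of $p_1^*H'$ in the third. (b) If $X\setminus U_1$ has codimension at least $2$ in $X$, then $\sigma_1^*D_x\sim 4D_y+4D_z-D_x$, $\sigma_1^*D_y=D_y$ and $\sigma_1^*D_z=D_z$. If $X\setminus U_2$ has codimension at least $2$ in $X$, then $\sigma_2^*D_y\sim 4D_x+4D_z-D_y$, $\sigma_2^*D_x=D_x$ and $\sigma_2^*D_z=D_z$. If $X\setminus U_3$ has codimension at least $2$ in $X$, then $\sigma_3^*D_z\sim 4D_x+4D_y-D_z$, $\sigma_3^*D_x=D_x$ and $\sigma_3^*D_y=D_y$. -/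

import Mathlib

open MvPolynomial

universe u

noncomputable section

namespace ThreeInvolutions

/-! ## Subvarieties of products of projective planes

`ι` indexes the factors of `∏_{t : ι} ℙ²_K`; the homogeneous coordinates of the factor `t` are the
variables `X (t, 0), X (t, 1), X (t, 2)`.  A multihomogeneous ideal `J` defines a closed subscheme
of the product, whose multihomogeneous coordinate ring is `MvPolynomial (ι × Fin 3) K ⧸ J`. -/

section General

variable {ι : Type} [Fintype ι] [DecidableEq ι] {K : Type u} [Field K]

/-- The multidegree of the variable `X (t, j)` is the unit vector `e_t`. -/
def multideg (ι : Type) [DecidableEq ι] : ι × Fin 3 → (ι → ℕ) := fun v => Pi.single v.1 1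

/-- `f` is a multihomogeneous form of multidegree `d`. -/
def IsForm (f : MvPolynomial (ι × Fin 3) K) (d : ι → ℕ) : Prop :=
  IsWeightedHomogeneous (multideg ι) f d

/-- A prime (Weil) divisor on the closed subscheme of `∏ ℙ²` defined by `J`, given by its generic
point: a multihomogeneous prime ideal of the coordinate ring which contains no irrelevant ideal
`(X (t, 0), X (t, 1), X (t, 2))` and has codimension one. -/
@[ext]
structure PrimeDivisor (J : Ideal (MvPolynomial (ι × Fin 3) K)) where
  ideal : Ideal (MvPolynomial (ι × Fin 3) K ⧸ J)
  isPrime : ideal.IsPrime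
  homogeneous : ∀ f : MvPolynomial (ι × Fin 3) K, Ideal.Quotient.mk J f ∈ ideal →
    ∀ d : ι → ℕ, Ideal.Quotient.mk J (weightedHomogeneousComponent (multideg ι) d f) ∈ ideal
  relevant : ∀ t : ι, ∃ j : Fin 3, Ideal.Quotient.mk J (X (t, j)) ∉ ideal
  height_eq_one : ideal.height = 1

attribute [instance] PrimeDivisor.isPrime

/-- Weil divisors. -/
abbrev WeilDiv (J : Ideal (MvPolynomial (ι × Fin 3) K)) : Type u := PrimeDivisor J →₀ ℤ

variable {J : Ideal (MvPolynomial (ι × Fin 3) K)}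

theorem mem_minimalPrimes_of_ord {R S : Type*} [CommRing R] [CommRing S] [Algebra R S]
    (P : Ideal R) [hP : P.IsPrime] [IsLocalization.AtPrime S P] (f : R)
    (h0 : (Ring.ord S (algebraMap R S f)).toNat ≠ 0) : P ∈ (Ideal.span {f}).minimalPrimes := by
  have hloc : IsLocalRing S := IsLocalization.AtPrime.isLocalRing S P
  have hord0 : Ring.ord S (algebraMap R S f) ≠ 0 := fun h => h0 (by rw [h]; rfl)
  have hordT : Ring.ord S (algebraMap R S f) ≠ ⊤ := fun h => h0 (by rw [h]; rfl)
  have hmem : f ∈ P := by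
    by_contra hf
    have hu : IsUnit (algebraMap R S f) :=
      IsLocalization.map_units S (⟨f, hf⟩ : P.primeCompl)
    exact hord0 (Ring.ord_of_isUnit hu)
  refine ⟨⟨hP, (Ideal.span_singleton_le_iff_mem _).mpr hmem⟩, ?_⟩
  rintro Q ⟨hQ, hfQ⟩ hQP
  have hfin' := Module.length_ne_top_iff.mp hordT
  have hart := (isFiniteLength_iff_isNoetherian_isArtinian.mp hfin').2
  have hart2 : IsArtinianRing (S ⧸ Ideal.span {algebraMap R S f}) :=
    isArtinian_of_tower S hart
  have hdisj : Disjoint (P.primeCompl : Set R) (Q : Set _) :=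
    Set.disjoint_left.mpr fun y hy hyQ => hy (hQP hyQ)
  have hQR : (Q.map (algebraMap R S)).IsPrime :=
    IsLocalization.isPrime_of_isPrime_disjoint P.primeCompl S Q hQ hdisj
  have hxQ : Ideal.span {algebraMap R S f} ≤ Q.map (algebraMap R S) :=
    (Ideal.span_singleton_le_iff_mem _).mpr
      (Ideal.mem_map_of_mem _ (hfQ (Ideal.mem_span_singleton_self f)))
  have hpr : ((Q.map (algebraMap R S)).map
      (Ideal.Quotient.mk (Ideal.span {algebraMap R S f}))).IsPrime :=
    Ideal.map_isPrime_of_surjective Ideal.Quotient.mk_surjective (by rwa [Ideal.mk_ker])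
  have hmax := IsArtinianRing.isMaximal_of_isPrime
    ((Q.map (algebraMap R S)).map (Ideal.Quotient.mk (Ideal.span {algebraMap R S f})))
  have hmaxR : (Q.map (algebraMap R S)).IsMaximal := by
    have := Ideal.comap_isMaximal_of_surjective (Ideal.Quotient.mk (Ideal.span {algebraMap R S f}))
      Ideal.Quotient.mk_surjective (K := (Q.map (algebraMap R S)).map (Ideal.Quotient.mk _))
    rwa [Ideal.comap_map_of_surjective _ Ideal.Quotient.mk_surjective, ← RingHom.ker_eq_comap_bot,
      Ideal.mk_ker, sup_eq_left.mpr hxQ] at this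
  have heq := IsLocalRing.eq_maximalIdeal hmaxR
  have h1 := IsLocalization.under_map_of_isPrime_disjoint P.primeCompl S hQ hdisj
  have h2 := IsLocalization.AtPrime.under_maximalIdeal S P
  rw [heq] at h1
  exact (h2.symm.trans h1).le

/-- Order of vanishing along `P`: the length of `R_P / (f)` over the local ring `R_P`.  (For a form
`f` this is the order of the local equation `f / m` of its zero divisor, `m` being any monomial of
the same multidegree that does not vanish along `P`.) -/
def ordAt (P : PrimeDivisor J) (f : MvPolynomial (ι × Fin 3) K ⧸ J) : ℕ :=
  (Ring.ord (Localization.AtPrime P.ideal) (algebraMap _ _ f)).toNat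

theorem ordAt_support_finite (f : MvPolynomial (ι × Fin 3) K ⧸ J) :
    (Function.support fun P : PrimeDivisor J => (ordAt P f : ℤ)).Finite := by
  have hfin := Ideal.finite_minimalPrimes_of_isNoetherianRing _ (Ideal.span {f})
  refine Set.Finite.of_finite_image (f := PrimeDivisor.ideal) (hfin.subset ?_)
    (fun P _ Q _ h => PrimeDivisor.ext h)
  rintro _ ⟨P, hP, rfl⟩
  exact mem_minimalPrimes_of_ord (S := Localization.AtPrime P.ideal) P.ideal f
    (fun h => hP (by simpa [ordAt] using h))

/-- The divisor of zeros of (the section given by) a form `f`. -/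
def divOf (f : MvPolynomial (ι × Fin 3) K ⧸ J) : WeilDiv J :=
  Finsupp.ofSupportFinite (fun P => (ordAt P f : ℤ)) (ordAt_support_finite f)

/-- Linear equivalence on an integral subscheme: `D - D'` is the divisor of a nonzero rational
function, that is, of a quotient `f / g` of two nonzero forms of the same multidegree. -/
def LinEquiv (D D' : WeilDiv J) : Prop :=
  ∃ (d : ι → ℕ) (f g : MvPolynomial (ι × Fin 3) K), IsForm f d ∧ IsForm g d ∧ f ∉ J ∧ g ∉ J ∧
    D - D' = divOf (Ideal.Quotient.mk J f) - divOf (Ideal.Quotient.mk J g)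

/-- A field over which the generic point of `P` has homogeneous coordinates: the residue field at `P`
of the multihomogeneous coordinate ring `R`, that is, the fraction field of `R / P`. -/
abbrev CoordField (P : PrimeDivisor J) : Type u := P.ideal.ResidueField

/-- Evaluation of polynomials at the homogeneous coordinates of the generic point of `P`. -/
def evalGen (P : PrimeDivisor J) : MvPolynomial (ι × Fin 3) K →+* CoordField P :=
  (algebraMap (MvPolynomial (ι × Fin 3) K ⧸ J) (CoordField P)).comp (Ideal.Quotient.mk J)

/-- For a map `φ` from another multigraded polynomial ring, the subfield of `CoordField P` generated
by the values at the generic point of the quotients `φ f / φ g`, where `f` and `g` are forms of the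
same multidegree. -/
def ratioField {κ : Type} [DecidableEq κ] (P : PrimeDivisor J)
    (φ : MvPolynomial (κ × Fin 3) K →+* MvPolynomial (ι × Fin 3) K) : Subfield (CoordField P) :=
  Subfield.closure {u | ∃ (d : κ → ℕ) (f g : MvPolynomial (κ × Fin 3) K), IsForm f d ∧ IsForm g d ∧
    u = evalGen P (φ f) / evalGen P (φ g)}

end General

/-! ## The projections forgetting one of three factors

The factors are numbered `x = 0`, `y = 1`, `z = 2`; the projection with index `i : Fin 3` forgets
the factor `i`, its target being the product of the two planes indexed by `{t // t ≠ i}`. -/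

section Projection

variable {K : Type u} [Field K]

/-- The coordinate ring of the target of the projection `i`, inside that of `(ℙ²)³`. -/
def incl (i : Fin 3) :
    MvPolynomial ({t : Fin 3 // t ≠ i} × Fin 3) K →+* MvPolynomial (Fin 3 × Fin 3) K :=
  (rename (fun v : {t : Fin 3 // t ≠ i} × Fin 3 => ((v.1 : Fin 3), v.2))).toRingHom

/-- The map of coordinate rings corresponding to the projection `X → ℙ² × ℙ²` forgetting the factor
`i`; the target `ℙ² × ℙ²` is the subscheme defined by the zero ideal. -/
def projHom (J : Ideal (MvPolynomial (Fin 3 × Fin 3) K)) (i : Fin 3) :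
    (MvPolynomial ({t : Fin 3 // t ≠ i} × Fin 3) K ⧸
      (⊥ : Ideal (MvPolynomial ({t : Fin 3 // t ≠ i} × Fin 3) K))) →+*
      (MvPolynomial (Fin 3 × Fin 3) K ⧸ J) :=
  Ideal.Quotient.lift ⊥ ((Ideal.Quotient.mk J).comp (incl i)) (by
    intro a ha
    rw [Ideal.mem_bot.mp ha, map_zero])

/-- Weil divisors on the target `ℙ² × ℙ²` of the projection `i`. -/
abbrev BaseDiv (K : Type u) [Field K] (i : Fin 3) : Type u :=
  WeilDiv (⊥ : Ideal (MvPolynomial ({t : Fin 3 // t ≠ i} × Fin 3) K))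

/-- The hyperplane divisor `{ first coordinate of the factor t vanishes }` on `ℙ² × ℙ²`. -/
def hyperplane (K : Type u) [Field K] (i : Fin 3) (t : {t : Fin 3 // t ≠ i}) : BaseDiv K i :=
  divOf (Ideal.Quotient.mk _ (X (t, 0)))

open Classical in
/-- Proper push-forward of a prime divisor `P` along the projection `i`: it is `[κ(P) : κ(q)] • q` if
the image `q` of `P` is again a prime divisor, and `0` if `P` is contracted.  The residue fields are
the fields of quotients of forms of equal multidegree, both taken inside `CoordField P`. -/
def pushPrime {J : Ideal (MvPolynomial (Fin 3 × Fin 3) K)} (i : Fin 3) (P : PrimeDivisor J) :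
    BaseDiv K i :=
  if h : ∃ q : PrimeDivisor (⊥ : Ideal (MvPolynomial ({t : Fin 3 // t ≠ i} × Fin 3) K)),
      q.ideal = P.ideal.comap (projHom J i) then
    Finsupp.single h.choose
      ((Subfield.relfinrank (ratioField P (incl i)) (ratioField P (RingHom.id _)) : ℕ) : ℤ)
  else 0

/-- Push-forward of Weil divisors along the projection `i`. -/
def push {J : Ideal (MvPolynomial (Fin 3 × Fin 3) K)} (i : Fin 3) : WeilDiv J →+ BaseDiv K i :=
  Finsupp.liftAddHom fun P => (zmultiplesHom (BaseDiv K i)) (pushPrime i P)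

open Classical in
/-- Pull-back of a prime divisor `q` of `ℙ² × ℙ²` along the projection `i`: the divisor on `X` of the
pulled back equation of `q`. (Every prime divisor of `ℙ² × ℙ²` is defined by one equation.) -/
def pullPrime (J : Ideal (MvPolynomial (Fin 3 × Fin 3) K)) (i : Fin 3)
    (q : PrimeDivisor (⊥ : Ideal (MvPolynomial ({t : Fin 3 // t ≠ i} × Fin 3) K))) : WeilDiv J :=
  if h : ∃ g, q.ideal = Ideal.span {g} then divOf (projHom J i h.choose) else 0

/-- Pull-back of divisors along the projection `i`. -/
def pull (J : Ideal (MvPolynomial (Fin 3 × Fin 3) K)) (i : Fin 3) : BaseDiv K i →+ WeilDiv J :=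
  Finsupp.liftAddHom fun q => (zmultiplesHom (WeilDiv J)) (pullPrime J i q)

end Projection

/-! ## The family `X^{A,B}` -/

section Family

variable {K : Type u} [Field K]

/-- The form `L = ∑ a_{s₀ s₁ s₂} x_{s₀} y_{s₁} z_{s₂}` of multidegree `(1,1,1)`. -/
def formL (A : (Fin 3 → Fin 3) → K) : MvPolynomial (Fin 3 × Fin 3) K :=
  ∑ s : Fin 3 → Fin 3, C (A s) * ∏ t, X (t, s t)

/-- The form `Q = ∑ b_{s,s'} x_{s₀} x_{s'₀} y_{s₁} y_{s'₁} z_{s₂} z_{s'₂}` of multidegree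
`(2,2,2)`. -/
def formQ (B : (Fin 3 → Fin 3) → (Fin 3 → Fin 3) → K) : MvPolynomial (Fin 3 × Fin 3) K :=
  ∑ s : Fin 3 → Fin 3, ∑ s' : Fin 3 → Fin 3, C (B s s') * ∏ t, (X (t, s t) * X (t, s' t))

/-- The ideal of `X^{A,B}`. -/
def idealX (A : (Fin 3 → Fin 3) → K) (B : (Fin 3 → Fin 3) → (Fin 3 → Fin 3) → K) :
    Ideal (MvPolynomial (Fin 3 × Fin 3) K) :=
  Ideal.span {formL A, formQ B}

/-- `L_k`: the coefficient of the `k`-th variable of the factor `i` in `L`, a form in the other two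
factors. -/
def coeffL (A : (Fin 3 → Fin 3) → K) (i k : Fin 3) :
    MvPolynomial ({t : Fin 3 // t ≠ i} × Fin 3) K :=
  ∑ s : Fin 3 → Fin 3, if s i = k then C (A s) * ∏ t : {t : Fin 3 // t ≠ i}, X (t, s t) else 0

/-- `Q_{k,n}`: the coefficient of the product of the `k`-th and `n`-th variables of the factor `i` in
`Q`, a form in the other two factors. -/
def coeffQ (B : (Fin 3 → Fin 3) → (Fin 3 → Fin 3) → K) (i k n : Fin 3) :
    MvPolynomial ({t : Fin 3 // t ≠ i} × Fin 3) K :=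
  ∑ s : Fin 3 → Fin 3, ∑ s' : Fin 3 → Fin 3,
    if (s i = k ∧ s' i = n) ∨ (s i = n ∧ s' i = k) then
      C (B s s') * ∏ t : {t : Fin 3 // t ≠ i}, (X (t, s t) * X (t, s' t)) else 0

/-- `G_k = L_p² Q_{qq} - L_p L_q Q_{pq} + L_q² Q_{pp}`, where `{p, q, k} = {0, 1, 2}`. -/
def formG (A : (Fin 3 → Fin 3) → K) (B : (Fin 3 → Fin 3) → (Fin 3 → Fin 3) → K) (i k : Fin 3) :
    MvPolynomial ({t : Fin 3 // t ≠ i} × Fin 3) K :=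
  coeffL A i (k + 1) ^ 2 * coeffQ B i (k + 2) (k + 2)
    - coeffL A i (k + 1) * coeffL A i (k + 2) * coeffQ B i (k + 1) (k + 2)
    + coeffL A i (k + 2) ^ 2 * coeffQ B i (k + 1) (k + 1)

/-- `H_{p,q} = 2 L_p L_q Q_{kk} - L_p L_k Q_{qk} - L_q L_k Q_{pk} + L_k² Q_{pq}`, where
`{p, q, k} = {0, 1, 2}`; it is indexed by `k`. -/
def formH (A : (Fin 3 → Fin 3) → K) (B : (Fin 3 → Fin 3) → (Fin 3 → Fin 3) → K) (i k : Fin 3) :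
    MvPolynomial ({t : Fin 3 // t ≠ i} × Fin 3) K :=
  2 * coeffL A i (k + 1) * coeffL A i (k + 2) * coeffQ B i k k
    - coeffL A i (k + 1) * coeffL A i k * coeffQ B i (k + 2) k
    - coeffL A i (k + 2) * coeffL A i k * coeffQ B i (k + 1) k
    + coeffL A i k ^ 2 * coeffQ B i (k + 1) (k + 2)

variable (A : (Fin 3 → Fin 3) → K) (B : (Fin 3 → Fin 3) → (Fin 3 → Fin 3) → K)

/-- The divisors `D_x, D_y, D_z` on `X^{A,B}`, where the first coordinate of the factor `i`
vanishes. -/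
def coordDiv (i : Fin 3) : WeilDiv (idealX A B) := divOf (Ideal.Quotient.mk _ (X (i, 0)))

/-- The generic point of `P` lies in the open set `U_i`, the complement in `X` of the common zeros of
the forms `G_k` and `H_{p,q}` in the factors other than `i`, i.e. of the union of the fibres of
positive dimension of the projection `i`. -/
def MemU (i : Fin 3) (P : PrimeDivisor (idealX A B)) : Prop :=
  ∃ k : Fin 3, projHom (idealX A B) i (Ideal.Quotient.mk _ (formG A B i k)) ∉ P.ideal ∨
    projHom (idealX A B) i (Ideal.Quotient.mk _ (formH A B i k)) ∉ P.ideal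

variable {A B}

/-- The restriction of a polynomial to the plane of the factor `i` through the generic point of `P`:
the other coordinates are specialised to those of the generic point. -/
def restrictFibre (i : Fin 3) (P : PrimeDivisor (idealX A B))
    (f : MvPolynomial (Fin 3 × Fin 3) K) : MvPolynomial (Fin 3) (CoordField P) :=
  eval₂ (C.comp ((evalGen P).comp C))
    (fun v => if v.1 = i then X v.2 else C (evalGen P (X v))) f

/-- The point `P'` is the image of the point `P` under the involution `σ_i`.  Let `a` be the `i`-th
coordinate vector of the generic point of `P`.  Its fibre under the projection `i` is the
intersection of the line `L(·) = 0` with the conic `Q(·) = 0` in the plane of the factor `i`.  The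
point `σ_i(P)` has as `i`-th coordinate vector the second intersection point `a'`, i.e. the conic
cuts the divisor `a + a'` on the line: modulo the equation of the line, `Q` is a product of two
linear forms, the first vanishing at `a` and the second at `a'`.  The other coordinates are those
of `P`. -/
def IsSigma (i : Fin 3) (P P' : PrimeDivisor (idealX A B)) : Prop :=
  ∃ a' : Fin 3 → CoordField P, a' ≠ 0 ∧
    eval a' (restrictFibre i P (formL A)) = 0 ∧
    (∃ M M' : MvPolynomial (Fin 3) (CoordField P), M.IsHomogeneous 1 ∧ M'.IsHomogeneous 1 ∧
      restrictFibre i P (formL A) ∣ restrictFibre i P (formQ B) - M * M' ∧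
      eval (fun j => evalGen P (X (i, j))) M = 0 ∧ eval a' M' = 0) ∧
    ∀ (d : Fin 3 → ℕ) (f : MvPolynomial (Fin 3 × Fin 3) K), IsForm f d →
      (Ideal.Quotient.mk _ f ∈ P'.ideal ↔ eval a' (restrictFibre i P f) = 0)

open Classical in
/-- `σ_i^* Y` for a prime divisor `Y` with generic point `P`: the closure of the preimage of `Y` under
the involution `σ_i : U_i → U_i`. -/
def sigmaPrime (i : Fin 3) (P : PrimeDivisor (idealX A B)) : WeilDiv (idealX A B) :=
  if h : ∃ P' : PrimeDivisor (idealX A B), MemU A B i P' ∧ IsSigma i P' P then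
    Finsupp.single h.choose 1
  else 0

variable (A B)

/-- The map `σ_i^*` on Weil divisors. -/
def sigmaPull (i : Fin 3) : WeilDiv (idealX A B) →+ WeilDiv (idealX A B) :=
  Finsupp.liftAddHom fun P => (zmultiplesHom (WeilDiv (idealX A B))) (sigmaPrime i P)

end Family

end ThreeInvolutions

end

open ThreeInvolutions

set_option linter.unusedSectionVars false

noncomputable section

namespace ThreeInvolutions

/-! ## Lines and conics in a plane over a ring -/

section LineConic

variable {S : Type*} [CommRing S]

/-! Fix one projection. Over a point of the base, a fibre of X is the set of common zeros of a
linear form `l` and a quadratic form `q` in three variables: the isotropic lines of `q` on the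
two-dimensional space `lin l x = 0`. For a constant vector `c`, the vector `s = c × l` lies in this
space, and the reflection in `s` exchanges the two isotropic lines. Multiplied by `-q(s)` it becomes
polynomial (`reflect`), in every characteristic. It therefore defines an endomorphism `conj` of the
coordinate ring of X over the base, whose square scales the fibre coordinates by `q(s) ^ 2`. As a
quadratic form in `c`, `q(c × l)` has the coefficients `G_k` and `-H_k`. Hence a prime divisor meets
`U_i` exactly when some `q(c × l)` does not vanish along it (`exists_discForm_notMem`), and there
`conj` realises the involution. With `v = lin c x`, Vieta's formula for the quadratic equation of
`x_k / v` gives the central identity `x_k * conj x_k = -(v ^ 2 * G_k)` (`fibX_mul_conjX`).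

For (b), `conj` identifies the local rings at a prime divisor P and at its conjugate, and `v` is a
unit at P. So `ord_P x_0` plus the order of `x_0` at the conjugate is `ord_P G_0`. This makes the
sum of `D_i` and its transform the divisor of `G_0`, which has the multidegree of the product of the
fourth powers of the other two first coordinates; those coordinates are fixed by `conj`. That the
conjugate prime divisor is the one described by `IsSigma` is the content of `isSigma_conjDiv` and
`eq_conjDiv_of_isSigma`.

For (a), the pulled back hyperplane is `D_i`, and the coefficient of its push-forward at a prime `g`
of the base is the sum of `ord_P x_0` times the residue degree over the prime divisors P above `g`.
Conjugation permutes these P and preserves residue degrees, so twice this sum is the same sum for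
`G_0`. If `n` is the multiplicity of `g` in `G_0`, the latter is `n` times the sum for `g`, that is
`2n`, because X has degree two over the base. This last fact is the identity "sum of e f = 2"
(`sum_ordAt_base_mul_relfinrank`). It is proved over the polynomial ring in one variable `T` over
the base ring, with `T` mapped to `v`, since this accounts for the scaling of the fibre coordinates.

The complete intersection hypothesis enters through `formG_ne_zero` and `exists_not_dvd_discForm`
(finite fibres in codimension one). Both come from the fact that, modulo `L`, `l_p ^ 2 * Q` is a
quadratic form in the two other fibre coordinates with coefficients among the `G` and `H`. -/

/-- The linear form with coefficient vector `l`. -/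
def lin (l x : Fin 3 → S) : S := l 0 * x 0 + l 1 * x 1 + l 2 * x 2

/-- The quadratic form with coefficients `q`, of which only `q k k` and `q k (k + 1)` are used. -/
def quad (q : Fin 3 → Fin 3 → S) (x : Fin 3 → S) : S :=
  q 0 0 * x 0 ^ 2 + q 1 1 * x 1 ^ 2 + q 2 2 * x 2 ^ 2 +
    q 1 2 * (x 1 * x 2) + q 2 0 * (x 2 * x 0) + q 0 1 * (x 0 * x 1)

/-- The polar form of `quad q`. -/
def bil (q : Fin 3 → Fin 3 → S) (x w : Fin 3 → S) : S :=
  2 * q 0 0 * (x 0 * w 0) + 2 * q 1 1 * (x 1 * w 1) + 2 * q 2 2 * (x 2 * w 2) +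
    q 1 2 * (x 1 * w 2 + x 2 * w 1) + q 2 0 * (x 2 * w 0 + x 0 * w 2) +
    q 0 1 * (x 0 * w 1 + x 1 * w 0)

/-- The vector product. -/
def cross (a b : Fin 3 → S) : Fin 3 → S := fun k => a (k + 1) * b (k + 2) - a (k + 2) * b (k + 1)

/-- The opposite of the reflection in the vector `s`, multiplied by `quad q s`. -/
def reflect (q : Fin 3 → Fin 3 → S) (s x : Fin 3 → S) : Fin 3 → S :=
  fun k => bil q x s * s k - quad q s * x k

/-- The value of `quad q` at the point of the line `lin l = 0` with vanishing `k`-th coordinate. -/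
def gCoeff (l : Fin 3 → S) (q : Fin 3 → Fin 3 → S) (k : Fin 3) : S :=
  l (k + 1) ^ 2 * q (k + 2) (k + 2) - l (k + 1) * l (k + 2) * q (k + 1) (k + 2)
    + l (k + 2) ^ 2 * q (k + 1) (k + 1)

/-- The polarisation of `gCoeff`, up to sign. -/
def hCoeff (l : Fin 3 → S) (q : Fin 3 → Fin 3 → S) (k : Fin 3) : S :=
  2 * l (k + 1) * l (k + 2) * q k k - l (k + 1) * l k * q (k + 2) k
    - l (k + 2) * l k * q k (k + 1) + l k ^ 2 * q (k + 1) (k + 2)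

/-- The value of the quadratic form at the vector `c × l` of the line `lin l = 0`. -/
def disc (l : Fin 3 → S) (q : Fin 3 → Fin 3 → S) (c : Fin 3 → S) : S := quad q (cross c l)

/-- The middle coefficient of the quadratic equation satisfied by the `k`-th coordinate of a common
zero of `lin l` and `quad q`. -/
def midCoeff (l : Fin 3 → S) (q : Fin 3 → Fin 3 → S) (c : Fin 3 → S) (k : Fin 3) : S :=
  bil q (cross c l) (cross l (Pi.single k 1))

theorem fin3_two_add_one : (2 : Fin 3) + 1 = 0 := rfl
theorem fin3_two_add_two : (2 : Fin 3) + 2 = 1 := rfl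
theorem fin3_one_add_two : (1 : Fin 3) + 2 = 0 := rfl
theorem fin3_one_add_one : (1 : Fin 3) + 1 = 2 := rfl

/-! ### Compatibility with ring homomorphisms. -/

section Map

variable {S' : Type*} [CommRing S'] (f : S →+* S')

theorem map_lin (l x : Fin 3 → S) : f (lin l x) = lin (fun k => f (l k)) (fun k => f (x k)) := by
  simp [lin]

theorem map_quad (q : Fin 3 → Fin 3 → S) (x : Fin 3 → S) :
    f (quad q x) = quad (fun k n => f (q k n)) (fun k => f (x k)) := by
  simp [quad]

theorem map_bil (q : Fin 3 → Fin 3 → S) (x w : Fin 3 → S) :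
    f (bil q x w) = bil (fun k n => f (q k n)) (fun k => f (x k)) (fun k => f (w k)) := by
  simp [bil, map_ofNat]

theorem map_cross (a b : Fin 3 → S) (k : Fin 3) :
    f (cross a b k) = cross (fun k => f (a k)) (fun k => f (b k)) k := by
  simp [cross]

theorem map_disc (l : Fin 3 → S) (q : Fin 3 → Fin 3 → S) (c : Fin 3 → S) :
    f (disc l q c) = disc (fun k => f (l k)) (fun k n => f (q k n)) (fun k => f (c k)) := by
  simp [disc, map_quad, map_cross]

theorem map_gCoeff (l : Fin 3 → S) (q : Fin 3 → Fin 3 → S) (k : Fin 3) :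
    f (gCoeff l q k) = gCoeff (fun k => f (l k)) (fun k n => f (q k n)) k := by
  simp [gCoeff]

theorem map_hCoeff (l : Fin 3 → S) (q : Fin 3 → Fin 3 → S) (k : Fin 3) :
    f (hCoeff l q k) = hCoeff (fun k => f (l k)) (fun k n => f (q k n)) k := by
  simp [hCoeff, map_ofNat]

theorem map_reflect (q : Fin 3 → Fin 3 → S) (s x : Fin 3 → S) (k : Fin 3) :
    f (reflect q s x k) =
      reflect (fun k n => f (q k n)) (fun k => f (s k)) (fun k => f (x k)) k := by
  simp [reflect, map_quad, map_bil]

theorem map_midCoeff (l : Fin 3 → S) (q : Fin 3 → Fin 3 → S) (c : Fin 3 → S) (k : Fin 3) :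
    f (midCoeff l q c k) =
      midCoeff (fun k => f (l k)) (fun k n => f (q k n)) (fun k => f (c k)) k := by
  have h : (fun n => f (Pi.single (M := fun _ : Fin 3 => S) k 1 n)) = Pi.single k 1 := by
    ext n
    by_cases h : n = k
    · subst h; simp
    · simp [h]
  simp [midCoeff, map_bil, map_cross, h]

end Map

variable (l : Fin 3 → S) (q : Fin 3 → Fin 3 → S) (c s x : Fin 3 → S)

theorem lin_smul (a : S) : lin l (fun k => a * x k) = a * lin l x := by
  simp only [lin]; ring

theorem quad_smul (a : S) : quad q (fun k => a * x k) = a ^ 2 * quad q x := by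
  simp only [quad]; ring

theorem quad_add (y : Fin 3 → S) :
    quad q (fun k => x k + y k) = quad q x + bil q x y + quad q y := by
  simp only [quad, bil]; ring

theorem bil_smul_left (a : S) (y : Fin 3 → S) :
    bil q (fun k => a * x k) y = a * bil q x y := by
  simp only [bil]; ring

theorem bil_smul_right (a : S) (y : Fin 3 → S) :
    bil q x (fun k => a * y k) = a * bil q x y := by
  simp only [bil]; ring

theorem lin_cross : lin l (cross c l) = 0 := by
  simp only [lin, cross, zero_add, fin3_two_add_one, fin3_two_add_two, fin3_one_add_one,
    fin3_one_add_two]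
  ring

theorem lin_reflect (hs : lin l s = 0) : lin l (reflect q s x) = -quad q s * lin l x := by
  simp only [lin, reflect] at *
  linear_combination bil q x s * hs

/-- `reflect q s` is `-quad q s` times the reflection in `s`, which is an isometry. Clearing the
denominator turns this into a polynomial identity, valid over any ring and also where `quad q s` is
not invertible. -/
theorem quad_reflect : quad q (reflect q s x) = quad q s ^ 2 * quad q x := by
  simp only [quad, reflect, bil]
  ring

theorem reflect_reflect (k : Fin 3) : reflect q s (reflect q s x) k = quad q s ^ 2 * x k := by
  have h : bil q (reflect q s x) s = quad q s * bil q x s := by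
    simp only [bil, reflect, quad]; ring
  simp only [reflect] at h ⊢
  rw [h]; ring

theorem reflect_smul (a : S) (k : Fin 3) :
    reflect q s (fun n => a * x n) k = a * reflect q s x k := by
  simp only [reflect, bil_smul_left]; ring

theorem lin_coord_cross : lin c (cross c l) = 0 := by
  simp only [lin, cross, zero_add, fin3_two_add_one, fin3_two_add_two, fin3_one_add_one,
    fin3_one_add_two]
  ring

theorem cross_coord (k : Fin 3) : lin c (cross l (Pi.single k 1)) = cross c l k := by
  fin_cases k <;>
  simp [lin, cross, fin3_two_add_one, fin3_two_add_two, fin3_one_add_one,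
    fin3_one_add_two] <;> ring

/-- The vector `l × e_k` lies on the line `lin l = 0` and has vanishing `k`-th coordinate. -/
theorem gCoeff_eq_quad (k : Fin 3) : gCoeff l q k = quad q (cross l (Pi.single k 1)) := by
  fin_cases k <;>
  simp [gCoeff, quad, cross, fin3_two_add_one, fin3_two_add_two,
    fin3_one_add_one, fin3_one_add_two] <;> ring

theorem lin_cross' : lin l (cross l c) = 0 := by
  simp only [lin, cross, zero_add, fin3_two_add_one, fin3_two_add_two, fin3_one_add_one,
    fin3_one_add_two]
  ring

theorem cross_single_self (k : Fin 3) : cross l (Pi.single k 1) k = 0 := by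
  fin_cases k <;> simp [cross, fin3_two_add_one, fin3_two_add_two,
    fin3_one_add_one, fin3_one_add_two]

variable {l q x}

/-- Every vector of the line `lin l = 0` is a combination of the two vectors `c × l` and `l × e_k`
of this line. -/
theorem coord_eq (hl : lin l x = 0) (k n : Fin 3) :
    cross c l k * x n = x k * cross c l n + lin c x * cross l (Pi.single k 1) n := by
  simp only [lin] at hl
  fin_cases k <;> fin_cases n <;>
  simp [lin, cross, fin3_two_add_one, fin3_two_add_two, fin3_one_add_one,
    fin3_one_add_two] <;> first
    | ring1
    | linear_combination (c 0) * hl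
    | linear_combination (c 1) * hl
    | linear_combination (c 2) * hl
    | linear_combination -(c 0) * hl
    | linear_combination -(c 1) * hl
    | linear_combination -(c 2) * hl

/-- Obtained by expanding `quad q` on the decomposition `coord_eq` of `x` along `c × l` and `l ×
e_k`. It is the quadratic equation for `x k` relative to `lin c x`. -/
theorem quad_coord (hl : lin l x = 0) (hq : quad q x = 0) (k : Fin 3) :
    disc l q c * x k ^ 2 + midCoeff l q c k * lin c x * x k + gCoeff l q k * lin c x ^ 2 = 0 := by
  have h1 : quad q (fun n => cross c l k * x n) = 0 := by rw [quad_smul, hq, mul_zero]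
  have h2 : (fun n => cross c l k * x n) = fun n =>
      x k * cross c l n + lin c x * cross l (Pi.single k 1) n := funext (coord_eq c hl k)
  rw [h2, quad_add, quad_smul, quad_smul, bil_smul_left, bil_smul_right, ← gCoeff_eq_quad] at h1
  rw [disc, midCoeff]
  linear_combination h1

/-- Pairing `coord_eq` with `s = c × l` gives `s k * bil q x s = 2 * D * x k + midCoeff * lin c x`,
where `D = quad q s`; subtracting `D * x k` leaves the right-hand side. By Vieta this is, for a zero
`x` of `quad q`, `-D` times the other root. -/
theorem reflect_coord (hl : lin l x = 0) (k : Fin 3) :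
    reflect q (cross c l) x k = disc l q c * x k + midCoeff l q c k * lin c x := by
  have h1 : cross c l k * bil q x (cross c l) = bil q (fun n => cross c l k * x n) (cross c l) := by
    rw [bil_smul_left]
  have h2 : (fun n => cross c l k * x n) = fun n =>
      x k * cross c l n + lin c x * cross l (Pi.single k 1) n := funext (coord_eq c hl k)
  rw [h2] at h1
  have h3 : bil q (fun n => x k * cross c l n + lin c x * cross l (Pi.single k 1) n) (cross c l)
      = x k * (2 * quad q (cross c l)) +
        lin c x * bil q (cross c l) (cross l (Pi.single k 1)) := by
    simp only [bil, quad]; ring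
  rw [reflect, disc, midCoeff]
  linear_combination h1 + h3

/-- The product of a coordinate with its conjugate. -/
theorem mul_reflect (hl : lin l x = 0) (hq : quad q x = 0) (k : Fin 3) :
    x k * reflect q (cross c l) x k = -(lin c x ^ 2 * gCoeff l q k) := by
  rw [reflect_coord c hl]
  linear_combination quad_coord c hl hq k

theorem lin_coord_reflect : lin c (reflect q (cross c l) x) = -(disc l q c * lin c x) := by
  have := lin_reflect c q (cross c l) x (lin_coord_cross l c)
  rw [this, disc]; ring

/-- Elimination of `x p` by means of `l p * x p = lin l x - ...`. The terms that remain show that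
common factors of the `G` and `H` force relations between the line and the conic. -/
theorem sq_mul_quad (l x : Fin 3 → S) (q : Fin 3 → Fin 3 → S) (p : Fin 3) :
    l p ^ 2 * quad q x = x (p + 1) ^ 2 * gCoeff l q (p + 2) + x (p + 2) ^ 2 * gCoeff l q (p + 1) +
      x (p + 1) * x (p + 2) * hCoeff l q p +
      lin l x * (l p * bil q x (Pi.single p 1) - lin l x * q p p) := by
  fin_cases p <;>
  simp [gCoeff, hCoeff, quad, lin, bil, fin3_two_add_one, fin3_two_add_two, fin3_one_add_one,
    fin3_one_add_two] <;> ring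

theorem disc_single (l : Fin 3 → S) (q : Fin 3 → Fin 3 → S) (k : Fin 3) :
    disc l q (Pi.single k 1) = gCoeff l q k := by
  fin_cases k <;>
  simp [gCoeff, disc, quad, cross, fin3_two_add_one, fin3_two_add_two,
    fin3_one_add_one, fin3_one_add_two] <;> ring

/-- `disc l q` is a quadratic form in `c` with diagonal coefficients `gCoeff` and mixed coefficients
`-hCoeff`. Values at vectors with entries 0 and 1 recover all of them without dividing by 2. -/
theorem disc_single_add (l : Fin 3 → S) (q : Fin 3 → Fin 3 → S) (k : Fin 3) :
    disc l q (Pi.single (k + 1) 1 + Pi.single (k + 2) 1) =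
      gCoeff l q (k + 1) + gCoeff l q (k + 2) - hCoeff l q k := by
  fin_cases k <;>
  simp [gCoeff, hCoeff, disc, quad, cross, fin3_two_add_one, fin3_two_add_two,
    fin3_one_add_one, fin3_one_add_two] <;> ring

end LineConic

/-! ## Forms -/

section Forms

variable {ι : Type} [Fintype ι] [DecidableEq ι] {K : Type u} [Field K]

theorem weight_multideg (m : ι × Fin 3 →₀ ℕ) (t : ι) :
    Finsupp.weight (multideg ι) m t = ∑ j, m (t, j) := by
  rw [Finsupp.weight_apply, Finsupp.sum_fintype _ _ (by simp), Finset.sum_apply,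
    Fintype.sum_prod_type, Finset.sum_eq_single t]
  · simp [multideg]
  · intro b _ hb
    simp [multideg, hb.symm]
  · simp

theorem isForm_X (t : ι) (j : Fin 3) :
    IsForm (X (t, j) : MvPolynomial (ι × Fin 3) K) (Pi.single t 1) :=
  isWeightedHomogeneous_X K (multideg ι) (t, j)

theorem isForm_component (f : MvPolynomial (ι × Fin 3) K) (d : ι → ℕ) :
    IsForm (weightedHomogeneousComponent (multideg ι) d f) d :=
  weightedHomogeneousComponent_isWeightedHomogeneous d f

/-- Homogeneous components of a product with a form. -/
theorem component_mul_form (f h : MvPolynomial (ι × Fin 3) K) (d e : ι → ℕ) (hh : IsForm h e) :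
    weightedHomogeneousComponent (multideg ι) (d + e) (f * h) =
      weightedHomogeneousComponent (multideg ι) d f * h := by
  induction f using MvPolynomial.induction_on' with
  | monomial m a =>
    have hm : IsForm (monomial m a : MvPolynomial (ι × Fin 3) K)
        (Finsupp.weight (multideg ι) m) := isWeightedHomogeneous_monomial _ _ _ rfl
    have hmh : IsForm (monomial m a * h) (Finsupp.weight (multideg ι) m + e) := hm.mul hh
    rw [weightedHomogeneousComponent_of_mem hmh, weightedHomogeneousComponent_of_mem hm]
    simp [ite_mul]
  | add p q hp hq => rw [add_mul, map_add, hp, hq, map_add, add_mul]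

/-- Two homomorphisms which differ by a scaling of the coordinates of the factors. -/
theorem map_form_scale {A : Type*} [CommRing A] (f₁ f₂ : MvPolynomial (ι × Fin 3) K →+* A)
    (u : ι → A) (hC : ∀ a, f₁ (C a) = f₂ (C a)) (hX : ∀ v, f₁ (X v) = u v.1 * f₂ (X v))
    {f : MvPolynomial (ι × Fin 3) K} {d : ι → ℕ} (hf : IsForm f d) :
    f₁ f = (∏ t, u t ^ d t) * f₂ f := by
  refine IsWeightedHomogeneous.induction_on
    (motive := fun f _ => f₁ f = (∏ t, u t ^ d t) * f₂ f) (by simp) ?_ ?_ hf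
  · intro p q _ _ hp hq
    rw [map_add, map_add, hp, hq, mul_add]
  · intro m a hm
    have hd : ∀ t, d t = ∑ j, m (t, j) := fun t => by rw [← hm, weight_multideg]
    rw [monomial_eq, map_mul, map_mul, hC, Finsupp.prod_fintype _ _ (by simp), map_prod, map_prod]
    simp only [map_pow, hX, mul_pow, Finset.prod_mul_distrib]
    have : ∏ v : ι × Fin 3, u v.1 ^ m v = ∏ t, u t ^ d t := by
      rw [Fintype.prod_prod_type]
      refine Finset.prod_congr rfl fun t _ => ?_
      rw [hd]
      exact Finset.prod_pow_eq_pow_sum Finset.univ (fun j => m (t, j)) (u t)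
    rw [this]; ring

/-- When all variables of a factor `t` go to forms of one multidegree `δ t`, the multidegree of a
monomial is transformed linearly. This serves both the inclusion of the base and the conjugation. -/
theorem IsForm.map_hom {κ : Type} [Fintype κ] [DecidableEq κ]
    (φ : MvPolynomial (κ × Fin 3) K →+* MvPolynomial (ι × Fin 3) K) (δ : κ → ι → ℕ)
    (hC : ∀ a, φ (C a) = C a) (hX : ∀ v, IsForm (φ (X v)) (δ v.1))
    {f : MvPolynomial (κ × Fin 3) K} {d : κ → ℕ} (hf : IsForm f d) :
    IsForm (φ f) (∑ t, d t • δ t) := by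
  refine IsWeightedHomogeneous.induction_on
    (motive := fun f _ => IsForm (φ f) (∑ t, d t • δ t)) ?_ ?_ ?_ hf
  · rw [map_zero]; exact isWeightedHomogeneous_zero _ _ _
  · intro p q _ _ hp hq
    rw [map_add]; exact hp.add hq
  · intro m a hm
    have hd : ∀ t, d t = ∑ j, m (t, j) := fun t => by rw [← hm, weight_multideg]
    rw [monomial_eq, map_mul, hC, Finsupp.prod_fintype _ _ (by simp), map_prod]
    refine IsWeightedHomogeneous.C_mul ?_ a
    have h1 := IsWeightedHomogeneous.prod (w := multideg ι) Finset.univ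
      (fun v => φ (X v ^ m v)) (fun v => m v • δ v.1) (fun v _ => by
        rw [map_pow]; exact (hX v).pow (m v))
    have h2 : ∑ v : κ × Fin 3, m v • δ v.1 = ∑ t, d t • δ t := by
      rw [Fintype.sum_prod_type]
      refine Finset.sum_congr rfl fun t _ => ?_
      rw [hd, Finset.sum_smul]
    rw [← h2]; exact h1

variable (ι) in
theorem induction_on_forms {motive : MvPolynomial (ι × Fin 3) K → Prop}
    (form : ∀ f d, IsForm f d → motive f) (add : ∀ f g, motive f → motive g → motive (f + g))
    (f : MvPolynomial (ι × Fin 3) K) : motive f := by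
  induction f using MvPolynomial.induction_on' with
  | monomial m a => exact form _ _ (isWeightedHomogeneous_monomial _ _ _ rfl)
  | add p q hp hq => exact add _ _ hp hq

/-- Components of the image of a polynomial under a homomorphism which maps forms to forms. -/
theorem component_map_hom {κ : Type} [Fintype κ] [DecidableEq κ]
    (φ : MvPolynomial (κ × Fin 3) K →+* MvPolynomial (ι × Fin 3) K) (T : (κ → ℕ) → ι → ℕ)
    (hT : Function.Injective T) (hφ : ∀ f d, IsForm f d → IsForm (φ f) (T d))
    (f : MvPolynomial (κ × Fin 3) K) (d : κ → ℕ) :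
    weightedHomogeneousComponent (multideg ι) (T d) (φ f) =
      φ (weightedHomogeneousComponent (multideg κ) d f) := by
  induction f using induction_on_forms κ with
  | form f e hf =>
    rw [weightedHomogeneousComponent_of_mem hf, weightedHomogeneousComponent_of_mem (hφ f e hf)]
    by_cases h : d = e
    · simp [h]
    · simp [h, hT.ne h]
  | add p q hp hq => rw [map_add, map_add, hp, hq, map_add, map_add]

/-- An ideal contains an element as soon as it contains its components. -/
theorem mem_of_component_mem {I : Ideal (MvPolynomial (ι × Fin 3) K)}
    {f : MvPolynomial (ι × Fin 3) K}
    (h : ∀ d, weightedHomogeneousComponent (multideg ι) d f ∈ I) : f ∈ I := by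
  rw [← sum_weightedHomogeneousComponent (multideg ι) f]
  exact finsum_induction (· ∈ I) I.zero_mem (fun _ _ => I.add_mem) h

/-- The homomorphism to polynomials in one variable for each factor which scales the coordinates of
each factor by its variable. -/
def torusHom {A : Type*} [CommRing A] (ev : MvPolynomial (ι × Fin 3) K →+* A) :
    MvPolynomial (ι × Fin 3) K →+* MvPolynomial ι A :=
  eval₂Hom (C.comp (ev.comp C)) (fun v => X v.1 * C (ev (X v)))

theorem torusHom_form {A : Type*} [CommRing A] (ev : MvPolynomial (ι × Fin 3) K →+* A)
    {f : MvPolynomial (ι × Fin 3) K} {d : ι → ℕ} (hf : IsForm f d) :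
    torusHom ev f = monomial (Finsupp.equivFunOnFinite.symm d) (ev f) := by
  rw [map_form_scale (torusHom ev) (C.comp ev) X (by simp [torusHom]) (by simp [torusHom]) hf,
    monomial_eq, Finsupp.prod_fintype _ _ (by simp), mul_comm]
  simp

theorem coeff_torusHom {A : Type*} [CommRing A] (ev : MvPolynomial (ι × Fin 3) K →+* A)
    (f : MvPolynomial (ι × Fin 3) K) (d : ι → ℕ) :
    coeff (Finsupp.equivFunOnFinite.symm d) (torusHom ev f) =
      ev (weightedHomogeneousComponent (multideg ι) d f) := by
  induction f using induction_on_forms ι with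
  | form f e hf =>
    rw [torusHom_form ev hf, coeff_monomial, weightedHomogeneousComponent_of_mem hf]
    by_cases h : d = e
    · simp [h]
    · simp [h, Ne.symm h]
  | add p q hp hq => rw [map_add, coeff_add, hp, hq, map_add, map_add]

/-- The kernel is therefore the largest multihomogeneous ideal inside the kernel of `ev`. If `A` is
a domain it is prime, since the target is a polynomial ring over `A`. -/
theorem torusHom_eq_zero_iff {A : Type*} [CommRing A] (ev : MvPolynomial (ι × Fin 3) K →+* A)
    (f : MvPolynomial (ι × Fin 3) K) :
    torusHom ev f = 0 ↔ ∀ d, ev (weightedHomogeneousComponent (multideg ι) d f) = 0 := by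
  simp_rw [← coeff_torusHom]
  refine ⟨fun h d => by simp [h], fun h => ?_⟩
  ext m
  simpa using h m

/-- A prime ideal of height one of the multihomogeneous coordinate ring which contains a nonzero form
is multihomogeneous. -/
theorem homogeneous_of_height_eq_one {J : Ideal (MvPolynomial (ι × Fin 3) K)} [J.IsPrime]
    {G : Set (MvPolynomial (ι × Fin 3) K)} (hJ : J = Ideal.span G)
    (hG : ∀ g ∈ G, ∃ d, IsForm g d) (P : Ideal (MvPolynomial (ι × Fin 3) K ⧸ J)) [P.IsPrime]
    (hP : P.height = 1) {f₀ : MvPolynomial (ι × Fin 3) K} {d₀ : ι → ℕ} (hf₀ : IsForm f₀ d₀)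
    (hf₀J : f₀ ∉ J) (hf₀P : Ideal.Quotient.mk J f₀ ∈ P) (f : MvPolynomial (ι × Fin 3) K)
    (hf : Ideal.Quotient.mk J f ∈ P) (d : ι → ℕ) :
    Ideal.Quotient.mk J (weightedHomogeneousComponent (multideg ι) d f) ∈ P := by
  set ev : MvPolynomial (ι × Fin 3) K →+* ((MvPolynomial (ι × Fin 3) K ⧸ J) ⧸ P) :=
    (Ideal.Quotient.mk P).comp (Ideal.Quotient.mk J) with hev
  have hev0 : ∀ f, ev f = 0 ↔ Ideal.Quotient.mk J f ∈ P := fun f => by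
    rw [hev, RingHom.comp_apply, Ideal.Quotient.eq_zero_iff_mem]
  -- `N` is the largest multihomogeneous ideal contained in the preimage of `P`, and it is prime.
  set N := RingHom.ker (torusHom (A := (MvPolynomial (ι × Fin 3) K ⧸ J) ⧸ P) ev) with hN
  have hNmem : ∀ f, f ∈ N ↔
      ∀ d, Ideal.Quotient.mk J (weightedHomogeneousComponent (multideg ι) d f) ∈ P := fun f => by
    rw [hN, RingHom.mem_ker, torusHom_eq_zero_iff]
    simp_rw [hev0]
  have hNform : ∀ g e, IsForm g e → Ideal.Quotient.mk J g ∈ P → g ∈ N := fun g e hg hgP => by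
    rw [hNmem]
    intro d
    rw [weightedHomogeneousComponent_of_mem hg]
    split_ifs
    · exact hgP
    · rw [map_zero]; exact P.zero_mem
  have hNp : N.IsPrime := RingHom.ker_isPrime _
  have hJN : J ≤ N := by
    rw [hJ, Ideal.span_le]
    intro g hg
    obtain ⟨e, he⟩ := hG g hg
    refine hNform g e he ?_
    rw [Ideal.Quotient.eq_zero_iff_mem.mpr (hJ ▸ Ideal.subset_span hg)]
    exact P.zero_mem
  have hmap : ∀ f, Ideal.Quotient.mk J f ∈ N.map (Ideal.Quotient.mk J) ↔ f ∈ N := fun f => by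
    rw [Ideal.mem_quotient_iff_mem hJN]
  have hpr : (N.map (Ideal.Quotient.mk J)).IsPrime :=
    Ideal.map_isPrime_of_surjective Ideal.Quotient.mk_surjective (by rwa [Ideal.mk_ker])
  have hle : N.map (Ideal.Quotient.mk J) ≤ P := by
    intro y hy
    obtain ⟨f, rfl⟩ := Ideal.Quotient.mk_surjective y
    rw [hmap, hNmem] at hy
    exact mem_of_component_mem (I := P.comap (Ideal.Quotient.mk J)) hy
  have hne : N.map (Ideal.Quotient.mk J) ≠ ⊥ := by
    intro h
    have : Ideal.Quotient.mk J f₀ ∈ N.map (Ideal.Quotient.mk J) :=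
      (hmap f₀).mpr (hNform f₀ d₀ hf₀ hf₀P)
    rw [h, Ideal.mem_bot, Ideal.Quotient.eq_zero_iff_mem] at this
    exact hf₀J this
  -- A nonzero prime contained in a prime of height one of a domain is equal to it; it is nonzero
  -- because it contains the form `f₀`.
  have heq : N.map (Ideal.Quotient.mk J) = P := by
    by_contra hneq
    have h1 := Ideal.height_strict_mono_of_isPrime_of_isPrime (lt_of_le_of_ne hle hneq)
    rw [hP, Order.lt_one_iff, Ideal.height_eq_zero_iff_eq_bot] at h1
    exact hne h1
  rw [← heq, hmap] at hf
  exact (hNmem f).mp hf d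

theorem PrimeDivisor.mem_iff {J : Ideal (MvPolynomial (ι × Fin 3) K)} (P : PrimeDivisor J)
    (f : MvPolynomial (ι × Fin 3) K) : Ideal.Quotient.mk J f ∈ P.ideal ↔
      ∀ d, Ideal.Quotient.mk J (weightedHomogeneousComponent (multideg ι) d f) ∈ P.ideal :=
  ⟨P.homogeneous f, mem_of_component_mem (I := P.ideal.comap (Ideal.Quotient.mk J))⟩

theorem PrimeDivisor.ext_forms {J : Ideal (MvPolynomial (ι × Fin 3) K)} {P P' : PrimeDivisor J}
    (h : ∀ f d, IsForm f d →
      (Ideal.Quotient.mk J f ∈ P.ideal ↔ Ideal.Quotient.mk J f ∈ P'.ideal)) : P = P' := by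
  ext y
  obtain ⟨f, rfl⟩ := Ideal.Quotient.mk_surjective y
  rw [P.mem_iff, P'.mem_iff]
  exact forall_congr' fun d => h _ d (isForm_component f d)

end Forms

/-! ## The equations of the family in one factor -/

section Equations

variable {K : Type u} [Field K]

/-- The coordinate ring of the target of the projection `i`. -/
abbrev BasePoly (K : Type u) [Field K] (i : Fin 3) : Type u :=
  MvPolynomial ({t : Fin 3 // t ≠ i} × Fin 3) K

variable (A : (Fin 3 → Fin 3) → K) (B : (Fin 3 → Fin 3) → (Fin 3 → Fin 3) → K) (i : Fin 3)

@[simp] theorem incl_C (a : K) : incl i (C a : BasePoly K i) = C a := rename_C _ _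

@[simp] theorem incl_X (v : {t : Fin 3 // t ≠ i} × Fin 3) :
    incl i (X v : BasePoly K i) = X ((v.1 : Fin 3), v.2) := rename_X _ _

theorem coeffQ_comm (k n : Fin 3) : coeffQ B i k n = coeffQ B i n k := by
  refine Finset.sum_congr rfl fun s _ => Finset.sum_congr rfl fun s' _ => ?_
  simp only [or_comm]

theorem formG_eq (k : Fin 3) : formG A B i k = gCoeff (coeffL A i) (coeffQ B i) k := rfl

theorem formH_eq (k : Fin 3) : formH A B i k = hCoeff (coeffL A i) (coeffQ B i) k := by
  rw [formH, hCoeff, coeffQ_comm B i (k + 1) k]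

theorem formL_eq :
    formL A = lin (fun k => incl i (coeffL A i k)) (fun k => X (i, k)) := by
  have h1 : lin (fun k => incl i (coeffL A i k)) (fun k => X (i, k)) =
      ∑ k, incl i (coeffL A i k) * X (i, k) := by
    rw [Fin.sum_univ_three]; rfl
  rw [h1]
  simp only [coeffL, map_sum, Finset.sum_mul]
  rw [Finset.sum_comm, formL]
  refine Finset.sum_congr rfl fun s _ => ?_
  rw [Finset.sum_eq_single (s i)]
  · rw [if_pos rfl, map_mul, map_prod, incl_C, Fintype.prod_eq_mul_prod_subtype_ne _ i]
    simp only [incl_X]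
    ring
  · intro k _ hk
    rw [if_neg hk.symm, map_zero, zero_mul]
  · simp

theorem quad_sum {S ι : Type*} [CommRing S] (s : Finset ι) (q : ι → Fin 3 → Fin 3 → S)
    (x : Fin 3 → S) : quad (fun k n => ∑ a ∈ s, q a k n) x = ∑ a ∈ s, quad (q a) x := by
  simp only [quad, Finset.sum_mul, Finset.sum_add_distrib]

/-- `quad` reads each unordered pair of indices once, so the symmetric condition used in `coeffQ`
counts the monomial `x a * x b` exactly once, also for `a = b`. -/
theorem quad_ite {S : Type*} [CommRing S] (a b : Fin 3) (c : S) (x : Fin 3 → S) :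
    quad (fun k n => if (a = k ∧ b = n) ∨ (a = n ∧ b = k) then c else 0) x = c * (x a * x b) := by
  fin_cases a <;> fin_cases b <;> simp [quad] <;> ring

theorem formQ_eq :
    formQ B = quad (fun k n => incl i (coeffQ B i k n)) (fun k => X (i, k)) := by
  simp only [coeffQ, map_sum]
  rw [quad_sum, formQ]
  refine Finset.sum_congr rfl fun s _ => ?_
  rw [quad_sum]
  refine Finset.sum_congr rfl fun s' _ => ?_
  simp only [apply_ite (incl i), map_zero]
  rw [quad_ite, map_mul, map_prod, incl_C, Fintype.prod_eq_mul_prod_subtype_ne _ i]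
  simp only [incl_X, map_mul]
  ring

theorem sum_single_eq {ι : Type*} [Fintype ι] [DecidableEq ι] :
    (∑ t : ι, Pi.single t 1 : ι → ℕ) = fun _ => 1 := by
  ext a; simp [Finset.sum_apply, Pi.single_apply]

theorem isForm_coeffL (k : Fin 3) : IsForm (coeffL A i k) (fun _ => 1) := by
  refine IsWeightedHomogeneous.sum _ _ _ fun s _ => ?_
  split_ifs
  · refine IsWeightedHomogeneous.C_mul ?_ _
    rw [← sum_single_eq]
    exact IsWeightedHomogeneous.prod _ _ _ fun t _ => isForm_X t _
  · exact isWeightedHomogeneous_zero _ _ _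

theorem isForm_coeffQ (k n : Fin 3) : IsForm (coeffQ B i k n) (fun _ => 2) := by
  refine IsWeightedHomogeneous.sum _ _ _ fun s _ => IsWeightedHomogeneous.sum _ _ _ fun s' _ => ?_
  split_ifs
  · refine IsWeightedHomogeneous.C_mul ?_ _
    have : (fun _ : {t : Fin 3 // t ≠ i} => 2) = ∑ t : {t : Fin 3 // t ≠ i}, (Pi.single t 1 +
        Pi.single t 1 : {t : Fin 3 // t ≠ i} → ℕ) := by
      rw [Finset.sum_add_distrib, sum_single_eq]; rfl
    rw [this]
    exact IsWeightedHomogeneous.prod _ _ _ fun t _ => (isForm_X t _).mul (isForm_X t _)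
  · exact isWeightedHomogeneous_zero _ _ _

theorem isForm_formL : IsForm (formL A) (fun _ => 1) := by
  refine IsWeightedHomogeneous.sum _ _ _ fun s _ => IsWeightedHomogeneous.C_mul ?_ _
  rw [← sum_single_eq]
  exact IsWeightedHomogeneous.prod _ _ _ fun t _ => isForm_X t _

theorem isForm_formQ : IsForm (formQ B) (fun _ => 2) := by
  refine IsWeightedHomogeneous.sum _ _ _ fun s _ => IsWeightedHomogeneous.sum _ _ _ fun s' _ => ?_
  refine IsWeightedHomogeneous.C_mul ?_ _
  have : (fun _ : Fin 3 => 2) = ∑ t : Fin 3, (Pi.single t 1 + Pi.single t 1 : Fin 3 → ℕ) := by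
    rw [Finset.sum_add_distrib, sum_single_eq]; rfl
  rw [this]
  exact IsWeightedHomogeneous.prod _ _ _ fun t _ => (isForm_X t _).mul (isForm_X t _)

/-! ### Multidegrees of vector products, polar forms and quadratic forms. -/

section Degrees

variable {ι : Type} [Fintype ι] [DecidableEq ι]

theorem isForm_cross {a b : Fin 3 → MvPolynomial (ι × Fin 3) K} {d e : ι → ℕ}
    (ha : ∀ k, IsForm (a k) d) (hb : ∀ k, IsForm (b k) e) (k : Fin 3) :
    IsForm (cross a b k) (d + e) :=
  ((ha _).mul (hb _)).sub ((ha _).mul (hb _))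

theorem isForm_bil {q : Fin 3 → Fin 3 → MvPolynomial (ι × Fin 3) K}
    {a b : Fin 3 → MvPolynomial (ι × Fin 3) K} {c d e : ι → ℕ} (hq : ∀ k n, IsForm (q k n) c)
    (ha : ∀ k, IsForm (a k) d) (hb : ∀ k, IsForm (b k) e) :
    IsForm (bil q a b) (c + (d + e)) := by
  have h2 : ∀ k n, IsForm (2 * q k n) c := fun k n => by
    rw [two_mul]; exact (hq k n).add (hq k n)
  have h3 : ∀ k n, IsForm (a k * b n) (d + e) := fun k n => (ha k).mul (hb n)
  exact ((((((h2 _ _).mul (h3 _ _)).add ((h2 _ _).mul (h3 _ _))).add ((h2 _ _).mul (h3 _ _))).add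
    ((hq _ _).mul ((h3 _ _).add (h3 _ _)))).add ((hq _ _).mul ((h3 _ _).add (h3 _ _)))).add
    ((hq _ _).mul ((h3 _ _).add (h3 _ _)))

theorem isForm_quad {q : Fin 3 → Fin 3 → MvPolynomial (ι × Fin 3) K}
    {a : Fin 3 → MvPolynomial (ι × Fin 3) K} {c d : ι → ℕ} (hq : ∀ k n, IsForm (q k n) c)
    (ha : ∀ k, IsForm (a k) d) : IsForm (quad q a) (c + (d + d)) := by
  have h3 : ∀ k n, IsForm (a k * a n) (d + d) := fun k n => (ha k).mul (ha n)
  simp only [quad, sq]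
  exact ((((((hq _ _).mul (h3 _ _)).add ((hq _ _).mul (h3 _ _))).add ((hq _ _).mul (h3 _ _))).add
    ((hq _ _).mul (h3 _ _))).add ((hq _ _).mul (h3 _ _))).add ((hq _ _).mul (h3 _ _))

theorem isForm_C (a : K) : IsForm (C a : MvPolynomial (ι × Fin 3) K) 0 :=
  isWeightedHomogeneous_C _ _

theorem isForm_single (k n : Fin 3) :
    IsForm (Pi.single (M := fun _ => MvPolynomial (ι × Fin 3) K) k 1 n) 0 := by
  by_cases h : n = k
  · subst h; rw [Pi.single_eq_same]; exact isWeightedHomogeneous_one _ _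
  · rw [Pi.single_eq_of_ne h]; exact isWeightedHomogeneous_zero _ _ _

end Degrees

theorem isForm_formG (k : Fin 3) : IsForm (formG A B i k) (fun _ => 4) := by
  rw [formG_eq, gCoeff_eq_quad]
  exact isForm_quad (isForm_coeffQ B i) (isForm_cross (isForm_coeffL A i) (isForm_single k))

/-- The discriminant form for a vector `c` of constants. -/
def discForm (c : Fin 3 → K) : BasePoly K i := disc (coeffL A i) (coeffQ B i) (fun k => C (c k))

/-- The vector `c × l` of forms. -/
def lineVec (c : Fin 3 → K) : Fin 3 → BasePoly K i :=
  cross (fun k => C (c k)) (coeffL A i)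

/-- The form `midCoeff` for a vector `c` of constants. -/
def midForm (c : Fin 3 → K) (k : Fin 3) : BasePoly K i :=
  midCoeff (coeffL A i) (coeffQ B i) (fun k => C (c k)) k

theorem isForm_lineVec (c : Fin 3 → K) (k : Fin 3) : IsForm (lineVec A i c k) (fun _ => 1) := by
  have := isForm_cross (fun k => isForm_C (ι := {t : Fin 3 // t ≠ i}) (c k)) (isForm_coeffL A i) k
  rwa [zero_add] at this

theorem isForm_discForm (c : Fin 3 → K) : IsForm (discForm A B i c) (fun _ => 4) :=
  isForm_quad (isForm_coeffQ B i) (isForm_lineVec A i c)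

theorem isForm_midForm (c : Fin 3 → K) (k : Fin 3) :
    IsForm (midForm A B i c k) (fun _ => 4) :=
  isForm_bil (isForm_coeffQ B i) (isForm_lineVec A i c)
    (isForm_cross (isForm_coeffL A i) (isForm_single k))

/-! ### Evaluation in the factor `i` -/

section Eval

variable {i}
variable {R' : Type*} [CommRing R'] (φ : BasePoly K i →+* R') (x : Fin 3 → R')

/-- The homomorphism which is `φ` on the coordinates of the other factors and maps the coordinates
of the factor `i` to `x`. -/
def evalFib : MvPolynomial (Fin 3 × Fin 3) K →+* R' :=
  eval₂Hom (φ.comp C) (fun v => if h : v.1 = i then x v.2 else φ (X (⟨v.1, h⟩, v.2)))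

@[simp] theorem evalFib_X (k : Fin 3) : evalFib φ x (X (i, k)) = x k := by simp [evalFib]

theorem evalFib_C (a : K) : evalFib φ x (C a) = φ (C a) := by simp [evalFib]

theorem evalFib_comp_incl : (evalFib φ x).comp (incl i) = φ := by
  refine MvPolynomial.ringHom_ext (fun a => ?_) (fun v => ?_)
  · simp [evalFib]
  · simp [evalFib, v.1.2]

@[simp] theorem evalFib_incl (s : BasePoly K i) : evalFib φ x (incl i s) = φ s :=
  RingHom.congr_fun (evalFib_comp_incl φ x) s

variable {φ x} in
theorem hom_ext_fib {f g : MvPolynomial (Fin 3 × Fin 3) K →+* R'}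
    (h : ∀ s : BasePoly K i, f (incl i s) = g (incl i s))
    (hX : ∀ k, f (X (i, k)) = g (X (i, k))) : f = g := by
  refine MvPolynomial.ringHom_ext (fun a => ?_) (fun v => ?_)
  · have := h (C a)
    rwa [incl_C] at this
  · by_cases hv : v.1 = i
    · obtain ⟨t, j⟩ := v
      obtain rfl : t = i := hv
      exact hX j
    · have := h (X (⟨v.1, hv⟩, v.2))
      rwa [incl_X] at this

theorem evalFib_formL :
    evalFib φ x (formL A) = lin (fun k => φ (coeffL A i k)) x := by
  rw [formL_eq A i, map_lin]; simp

theorem evalFib_formQ :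
    evalFib φ x (formQ B) = quad (fun k n => φ (coeffQ B i k n)) x := by
  rw [formQ_eq B i, map_quad]; simp

theorem evalFib_smul {a : R'} {f : MvPolynomial (Fin 3 × Fin 3) K} {d : Fin 3 → ℕ}
    (hf : IsForm f d) : evalFib φ (fun k => a * x k) f = a ^ d i * evalFib φ x f := by
  have := map_form_scale (evalFib φ (fun k => a * x k)) (evalFib φ x) (Pi.mulSingle i a)
    (fun b => by rw [evalFib_C, evalFib_C]) (fun v => ?_) hf
  · rw [this, Fintype.prod_eq_single i (fun t ht => by simp [ht]), Pi.mulSingle_eq_same]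
  · by_cases hv : v.1 = i
    · obtain ⟨t, j⟩ := v
      obtain rfl : t = i := hv
      simp
    · simp [evalFib, hv]

/-- The values of forms at the coordinates `x` of a point of `X`. -/
def fibLift {A : (Fin 3 → Fin 3) → K} {B : (Fin 3 → Fin 3) → (Fin 3 → Fin 3) → K}
    (hl : lin (fun k => φ (coeffL A i k)) x = 0) (hq : quad (fun k n => φ (coeffQ B i k n)) x = 0) :
    (MvPolynomial (Fin 3 × Fin 3) K ⧸ idealX A B) →+* R' :=
  Ideal.Quotient.lift _ (evalFib φ x) (by
    intro f hf
    have : idealX A B ≤ RingHom.ker (evalFib φ x) := by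
      rw [idealX, Ideal.span_le]
      rintro _ (rfl | rfl)
      · show evalFib φ x (formL A) = 0
        rw [evalFib_formL, hl]
      · show evalFib φ x (formQ B) = 0
        rw [evalFib_formQ, hq]
    exact this hf)

@[simp] theorem fibLift_mk (hl : lin (fun k => φ (coeffL A i k)) x = 0)
    (hq : quad (fun k n => φ (coeffQ B i k n)) x = 0) (f : MvPolynomial (Fin 3 × Fin 3) K) :
    fibLift φ x hl hq (Ideal.Quotient.mk _ f) = evalFib φ x f := rfl

end Eval

/-- The coordinate ring of `X`. -/
abbrev CoordRing : Type u := MvPolynomial (Fin 3 × Fin 3) K ⧸ idealX A B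

/-- The pull-back of forms along the projection `i`. -/
def base : BasePoly K i →+* CoordRing A B := (Ideal.Quotient.mk (idealX A B)).comp (incl i)

/-- The coordinates of the factor `i` on `X`. -/
def fibX (k : Fin 3) : CoordRing A B := Ideal.Quotient.mk (idealX A B) (X (i, k))

theorem mk_incl (s : BasePoly K i) : Ideal.Quotient.mk (idealX A B) (incl i s) = base A B i s := rfl

theorem mk_X (k : Fin 3) : Ideal.Quotient.mk (idealX A B) (X (i, k)) = fibX A B i k := rfl

theorem projHom_mk (s : BasePoly K i) :
    projHom (idealX A B) i (Ideal.Quotient.mk _ s) = base A B i s := rfl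

theorem lin_fibX : lin (fun k => base A B i (coeffL A i k)) (fibX A B i) = 0 := by
  have : Ideal.Quotient.mk (idealX A B) (formL A) = 0 :=
    Ideal.Quotient.eq_zero_iff_mem.mpr (Ideal.subset_span (by simp))
  rwa [formL_eq A i, map_lin] at this

theorem quad_fibX : quad (fun k n => base A B i (coeffQ B i k n)) (fibX A B i) = 0 := by
  have : Ideal.Quotient.mk (idealX A B) (formQ B) = 0 :=
    Ideal.Quotient.eq_zero_iff_mem.mpr (Ideal.subset_span (by simp))
  rwa [formQ_eq B i, map_quad] at this

variable {A B i} in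
theorem hom_ext_coordRing {R' : Type*} [CommRing R'] {f g : CoordRing A B →+* R'}
    (h : ∀ s, f (base A B i s) = g (base A B i s))
    (hX : ∀ k, f (fibX A B i k) = g (fibX A B i k)) : f = g :=
  Ideal.Quotient.ringHom_ext (hom_ext_fib (i := i) h hX)

/-- No nonzero form in the other two factors vanishes on `X`. -/
theorem base_injective : Function.Injective (base A B i) := by
  rw [injective_iff_map_eq_zero]
  intro s hs
  -- The zero vector in the factor `i` solves both equations over the base ring, and restriction to
  -- it is a left inverse of `base`.
  have := congrArg (fibLift (A := A) (B := B) (RingHom.id (BasePoly K i)) (fun _ => 0)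
    (by simp [lin]) (by simp [quad])) hs
  rwa [map_zero, ← mk_incl, fibLift_mk, evalFib_incl] at this

/-! ### Degrees of pulled back forms -/

/-- The extension of a multidegree by zero. -/
def extDeg (d : {t : Fin 3 // t ≠ i} → ℕ) : Fin 3 → ℕ :=
  fun t => if h : t = i then 0 else d ⟨t, h⟩

theorem extDeg_injective : Function.Injective (extDeg i) := by
  intro d e h
  ext t
  have := congrFun h t
  simpa [extDeg, t.2] using this

theorem sum_smul_single (d : {t : Fin 3 // t ≠ i} → ℕ) :
    ∑ t : {t : Fin 3 // t ≠ i}, d t • (Pi.single (t : Fin 3) 1 : Fin 3 → ℕ) = extDeg i d := by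
  ext a
  rw [Finset.sum_apply]
  by_cases h : a = i
  · rw [extDeg, dif_pos h]
    refine Finset.sum_eq_zero fun t _ => ?_
    have : a ≠ t := fun h' => t.2 (h' ▸ h)
    simp [this]
  · rw [extDeg, dif_neg h, Finset.sum_eq_single ⟨a, h⟩]
    · simp
    · intro t _ ht
      have : a ≠ t := fun h' => ht (Subtype.ext h'.symm)
      simp [this]
    · simp

variable {i} in
theorem IsForm.incl {f : BasePoly K i} {d : {t : Fin 3 // t ≠ i} → ℕ} (hf : IsForm f d) :
    IsForm (incl i f) (extDeg i d) := by
  rw [← sum_smul_single]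
  exact hf.map_hom (ThreeInvolutions.incl i) (fun t => Pi.single (t : Fin 3) 1) (incl_C i)
    (fun v => by rw [incl_X]; exact isForm_X _ _)

theorem component_incl (f : BasePoly K i) (d : {t : Fin 3 // t ≠ i} → ℕ) :
    weightedHomogeneousComponent (multideg (Fin 3)) (extDeg i d) (incl i f) =
      incl i (weightedHomogeneousComponent (multideg _) d f) :=
  component_map_hom (incl i) (extDeg i) (extDeg_injective i) (fun _ _ h => h.incl) f d

end Equations

/-! ## Consequences of `X` being an integral complete intersection -/

section Integral

variable {K : Type u} [Field K]
variable {A : (Fin 3 → Fin 3) → K} {B : (Fin 3 → Fin 3) → (Fin 3 → Fin 3) → K}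

/-- A common factor that is not a unit would place the ideal inside a principal ideal, of height at
most one by Krull's principal ideal theorem. -/
theorem isRelPrime_formL_formQ (hcodim : (idealX A B).height = 2) :
    IsRelPrime (formL A) (formQ B) := by
  have key : ∀ p, ¬ IsUnit p → p ∣ formL A → ¬ p ∣ formQ B := by
    intro p hp hL hQ
    have hle : idealX A B ≤ Ideal.span {p} := by
      rw [idealX, Ideal.span_le]
      rintro _ (rfl | rfl)
      · exact Ideal.mem_span_singleton.mpr hL
      · exact Ideal.mem_span_singleton.mpr hQ
    have h1 := (Ideal.height_mono hle).trans (Ideal.height_span_singleton_le_one hp)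
    rw [hcodim] at h1
    exact absurd h1 (by decide)
  intro p hL hQ
  by_contra hp
  exact key p hp hL hQ

theorem idealX_height_le_one_of_span {f : MvPolynomial (Fin 3 × Fin 3) K}
    (hprime : (idealX A B).IsPrime) (hcodim : (idealX A B).height = 2) :
    idealX A B ≠ Ideal.span {f} := by
  intro h
  have hf : ¬ IsUnit f := fun hu => hprime.ne_top (h.trans (Ideal.span_singleton_eq_top.mpr hu))
  have h1 := Ideal.height_span_singleton_le_one hf
  rw [← h, hcodim] at h1
  exact absurd h1 (by decide)

theorem formL_ne_zero (hprime : (idealX A B).IsPrime) (hcodim : (idealX A B).height = 2) :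
    formL A ≠ 0 := by
  intro h
  refine idealX_height_le_one_of_span (f := formQ B) hprime hcodim ?_
  rw [idealX, h, Ideal.span_insert_zero]

theorem constantCoeff_form {ι : Type} [Fintype ι] [DecidableEq ι]
    {f : MvPolynomial (ι × Fin 3) K} {d : ι → ℕ} (hf : IsForm f d) (hd : d ≠ 0) :
    constantCoeff f = 0 := by
  rw [constantCoeff_eq]
  exact IsWeightedHomogeneous.coeff_eq_zero hf 0 (by rw [map_zero]; exact hd.symm)

theorem exists_ne (i : Fin 3) : ∃ t : Fin 3, t ≠ i := ⟨i + 1, by fin_cases i <;> decide⟩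

theorem const_ne_zero {i : Fin 3} {n : ℕ} (hn : n ≠ 0) :
    (fun _ : {t : Fin 3 // t ≠ i} => n) ≠ 0 := by
  intro h
  obtain ⟨t, ht⟩ := exists_ne i
  exact hn (congrFun h ⟨t, ht⟩)

/-- At the origin of the other two factors all coefficients of both equations vanish, so `e_k` is a
solution there, with `k`-th coordinate 1. -/
theorem fibX_ne_zero (i k : Fin 3) : fibX A B i k ≠ 0 := by
  intro h
  have := congrArg (fibLift (A := A) (B := B) (constantCoeff : BasePoly K i →+* K)
    (Pi.single k 1) (by simp [lin, constantCoeff_form (isForm_coeffL A i _) (const_ne_zero one_ne_zero)])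
    (by simp [quad, constantCoeff_form (isForm_coeffQ B i _ _) (const_ne_zero two_ne_zero)])) h
  rw [map_zero, ← mk_X, fibLift_mk, evalFib_X, Pi.single_eq_same] at this
  exact one_ne_zero this

/-- Divisibility by `L` of a multiple of `Q`, restricted to the origin of the factor `i`. -/
theorem eq_zero_of_dvd {i : Fin 3} {f : MvPolynomial (Fin 3 × Fin 3) K} (h : formL A ∣ f) :
    evalFib (RingHom.id (BasePoly K i)) (fun _ => 0) f = 0 := by
  obtain ⟨w, rfl⟩ := h
  rw [map_mul, evalFib_formL]
  simp [lin]

/-- The product `b * W` lies in the prime ideal `(L, Q)`, hence so does `W = α L + β Q`. Then `L`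
divides `(a - b β) Q`, hence `a - b β` by coprimality, and it vanishes at the origin of the factor
`i`. This converts relations on X into divisibilities on the base. -/
theorem exists_sub_of_mul_mem (hprime : (idealX A B).IsPrime) (hcodim : (idealX A B).height = 2)
    {i : Fin 3} {a : BasePoly K i} {b W V : MvPolynomial (Fin 3 × Fin 3) K}
    (hb : b ∉ idealX A B) (h : incl i a * formQ B = b * W + formL A * V) :
    ∃ β, a = evalFib (RingHom.id (BasePoly K i)) (fun _ => 0) b * β := by
  have hW : W ∈ idealX A B := by
    refine (hprime.mem_or_mem (x := b) (y := W) ?_).resolve_left hb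
    have : b * W = incl i a * formQ B - V * formL A := by rw [h]; ring
    rw [this]
    exact sub_mem (Ideal.mul_mem_left _ _ (Ideal.subset_span (by simp)))
      (Ideal.mul_mem_left _ _ (Ideal.subset_span (by simp)))
  obtain ⟨α, β, rfl⟩ := Ideal.mem_span_pair.mp hW
  have hdvd : formL A ∣ (incl i a - b * β) * formQ B := ⟨V + b * α, by linear_combination h⟩
  have h0 := eq_zero_of_dvd (i := i)
    ((isRelPrime_formL_formQ hcodim).dvd_of_dvd_mul_right hdvd)
  refine ⟨evalFib (RingHom.id (BasePoly K i)) (fun _ => 0) β, ?_⟩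
  rwa [map_sub, map_mul, evalFib_incl, RingHom.id_apply, sub_eq_zero] at h0

theorem sq_mul_formQ (i p : Fin 3) :
    ∃ V, incl i (coeffL A i p ^ 2) * formQ B =
      X (i, p + 1) ^ 2 * incl i (formG A B i (p + 2)) +
      X (i, p + 2) ^ 2 * incl i (formG A B i (p + 1)) +
      X (i, p + 1) * X (i, p + 2) * incl i (formH A B i p) + formL A * V := by
  have := sq_mul_quad (fun k => incl i (coeffL A i k)) (fun k => X (i, k))
    (fun k n => incl i (coeffQ B i k n)) p
  rw [← formL_eq, ← formQ_eq] at this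
  rw [map_pow, this, formG_eq, formG_eq, formH_eq, map_gCoeff, map_gCoeff, map_hCoeff]
  exact ⟨_, rfl⟩

/-- If `G_k` vanished, then for both `p ≠ k` the quadratic form equal to `l_p ^ 2 * Q` modulo `L`
would be divisible by `x_k`. At the origin of the fibre coordinates this gives `l_p = 0`. Then `l_k
* x_k = 0` on X, so `l_k = 0` as well and `L = 0`. -/
theorem formG_ne_zero (hprime : (idealX A B).IsPrime) (hcodim : (idealX A B).height = 2)
    (i k : Fin 3) : formG A B i k ≠ 0 := by
  intro hG
  have hX : (X (i, k) : MvPolynomial (Fin 3 × Fin 3) K) ∉ idealX A B := fun h =>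
    fibX_ne_zero (A := A) (B := B) i k (Ideal.Quotient.eq_zero_iff_mem.mpr h)
  have key : ∀ (p : Fin 3) (W V : MvPolynomial (Fin 3 × Fin 3) K),
      incl i (coeffL A i p ^ 2) * formQ B = X (i, k) * W + formL A * V → coeffL A i p = 0 := by
    intro p W V h
    obtain ⟨β, hβ⟩ := exists_sub_of_mul_mem hprime hcodim hX h
    rw [evalFib_X, zero_mul] at hβ
    exact pow_eq_zero_iff two_ne_zero |>.mp hβ
  have h1 : coeffL A i (k + 1) = 0 := by
    obtain ⟨V, hV⟩ := sq_mul_formQ (A := A) (B := B) i (k + 1)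
    have e1 : k + 1 + 2 = k := by fin_cases k <;> rfl
    have e2 : k + 1 + 1 = k + 2 := by fin_cases k <;> rfl
    rw [e1, hG, e2] at hV
    exact key _ (X (i, k) * incl i (formG A B i (k + 2)) +
      X (i, k + 2) * incl i (formH A B i (k + 1))) V (by rw [hV, map_zero]; ring)
  have h2 : coeffL A i (k + 2) = 0 := by
    obtain ⟨V, hV⟩ := sq_mul_formQ (A := A) (B := B) i (k + 2)
    have e1 : k + 2 + 2 = k + 1 := by fin_cases k <;> rfl
    have e2 : k + 2 + 1 = k := by fin_cases k <;> rfl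
    rw [e1, e2, hG] at hV
    exact key _ (X (i, k) * incl i (formG A B i (k + 1)) +
      X (i, k + 1) * incl i (formH A B i (k + 2))) V (by rw [hV, map_zero]; ring)
  have hL : base A B i (coeffL A i k) * fibX A B i k = 0 := by
    have := lin_fibX A B i
    have e : lin (fun k => base A B i (coeffL A i k)) (fibX A B i) =
        base A B i (coeffL A i k) * fibX A B i k +
        base A B i (coeffL A i (k + 1)) * fibX A B i (k + 1) +
        base A B i (coeffL A i (k + 2)) * fibX A B i (k + 2) := by
      fin_cases k <;> simp [lin, fin3_two_add_one, fin3_two_add_two, fin3_one_add_one,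
        fin3_one_add_two] <;> ring
    rw [e, h1, h2] at this
    simpa using this
  have h0 : coeffL A i k = 0 := by
    rw [mul_eq_zero, or_iff_left (fibX_ne_zero i k)] at hL
    exact base_injective A B i (by rw [hL, map_zero])
  refine formL_ne_zero hprime hcodim ?_
  have hall : ∀ n, coeffL A i n = 0 := by
    intro n
    have : n = k ∨ n = k + 1 ∨ n = k + 2 := by
      fin_cases n <;> fin_cases k <;> decide
    rcases this with rfl | rfl | rfl
    · exact h0
    · exact h1
    · exact h2
  rw [formL_eq A i]
  simp [hall, lin]

theorem discForm_single (i k : Fin 3) : discForm A B i (Pi.single k 1) = formG A B i k := by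
  have : (fun n => C (Pi.single (M := fun _ => K) k 1 n)) =
      (Pi.single k 1 : Fin 3 → BasePoly K i) := by
    ext n : 1
    by_cases h : n = k
    · subst h; simp
    · simp [h]
  rw [discForm, this, disc_single, formG_eq]

theorem discForm_single_add (i k : Fin 3) :
    discForm A B i (Pi.single (k + 1) 1 + Pi.single (k + 2) 1) =
      formG A B i (k + 1) + formG A B i (k + 2) - formH A B i k := by
  have : (fun n => C ((Pi.single (k + 1) 1 + Pi.single (k + 2) 1 : Fin 3 → K) n)) =
      (Pi.single (k + 1) 1 + Pi.single (k + 2) 1 : Fin 3 → BasePoly K i) := by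
    ext n : 1
    by_cases h : n = k + 1 <;> by_cases h' : n = k + 2 <;> simp [h, h']
  rw [discForm, this, disc_single_add, formG_eq, formG_eq, formH_eq]

/-- If the forms `G` and `H` are not all in an ideal, then some `discForm` is not. -/
theorem exists_discForm_notMem (i : Fin 3) (I : Ideal (BasePoly K i))
    (h : ∃ k, formG A B i k ∉ I ∨ formH A B i k ∉ I) : ∃ c, discForm A B i c ∉ I := by
  by_contra! hc
  have hG : ∀ k, formG A B i k ∈ I := fun k => by rw [← discForm_single]; exact hc _
  obtain ⟨k, hk | hk⟩ := h
  · exact hk (hG k)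
  · refine hk ?_
    have := sub_mem (add_mem (hG (k + 1)) (hG (k + 2))) (hc (Pi.single (k + 1) 1 + Pi.single (k + 2) 1))
    rw [discForm_single_add] at this
    simpa using this

/-- The fibres of the projections over points of codimension one are finite. -/
theorem exists_not_dvd_discForm (hprime : (idealX A B).IsPrime)
    (hcodim : (idealX A B).height = 2) (i : Fin 3) {g : BasePoly K i} (hg : Prime g) :
    ∃ c, ¬ g ∣ discForm A B i c := by
  have hgJ : incl i g ∉ idealX A B := fun h => hg.ne_zero
    (base_injective A B i (by rw [map_zero]; exact Ideal.Quotient.eq_zero_iff_mem.mpr h))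
  suffices h : ∃ k, formG A B i k ∉ Ideal.span {g} ∨ formH A B i k ∉ Ideal.span {g} by
    obtain ⟨c, hc⟩ := exists_discForm_notMem i _ h
    exact ⟨c, fun h => hc (Ideal.mem_span_singleton.mpr h)⟩
  by_contra! h
  simp only [Ideal.mem_span_singleton] at h
  -- If `g` divides all coefficients of the line, `L` itself is divisible by `g`; otherwise some
  -- `l_p` is prime to `g` and the elimination of `x_p` applies.
  by_cases hl : ∀ p, g ∣ coeffL A i p
  · choose l' hl' using hl
    set L' : MvPolynomial (Fin 3 × Fin 3) K := lin (fun k => incl i (l' k)) (fun k => X (i, k))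
    have hL : formL A = incl i g * L' := by
      rw [formL_eq A i]
      simp only [L', lin]
      rw [hl' 0, hl' 1, hl' 2, map_mul, map_mul, map_mul]
      ring
    have hL' : L' ∈ idealX A B := by
      refine (hprime.mem_or_mem (x := incl i g) (y := L') ?_).resolve_left hgJ
      rw [← hL]
      exact Ideal.subset_span (by simp)
    -- With `L = g L'` and `L' = α L + β Q`, the form `Q` divides `(1 - α g) L'`, hence `1 - α g`.
    -- At the origin of the fibre coordinates `Q` vanishes, so `g` would be a unit.
    obtain ⟨α, β, hαβ⟩ := Ideal.mem_span_pair.mp hL'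
    have hrel : IsRelPrime (formQ B) L' :=
      (IsRelPrime.of_mul_left_right (hL ▸ isRelPrime_formL_formQ hcodim)).symm
    have hdvd : formQ B ∣ (1 - α * incl i g) * L' := ⟨β, by rw [hL] at hαβ; linear_combination -hαβ⟩
    obtain ⟨w, hw⟩ := hrel.dvd_of_dvd_mul_right hdvd
    have h0 := congrArg (evalFib (RingHom.id (BasePoly K i)) (fun _ => 0)) hw
    rw [map_mul, evalFib_formQ, map_sub, map_mul, evalFib_incl, map_one] at h0
    simp only [quad, RingHom.id_apply] at h0
    refine hg.not_isUnit (IsUnit.of_mul_eq_one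
      (evalFib (RingHom.id (BasePoly K i)) (fun _ => 0) α) ?_)
    linear_combination -h0
  · push Not at hl
    obtain ⟨p, hp⟩ := hl
    obtain ⟨V, hV⟩ := sq_mul_formQ (A := A) (B := B) i p
    obtain ⟨a, ha⟩ := (h (p + 2)).1
    obtain ⟨b, hb⟩ := (h (p + 1)).1
    obtain ⟨e, he⟩ := (h p).2
    rw [ha, hb, he, map_mul, map_mul, map_mul] at hV
    obtain ⟨β, hβ⟩ := exists_sub_of_mul_mem hprime hcodim hgJ (W := X (i, p + 1) ^ 2 * incl i a +
      X (i, p + 2) ^ 2 * incl i b + X (i, p + 1) * X (i, p + 2) * incl i e) (V := V)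
      (by rw [hV]; ring)
    rw [evalFib_incl, RingHom.id_apply] at hβ
    exact hp (hg.dvd_of_dvd_pow ⟨β, hβ⟩)

end Integral

/-! ## Orders of vanishing -/

section Ord

theorem ord_eq_of_surjective {R S : Type*} [CommRing R] [CommRing S] (f : R →+* S)
    (hf : Function.Surjective f) {x : R} {y : S}
    (h : Ideal.span {x} = (Ideal.span {y}).comap f) : Ring.ord R x = Ring.ord S y := by
  rw [Ring.ord, Ring.ord, Module.length_quotient, Module.length_quotient, h,
    Ideal.coheight_comap_of_surjective f hf]

theorem ord_map_of_bijective {R S : Type*} [CommRing R] [CommRing S] (f : R →+* S)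
    (hf : Function.Bijective f) (x : R) : Ring.ord S (f x) = Ring.ord R x := by
  refine (ord_eq_of_surjective f hf.2 ?_).symm
  rw [← Set.image_singleton, ← Ideal.map_span, Ideal.comap_map_of_bijective f hf]

/-- The local rings of a domain at two primes which correspond under an endomorphism that is invertible
up to denominators. -/
theorem localRingHom_bijective {R : Type*} [CommRing R] [IsDomain R] (τ : R →+* R)
    (hτ : Function.Injective τ) (P : Ideal R) [P.IsPrime]
    (hgen : ∀ a, ∃ a' u, τ u ∉ P ∧ τ a' = τ u * a) :
    Function.Bijective (Localization.localRingHom (P.comap τ) P τ rfl) := by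
  constructor
  · rw [injective_iff_map_eq_zero]
    intro z hz
    obtain ⟨a, b, rfl⟩ := IsLocalization.exists_mk'_eq (P.comap τ).primeCompl z
    rw [Localization.localRingHom_mk', IsLocalization.mk'_eq_zero_iff] at hz
    obtain ⟨m, hm⟩ := hz
    have hm0 : (m : R) ≠ 0 := fun h => m.2 (h ▸ P.zero_mem)
    have : a = 0 := hτ (by rw [map_zero]; exact (mul_eq_zero.mp hm).resolve_left hm0)
    rw [this, IsLocalization.mk'_zero]
  · intro z
    obtain ⟨a, b, rfl⟩ := IsLocalization.exists_mk'_eq P.primeCompl z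
    obtain ⟨a', u, hu, ha⟩ := hgen a
    obtain ⟨b', w, hw, hb⟩ := hgen b
    -- From `a = τ a' / τ u` and `b = τ b' / τ w`, the fraction `a / b` is the image of `a' w / (u
    -- b')`.
    have hb' : u * b' ∈ (P.comap τ).primeCompl := by
      show ¬ τ (u * b') ∈ P
      rw [map_mul, hb]
      exact fun h => (‹P.IsPrime›.mem_or_mem h).elim hu
        (fun h => (‹P.IsPrime›.mem_or_mem h).elim hw b.2)
    refine ⟨IsLocalization.mk' _ (a' * w) ⟨u * b', hb'⟩, ?_⟩
    rw [Localization.localRingHom_mk', IsLocalization.mk'_eq_iff_eq]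
    congr 1
    simp only [map_mul, ha, hb]
    ring

/-! ### Orders at a prime ideal. -/

section Local

variable {R : Type*} [CommRing R] (P : Ideal R) [P.IsPrime]

/-- The order of vanishing of an element of a ring along a prime ideal. -/
def ordLoc (f : R) : ℕ :=
  (Ring.ord (Localization.AtPrime P) (algebraMap R (Localization.AtPrime P) f)).toNat

theorem ordLoc_of_notMem {f : R} (hf : f ∉ P) : ordLoc P f = 0 := by
  rw [ordLoc, Ring.ord_of_isUnit (IsLocalization.map_units _ (⟨f, hf⟩ : P.primeCompl))]
  rfl

theorem ordLoc_neg (f : R) : ordLoc P (-f) = ordLoc P f := by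
  rw [ordLoc, map_neg, Ring.ord_neg, ordLoc]

variable [IsDomain R] [IsNoetherianRing R]

/-- Height one makes the local ring a domain of dimension at most one, in which the lengths of `R /
(f)` for nonzero `f` are finite and additive on products. No normality is needed. -/
theorem ordLoc_mul (hP : P.height = 1) {f g : R} (hf : f ≠ 0) (hg : g ≠ 0) :
    ordLoc P (f * g) = ordLoc P f + ordLoc P g := by
  have hdim : Ring.KrullDimLE 1 (Localization.AtPrime P) := by
    rw [Ring.krullDimLE_iff, IsLocalization.AtPrime.ringKrullDim_eq_height P, hP]
    rfl
  have h0 : ∀ {f : R}, f ≠ 0 →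
      algebraMap R (Localization.AtPrime P) f ∈ nonZeroDivisors (Localization.AtPrime P) :=
    fun hf => mem_nonZeroDivisors_of_ne_zero
      (by rwa [Ne, IsLocalization.to_map_eq_zero_iff _ P.primeCompl_le_nonZeroDivisors])
  rw [ordLoc, map_mul, Ring.ord_mul _ (h0 hg), ENat.toNat_add (Ring.ord_ne_top (h0 hf))
    (Ring.ord_ne_top (h0 hg))]
  rfl

theorem ordLoc_pow_mul {g h : R} (hg : P = Ideal.span {g}) (hg0 : g ≠ 0) (hh : h ∉ P) (n : ℕ) :
    ordLoc P (g ^ n * h) = n := by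
  have hgP : g ∈ P := hg ▸ Ideal.mem_span_singleton_self g
  have h0 : algebraMap R (Localization.AtPrime P) g ∈ nonZeroDivisors (Localization.AtPrime P) :=
    mem_nonZeroDivisors_of_ne_zero
      (by rwa [Ne, IsLocalization.to_map_eq_zero_iff _ P.primeCompl_le_nonZeroDivisors])
  have h1 : Ring.ord (Localization.AtPrime P) (algebraMap R _ g) = 1 := by
    have hmax : Ideal.span {algebraMap R (Localization.AtPrime P) g} =
        IsLocalRing.maximalIdeal (Localization.AtPrime P) := by
      rw [← Localization.AtPrime.map_eq_maximalIdeal, ← Set.image_singleton, ← Ideal.map_span, ← hg]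
    rw [Ring.ord, hmax, Module.length_eq_one_iff, isSimpleModule_iff_isCoatom, ← Ideal.isMaximal_def]
    infer_instance
  rw [ordLoc, map_mul, map_pow, Ring.ord_mul_of_isUnit_right
    (IsLocalization.map_units _ (⟨h, hh⟩ : P.primeCompl)), Ring.ord_pow h0, h1]
  simp

end Local

variable {ι : Type} [Fintype ι] [DecidableEq ι] {K : Type u} [Field K]
  {J : Ideal (MvPolynomial (ι × Fin 3) K)}

theorem ordAt_eq_ordLoc (P : PrimeDivisor J) (f : MvPolynomial (ι × Fin 3) K ⧸ J) :
    ordAt P f = ordLoc P.ideal f := rfl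

variable [hJ : J.IsPrime]

theorem ordAt_mul (P : PrimeDivisor J) {f g : MvPolynomial (ι × Fin 3) K ⧸ J} (hf : f ≠ 0)
    (hg : g ≠ 0) : ordAt P (f * g) = ordAt P f + ordAt P g :=
  ordLoc_mul P.ideal P.height_eq_one hf hg

theorem ordAt_of_notMem (P : PrimeDivisor J) {f : MvPolynomial (ι × Fin 3) K ⧸ J}
    (hf : f ∉ P.ideal) : ordAt P f = 0 := ordLoc_of_notMem P.ideal hf

theorem ordAt_one (P : PrimeDivisor J) : ordAt P 1 = 0 :=
  ordAt_of_notMem P fun h => P.isPrime.ne_top ((Ideal.eq_top_iff_one _).mpr h)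

theorem ordAt_pow (P : PrimeDivisor J) {f : MvPolynomial (ι × Fin 3) K ⧸ J} (hf : f ≠ 0) (n : ℕ) :
    ordAt P (f ^ n) = n * ordAt P f := by
  induction n with
  | zero => simp [ordAt_one]
  | succ n ih => rw [pow_succ, ordAt_mul P (pow_ne_zero n hf) hf, ih]; ring

theorem ordAt_neg (P : PrimeDivisor J) (f : MvPolynomial (ι × Fin 3) K ⧸ J) :
    ordAt P (-f) = ordAt P f := ordLoc_neg P.ideal f

theorem divOf_apply (f : MvPolynomial (ι × Fin 3) K ⧸ J) (P : PrimeDivisor J) :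
    divOf f P = ordAt P f := rfl

theorem divOf_mul {f g : MvPolynomial (ι × Fin 3) K ⧸ J} (hf : f ≠ 0) (hg : g ≠ 0) :
    divOf (f * g) = divOf f + divOf g := by
  ext P
  simp [divOf_apply, ordAt_mul P hf hg]

theorem divOf_pow {f : MvPolynomial (ι × Fin 3) K ⧸ J} (hf : f ≠ 0) (n : ℕ) :
    divOf (f ^ n) = (n : ℤ) • divOf f := by
  ext P
  simp [divOf_apply, ordAt_pow P hf n]

theorem divOf_one : divOf (1 : MvPolynomial (ι × Fin 3) K ⧸ J) = 0 := by
  ext P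
  simp [divOf_apply, ordAt_one]

theorem divOf_prod {κ : Type*} (s : Finset κ) (f : κ → MvPolynomial (ι × Fin 3) K ⧸ J)
    (hf : ∀ a ∈ s, f a ≠ 0) : divOf (∏ a ∈ s, f a) = ∑ a ∈ s, divOf (f a) := by
  classical
  induction s using Finset.induction_on with
  | empty => simp [divOf_one]
  | insert a s ha ih =>
    rw [Finset.prod_insert ha, Finset.sum_insert ha, divOf_mul (hf a (by simp))
      (Finset.prod_ne_zero_iff.mpr fun b hb => hf b (by simp [hb])),
      ih fun b hb => hf b (by simp [hb])]

end Ord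

/-! ## The involution -/

section Reflection

variable {K : Type u} [Field K]
variable (A : (Fin 3 → Fin 3) → K) (B : (Fin 3 → Fin 3) → (Fin 3 → Fin 3) → K) (i : Fin 3)
  (c : Fin 3 → K)

/-- The linear form with constant coefficients `c` in the coordinates of the factor `i`. -/
def fibV : CoordRing A B := lin (fun k => base A B i (C (c k))) (fibX A B i)

theorem lin_lineVec : lin (coeffL A i) (lineVec A i c) = 0 := lin_cross _ _

theorem base_disc : base A B i (discForm A B i c) =
    quad (fun k n => base A B i (coeffQ B i k n)) (fun k => base A B i (lineVec A i c k)) :=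
  map_quad _ _ _

theorem base_lineVec : (fun k => base A B i (lineVec A i c k)) =
    cross (fun k => base A B i (C (c k))) (fun k => base A B i (coeffL A i k)) :=
  funext fun _ => map_cross _ _ _ _

/-- The coordinates of the conjugate of the generic point of `X` in its fibre. -/
def conjX : Fin 3 → CoordRing A B :=
  reflect (fun k n => base A B i (coeffQ B i k n)) (fun k => base A B i (lineVec A i c k))
    (fibX A B i)

theorem lin_conjX : lin (fun k => base A B i (coeffL A i k)) (conjX A B i c) = 0 := by
  rw [conjX, lin_reflect, lin_fibX, mul_zero]
  rw [← map_lin, lin_lineVec, map_zero]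

theorem quad_conjX : quad (fun k n => base A B i (coeffQ B i k n)) (conjX A B i c) = 0 := by
  rw [conjX, quad_reflect, quad_fibX, mul_zero]

/-- The involution of the fibres of the projection `i`, up to a scalar factor. -/
def conj : CoordRing A B →+* CoordRing A B :=
  fibLift (base A B i) (conjX A B i c) (lin_conjX A B i c) (quad_conjX A B i c)

@[simp] theorem conj_base (s : BasePoly K i) : conj A B i c (base A B i s) = base A B i s := by
  rw [conj, ← mk_incl, fibLift_mk, evalFib_incl]; rfl

@[simp] theorem conj_fibX (k : Fin 3) : conj A B i c (fibX A B i k) = conjX A B i c k := by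
  rw [conj, ← mk_X, fibLift_mk, evalFib_X]

theorem conjX_eq (k : Fin 3) : conjX A B i c k = base A B i (discForm A B i c) * fibX A B i k +
    base A B i (midForm A B i c k) * fibV A B i c := by
  rw [conjX, base_lineVec, reflect_coord _ (lin_fibX A B i), discForm, map_disc, midForm,
    map_midCoeff]
  rfl

/-- Product of the two roots of the quadratic equation of the `k`-th fibre coordinate. This is where
the forms `G_k` enter both the push-forward and the action of the involution. -/
theorem fibX_mul_conjX (k : Fin 3) : fibX A B i k * conjX A B i c k =
    -(fibV A B i c ^ 2 * base A B i (formG A B i k)) := by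
  rw [conjX, base_lineVec, mul_reflect _ (lin_fibX A B i) (quad_fibX A B i), formG_eq, map_gCoeff]
  rfl

theorem conj_fibV : conj A B i c (fibV A B i c) =
    -(base A B i (discForm A B i c) * fibV A B i c) := by
  rw [fibV, map_lin]
  simp only [conj_base, conj_fibX]
  have := lin_coord_reflect (l := fun k => base A B i (coeffL A i k))
    (q := fun k n => base A B i (coeffQ B i k n)) (x := fibX A B i) (fun k => base A B i (C (c k)))
  rw [← base_lineVec] at this
  rw [discForm, map_disc]
  exact this

theorem conj_conjX (k : Fin 3) : conj A B i c (conjX A B i c k) =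
    base A B i (discForm A B i c) ^ 2 * fibX A B i k := by
  rw [conjX, map_reflect]
  simp only [conj_base, conj_fibX]
  rw [conjX, reflect_reflect, base_disc]

/-- Where the `k`-th entry of `c × l` is invertible, all fibre coordinates are combinations over the
base of the `k`-th one and of `fibV`. -/
theorem lineVec_mul_fibX (k n : Fin 3) :
    base A B i (lineVec A i c k) * fibX A B i n = fibX A B i k * base A B i (lineVec A i c n) +
      fibV A B i c * base A B i (cross (coeffL A i) (Pi.single k 1) n) := by
  have h := coord_eq (fun k => base A B i (C (c k))) (lin_fibX A B i) k n
  have e : (fun m => base A B i (Pi.single (M := fun _ => BasePoly K i) k 1 m)) =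
      Pi.single k 1 := by
    ext m : 1
    by_cases h : m = k
    · subst h; simp
    · simp [h]
  rw [lineVec, map_cross, map_cross, map_cross, e]
  exact h

theorem quad_eq_fibX (k : Fin 3) :
    base A B i (discForm A B i c) * fibX A B i k ^ 2 +
      base A B i (midForm A B i c k) * fibV A B i c * fibX A B i k +
      base A B i (formG A B i k) * fibV A B i c ^ 2 = 0 := by
  have h := quad_coord (fun k => base A B i (C (c k))) (lin_fibX A B i) (quad_fibX A B i) k
  rw [discForm, map_disc, midForm, map_midCoeff, formG_eq, map_gCoeff]
  exact h

theorem mk_eq_evalFib : Ideal.Quotient.mk (idealX A B) = evalFib (base A B i) (fibX A B i) := by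
  refine hom_ext_fib (i := i) (fun s => ?_) (fun k => ?_)
  · rw [evalFib_incl, mk_incl]
  · rw [evalFib_X, mk_X]

/-- Applying the reflection twice scales the fibre coordinates by the square of `discForm`; only the
degree in the factor `i` matters. -/
theorem conj_conj_form {f : MvPolynomial (Fin 3 × Fin 3) K} {d : Fin 3 → ℕ} (hf : IsForm f d) :
    conj A B i c (conj A B i c (Ideal.Quotient.mk _ f)) =
      (base A B i (discForm A B i c) ^ 2) ^ d i * Ideal.Quotient.mk _ f := by
  have h : ((conj A B i c).comp (conj A B i c)).comp (Ideal.Quotient.mk _) =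
      evalFib (base A B i) (fun k => base A B i (discForm A B i c) ^ 2 * fibX A B i k) := by
    refine hom_ext_fib (i := i) (fun s => ?_) (fun k => ?_)
    · rw [evalFib_incl, RingHom.comp_apply, RingHom.comp_apply, mk_incl, conj_base, conj_base]
    · rw [evalFib_X, RingHom.comp_apply, RingHom.comp_apply, mk_X, conj_fibX, conj_conjX]
  rw [mk_eq_evalFib A B i, ← evalFib_smul _ _ hf, ← h, ← mk_eq_evalFib A B i]
  rfl

/-- The homomorphism of polynomial rings inducing `conj`. -/
def conjPoly : MvPolynomial (Fin 3 × Fin 3) K →+* MvPolynomial (Fin 3 × Fin 3) K :=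
  evalFib (incl i) (reflect (fun k n => incl i (coeffQ B i k n))
    (fun k => incl i (lineVec A i c k)) (fun k => X (i, k)))

theorem mk_conjPoly (f : MvPolynomial (Fin 3 × Fin 3) K) :
    Ideal.Quotient.mk (idealX A B) (conjPoly A B i c f) =
      conj A B i c (Ideal.Quotient.mk _ f) := by
  have : (Ideal.Quotient.mk (idealX A B)).comp (conjPoly A B i c) =
      (conj A B i c).comp (Ideal.Quotient.mk _) := by
    refine hom_ext_fib (i := i) (fun s => ?_) (fun k => ?_)
    · rw [RingHom.comp_apply, RingHom.comp_apply, mk_incl, conj_base, conjPoly, evalFib_incl,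
        mk_incl]
    · rw [RingHom.comp_apply, RingHom.comp_apply, mk_X, conj_fibX, conjPoly, evalFib_X,
        map_reflect]
      rfl
  exact RingHom.congr_fun this f

/-- The multidegree of the conjugate of a form. -/
def conjDeg (d : Fin 3 → ℕ) : Fin 3 → ℕ :=
  ∑ t, d t • (if t = i then Pi.single i 1 + extDeg i (fun _ => 4) else Pi.single t 1 : Fin 3 → ℕ)

/-- Each fibre coordinate becomes an expression still linear in the fibre coordinates, but of degree
`2 + 1 + 1 = 4` in each other factor: once in the `q`, twice in `c × l`. -/
theorem conjDeg_apply (d : Fin 3 → ℕ) (t : Fin 3) :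
    conjDeg i d t = if t = i then d i else d t + 4 * d i := by
  rw [conjDeg, Finset.sum_apply]
  have h : ∀ a : Fin 3, (d a • (if a = i then Pi.single i 1 + extDeg i (fun _ => 4)
      else Pi.single a 1 : Fin 3 → ℕ)) t = (if a = t then d a else 0) +
        (if a = i then (if t = i then 0 else 4 * d i) else 0) := by
    intro a
    by_cases h1 : a = i <;> by_cases h2 : t = i
    · subst h1 h2; simp [extDeg]
    · subst h1; simp [extDeg, h2, Ne.symm h2]; ring
    · have h3 : a ≠ t := fun h => h1 (h.trans h2)
      simp [h1, h3, h3.symm]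
    · by_cases h3 : a = t
      · subst h3; simp [h1]
      · simp [h1, h3, Ne.symm h3]
  simp_rw [h]
  rw [Finset.sum_add_distrib]
  by_cases h2 : t = i
  · simp [h2]
  · simp [h2]

theorem conjDeg_injective : Function.Injective (conjDeg i) := by
  intro d e h
  have hi : d i = e i := by simpa [conjDeg_apply] using congrFun h i
  ext t
  have ht := congrFun h t
  rw [conjDeg_apply, conjDeg_apply] at ht
  by_cases hti : t = i
  · rw [hti, hi]
  · simpa [hti, hi] using ht

theorem isForm_conjPoly (f : MvPolynomial (Fin 3 × Fin 3) K) (d : Fin 3 → ℕ) (hf : IsForm f d) :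
    IsForm (conjPoly A B i c f) (conjDeg i d) := by
  refine hf.map_hom _ _ (fun a => by simp [conjPoly, evalFib_C]) (fun v => ?_)
  by_cases hv : v.1 = i
  · obtain ⟨t, j⟩ := v
    obtain rfl : t = i := hv
    rw [conjPoly, evalFib_X, if_pos rfl, reflect]
    have hs : ∀ k, IsForm (incl t (lineVec A t c k)) _ := fun k => (isForm_lineVec A t c k).incl
    have hq : ∀ k n, IsForm (incl t (coeffQ B t k n)) _ := fun k n => (isForm_coeffQ B t k n).incl
    have hx : ∀ k, IsForm (X (t, k) : MvPolynomial (Fin 3 × Fin 3) K) _ := fun k => isForm_X t k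
    refine IsWeightedHomogeneous.sub ?_ ?_
    · have h1 := (isForm_bil hq hx hs).mul (hs j)
      have e : extDeg t (fun _ => 2) + (Pi.single t 1 + extDeg t (fun _ => 1)) +
          extDeg t (fun _ => 1) = Pi.single t 1 + extDeg t (fun _ => 4) := by
        ext a
        by_cases ha : a = t <;> simp [extDeg, ha]
      rwa [e] at h1
    · have h1 := (isForm_quad hq hs).mul (hx j)
      have e : extDeg t (fun _ => 2) + (extDeg t (fun _ => 1) + extDeg t (fun _ => 1)) +
          Pi.single t 1 = Pi.single t 1 + extDeg t (fun _ => 4) := by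
        ext a
        by_cases ha : a = t <;> simp [extDeg, ha]
      rwa [e] at h1
  · obtain ⟨t, j⟩ := v
    have : (X (t, j) : MvPolynomial (Fin 3 × Fin 3) K) = incl i (X (⟨t, hv⟩, j)) := by
      rw [incl_X]
    rw [if_neg hv, this, conjPoly, evalFib_incl, ← this]
    exact isForm_X _ _

variable {A B i c}

/-- If the linear form vanished along P, the quadratic equation would reduce to `D * x_k ^ 2 = 0`
for every `k`, and all fibre coordinates would vanish, contrary to relevance. -/
theorem fibV_notMem (P : PrimeDivisor (idealX A B))
    (hD : base A B i (discForm A B i c) ∉ P.ideal) : fibV A B i c ∉ P.ideal := by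
  intro hv
  have hP := P.isPrime
  obtain ⟨k, hk⟩ := P.relevant i
  have h := quad_eq_fibX A B i c k
  have h2 : base A B i (discForm A B i c) * fibX A B i k ^ 2 ∈ P.ideal := by
    have : base A B i (discForm A B i c) * fibX A B i k ^ 2 =
        -(base A B i (midForm A B i c k) * fibX A B i k +
          base A B i (formG A B i k) * fibV A B i c) * fibV A B i c := by
      linear_combination h
    rw [this]
    exact Ideal.mul_mem_left _ _ hv
  exact ((hP.mem_or_mem h2).resolve_left hD) |> fun h => hk (hP.mem_of_pow_mem 2 h)

theorem base_ne_zero {s : BasePoly K i} (hs : s ≠ 0) :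
    base A B i s ≠ 0 := fun h => hs (base_injective A B i (by rw [h, map_zero]))

/-- Over the fraction field, `conj` followed by its rescaling by `D ^ (-2)`, where `D` is the image
of `discForm`, is the canonical embedding. -/
theorem conj_injective [hJ : (idealX A B).IsPrime]
    (hD : discForm A B i c ≠ 0) : Function.Injective (conj A B i c) := by
  set F := FractionRing (CoordRing A B)
  set a : F := (algebraMap _ F (base A B i (discForm A B i c)) ^ 2)⁻¹ with ha
  have ha0 : algebraMap _ F (base A B i (discForm A B i c)) ^ 2 ≠ 0 := by
    refine pow_ne_zero 2 ?_
    rw [Ne, IsFractionRing.to_map_eq_zero_iff]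
    exact base_ne_zero hD
  set φ : BasePoly K i →+* F := (algebraMap (CoordRing A B) F).comp (base A B i) with hφ
  have hl : lin (fun k => φ (coeffL A i k)) (fun k => algebraMap _ F (conjX A B i c k)) = 0 := by
    have := congrArg (algebraMap (CoordRing A B) F) (lin_conjX A B i c)
    rwa [map_lin, map_zero] at this
  have hq : quad (fun k n => φ (coeffQ B i k n)) (fun k => algebraMap _ F (conjX A B i c k)) = 0 := by
    have := congrArg (algebraMap (CoordRing A B) F) (quad_conjX A B i c)
    rwa [map_quad, map_zero] at this
  have hcomp : (fibLift (A := A) (B := B) φ (fun k => a * algebraMap _ F (conjX A B i c k))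
      (by rw [lin_smul, hl, mul_zero]) (by rw [quad_smul, hq, mul_zero])).comp (conj A B i c) =
      algebraMap (CoordRing A B) F := by
    set θ := fibLift (A := A) (B := B) φ (fun k => a * algebraMap _ F (conjX A B i c k))
      (by rw [lin_smul, hl, mul_zero]) (by rw [quad_smul, hq, mul_zero]) with hθ
    have hb : ∀ s, θ (base A B i s) = φ s := fun s => by
      rw [hθ, ← mk_incl, fibLift_mk, evalFib_incl]
    have hx : ∀ k, θ (fibX A B i k) = a * algebraMap _ F (conjX A B i c k) := fun k => by
      rw [hθ, ← mk_X, fibLift_mk, evalFib_X]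
    refine hom_ext_coordRing (i := i) (fun s => ?_) (fun k => ?_)
    · rw [RingHom.comp_apply, conj_base, hb]; rfl
    · rw [RingHom.comp_apply, conj_fibX, conjX, map_reflect]
      simp only [hb, hx]
      rw [reflect_smul]
      have := congrArg (algebraMap (CoordRing A B) F) (conj_conjX A B i c k)
      nth_rw 1 [conjX] at this
      rw [map_reflect] at this
      simp only [conj_base, conj_fibX] at this
      rw [map_reflect, map_mul, map_pow] at this
      rw [show (fun k n => φ (coeffQ B i k n)) =
        fun k n => algebraMap _ F (base A B i (coeffQ B i k n)) from rfl,
        show (fun k => φ (lineVec A i c k)) =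
        fun k => algebraMap _ F (base A B i (lineVec A i c k)) from rfl, this, ha, ← mul_assoc,
        inv_mul_cancel₀ ha0, one_mul]
  intro x y hxy
  have := congrArg (fibLift (A := A) (B := B) φ (fun k => a * algebraMap _ F (conjX A B i c k))
      (by rw [lin_smul, hl, mul_zero]) (by rw [quad_smul, hq, mul_zero])) hxy
  rw [← RingHom.comp_apply, ← RingHom.comp_apply, hcomp] at this
  exact IsFractionRing.injective _ F this

/-- `conj` fixes the base and sends `conjX` to `D ^ 2` times the original coordinate, so every
element is a quotient of values of `conj` with denominator a power of `D ^ 2`, which is outside P.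
This is the surjectivity input for the local rings. -/
theorem exists_conj_eq (P : Ideal (CoordRing A B)) [hP : P.IsPrime]
    (hD : base A B i (discForm A B i c) ∉ P) (a : CoordRing A B) :
    ∃ a' u, conj A B i c u ∉ P ∧ conj A B i c a' = conj A B i c u * a := by
  have h1 : (1 : CoordRing A B) ∉ P := fun h => hP.ne_top ((Ideal.eq_top_iff_one P).mpr h)
  obtain ⟨f, rfl⟩ := Ideal.Quotient.mk_surjective a
  induction f using MvPolynomial.induction_on with
  | C b =>
    refine ⟨base A B i (C b), 1, by rwa [map_one], ?_⟩
    rw [conj_base, map_one, one_mul, ← mk_incl, incl_C]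
  | add p q hp hq =>
    obtain ⟨a, u, hu, h⟩ := hp
    obtain ⟨a', u', hu', h'⟩ := hq
    refine ⟨a * u' + a' * u, u * u', ?_, ?_⟩
    · rw [map_mul]; exact fun h => (hP.mem_or_mem h).elim hu hu'
    · simp only [map_mul, map_add, h, h']; ring
  | mul_X p v hp =>
    obtain ⟨a, u, hu, h⟩ := hp
    by_cases hv : v.1 = i
    · obtain ⟨t, j⟩ := v
      obtain rfl : t = i := hv
      refine ⟨a * conjX A B t c j, u * base A B t (discForm A B t c) ^ 2, ?_, ?_⟩
      · rw [map_mul, map_pow, conj_base]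
        exact fun h => (hP.mem_or_mem h).elim hu fun h => hD (hP.mem_of_pow_mem 2 h)
      · simp only [map_mul, map_pow, conj_base, h, conj_conjX, mk_X]; ring
    · refine ⟨a * base A B i (X (⟨v.1, hv⟩, v.2)), u, hu, ?_⟩
      rw [map_mul, conj_base, h, map_mul, ← mk_incl, incl_X]; ring

/-- The image of a prime divisor under the involution of the fibres of the projection `i`. -/
def conjDiv [hJ : (idealX A B).IsPrime] (P : PrimeDivisor (idealX A B))
    (hD : base A B i (discForm A B i c) ∉ P.ideal) : PrimeDivisor (idealX A B) where
  ideal := P.ideal.comap (conj A B i c)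
  isPrime := inferInstance
  homogeneous f hf d := by
    rw [Ideal.mem_comap, ← mk_conjPoly] at hf ⊢
    rw [← component_map_hom _ _ (conjDeg_injective i) (isForm_conjPoly A B i c)]
    exact P.homogeneous _ hf _
  relevant t := by
    by_cases ht : t = i
    · subst ht
      by_contra! h
      have hall : ∀ k, conjX A B t c k ∈ P.ideal := fun k => by
        have := h k
        rwa [Ideal.mem_comap, mk_X, conj_fibX] at this
      -- The image of `fibV` is a combination of the conjugate coordinates, but equals `-(D *
      -- fibV)`, neither factor of which vanishes along P.
      have hv : conj A B t c (fibV A B t c) ∈ P.ideal := by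
        rw [fibV, map_lin]
        simp only [conj_fibX, lin]
        exact add_mem (add_mem (Ideal.mul_mem_left _ _ (hall 0)) (Ideal.mul_mem_left _ _ (hall 1)))
          (Ideal.mul_mem_left _ _ (hall 2))
      rw [conj_fibV, neg_mem_iff] at hv
      exact (P.isPrime.mem_or_mem hv).elim hD (fibV_notMem P hD)
    · obtain ⟨k, hk⟩ := P.relevant t
      refine ⟨k, ?_⟩
      have e : Ideal.Quotient.mk (idealX A B) (X (t, k)) = base A B i (X (⟨t, ht⟩, k)) := by
        rw [← mk_incl, incl_X]
      rwa [Ideal.mem_comap, e, conj_base, ← e]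
  height_eq_one := by
    have hD0 : discForm A B i c ≠ 0 := fun h => hD (by rw [h, map_zero]; exact P.ideal.zero_mem)
    have h := localRingHom_bijective (conj A B i c) (conj_injective hD0) P.ideal
      (exists_conj_eq P.ideal hD)
    have h2 := ringKrullDim_eq_of_ringEquiv (RingEquiv.ofBijective _ h)
    rw [IsLocalization.AtPrime.ringKrullDim_eq_height (P.ideal.comap (conj A B i c)),
      IsLocalization.AtPrime.ringKrullDim_eq_height P.ideal, P.height_eq_one] at h2
    exact WithBot.coe_injective h2

variable [hJ : (idealX A B).IsPrime]

theorem mem_conjDiv (P : PrimeDivisor (idealX A B))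
    (hD : base A B i (discForm A B i c) ∉ P.ideal) (f : CoordRing A B) :
    f ∈ (conjDiv P hD).ideal ↔ conj A B i c f ∈ P.ideal := Iff.rfl

theorem base_mem_conjDiv (P : PrimeDivisor (idealX A B))
    (hD : base A B i (discForm A B i c) ∉ P.ideal) (s : BasePoly K i) :
    base A B i s ∈ (conjDiv P hD).ideal ↔ base A B i s ∈ P.ideal := by
  rw [mem_conjDiv, conj_base]

theorem conjDiv_conjDiv (P : PrimeDivisor (idealX A B))
    (hD : base A B i (discForm A B i c) ∉ P.ideal)
    (hD' : base A B i (discForm A B i c) ∉ (conjDiv P hD).ideal) :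
    conjDiv (conjDiv P hD) hD' = P := by
  refine PrimeDivisor.ext_forms fun f d hf => ?_
  rw [mem_conjDiv, mem_conjDiv, conj_conj_form A B i c hf]
  refine ⟨fun h => (P.isPrime.mem_or_mem h).resolve_left fun h => hD ?_,
    fun h => Ideal.mul_mem_left _ _ h⟩
  exact P.isPrime.mem_of_pow_mem 2 (P.isPrime.mem_of_pow_mem _ h)

/-- `conj` induces an isomorphism from the local ring at the conjugate of P to the local ring at P,
and isomorphisms preserve lengths. -/
theorem ordAt_conjDiv (P : PrimeDivisor (idealX A B))
    (hD : base A B i (discForm A B i c) ∉ P.ideal) (f : CoordRing A B) :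
    ordAt (conjDiv P hD) f = ordAt P (conj A B i c f) := by
  have hD0 : discForm A B i c ≠ 0 := fun h => hD (by rw [h, map_zero]; exact P.ideal.zero_mem)
  have h := localRingHom_bijective (conj A B i c) (conj_injective hD0) P.ideal
    (exists_conj_eq P.ideal hD)
  have h2 := ord_map_of_bijective _ h (algebraMap _ _ f)
  rw [Localization.localRingHom_to_map] at h2
  exact congrArg ENat.toNat h2.symm

theorem ordAt_base_conjDiv (P : PrimeDivisor (idealX A B))
    (hD : base A B i (discForm A B i c) ∉ P.ideal) (s : BasePoly K i) :
    ordAt (conjDiv P hD) (base A B i s) = ordAt P (base A B i s) := by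
  rw [ordAt_conjDiv, conj_base]

theorem ordAt_add_ordAt_conjDiv (P : PrimeDivisor (idealX A B))
    (hD : base A B i (discForm A B i c) ∉ P.ideal) (k : Fin 3) (hG : formG A B i k ≠ 0) :
    ordAt P (fibX A B i k) + ordAt (conjDiv P hD) (fibX A B i k) =
      ordAt P (base A B i (formG A B i k)) := by
  have hD0 : discForm A B i c ≠ 0 := fun h => hD (by rw [h, map_zero]; exact P.ideal.zero_mem)
  have hv := fibV_notMem P hD
  have hv0 : fibV A B i c ≠ 0 := fun h => hv (h ▸ P.ideal.zero_mem)
  have hx : conj A B i c (fibX A B i k) ≠ 0 := fun h => fibX_ne_zero i k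
    (conj_injective hD0 (by rw [h, map_zero]))
  rw [ordAt_conjDiv, ← ordAt_mul P (fibX_ne_zero i k) hx, conj_fibX, fibX_mul_conjX, ordAt_neg,
    ordAt_mul P (pow_ne_zero 2 hv0) (base_ne_zero hG), ordAt_pow P hv0,
    ordAt_of_notMem P hv, mul_zero, zero_add]

end Reflection

/-! ## The involution on generic points -/

section Sigma

/-- Decomposition of `x` along the vectors `a` and `c × l` of the line, with denominators cleared;
the last term corrects for `x` off the line. The coefficient of `c × l` is read from `a × x`, which
vanishes at `x = a`. -/
theorem cross_decomp {S : Type*} [CommRing S] {l a : Fin 3 → S} (ha : lin l a = 0)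
    (c x : Fin 3 → S) (k n : Fin 3) :
    (lin c a * l k) * x n = l k * lin c x * a n - cross a x k * cross c l n +
      lin l x * (lin c a * (Pi.single k 1 : Fin 3 → S) n - c k * a n) := by
  have key : ∀ k n : Fin 3, (lin c a * l k) * x n = l k * lin c x * a n -
      cross a x k * cross c l n +
      lin l x * (lin c a * (Pi.single k 1 : Fin 3 → S) n - c k * a n) -
      lin l a * (lin c x * (Pi.single k 1 : Fin 3 → S) n - c k * x n) := by
    intro k n
    fin_cases k <;> fin_cases n <;>
    simp [lin, cross, fin3_two_add_one, fin3_two_add_two, fin3_one_add_one,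
      fin3_one_add_two] <;> ring
  rw [key k n, ha, zero_mul, sub_zero]

theorem cross_self {S : Type*} [CommRing S] (a : Fin 3 → S) (k : Fin 3) : cross a a k = 0 := by
  simp only [cross]; ring

/-- The vector product of two vectors of a line. -/
theorem cross_linePt {S : Type*} [CommRing S] {l a : Fin 3 → S} (ha : lin l a = 0)
    (c : Fin 3 → S) (k : Fin 3) : cross a (cross c l) k = -(lin c a * l k) := by
  simp only [lin] at ha
  fin_cases k <;>
  simp [lin, cross, fin3_two_add_one, fin3_two_add_two, fin3_one_add_one,
      fin3_one_add_two]
  · linear_combination c 0 * ha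
  · linear_combination c 1 * ha
  · linear_combination c 2 * ha

/-- Modulo the equation of a line through a zero `a` of a quadratic form, the quadratic form is a
product of two linear forms. -/
theorem quad_decomp {S : Type*} [CommRing S] {l a : Fin 3 → S} {q : Fin 3 → Fin 3 → S}
    (ha : lin l a = 0) (hq : quad q a = 0) (c x : Fin 3 → S) (k : Fin 3) :
    lin l x ∣ (lin c a * l k) ^ 2 * quad q x - (-cross a x k) *
      (l k * lin c x * bil q a (cross c l) + (-cross a x k) * quad q (cross c l)) := by
  have h : (fun n => (lin c a * l k) * x n) = fun n => (l k * lin c x * a n +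
      (-cross a x k) * cross c l n) +
      lin l x * (lin c a * (Pi.single k 1 : Fin 3 → S) n - c k * a n) := by
    ext n
    rw [cross_decomp ha]; ring
  rw [← quad_smul, h, quad_add, quad_add, quad_smul, quad_smul, quad_smul, hq, bil_smul_right,
    bil_smul_left, bil_smul_right]
  refine ⟨bil q (fun n => l k * lin c x * a n + (-cross a x k) * cross c l n)
      (fun n => lin c a * (Pi.single k 1 : Fin 3 → S) n - c k * a n) +
      lin l x * quad q (fun n => lin c a * (Pi.single k 1 : Fin 3 → S) n - c k * a n), ?_⟩
  ring

theorem eval_linear_comb {F : Type*} [Field F] {M : MvPolynomial (Fin 3) F}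
    (hM : M.IsHomogeneous 1) (u w : F) (a b : Fin 3 → F) :
    eval (fun n => u * a n + w * b n) M = u * eval a M + w * eval b M := by
  have hM' : M ∈ Submodule.span F (Set.range (X : Fin 3 → MvPolynomial (Fin 3) F)) := by
    rw [← homogeneousSubmodule_one_eq_span_X]; exact hM
  clear hM
  induction hM' using Submodule.span_induction with
  | mem x h => obtain ⟨j, rfl⟩ := h; simp
  | zero => simp
  | add p q _ _ hp hq =>
    rw [map_add, map_add, map_add, hp, hq]; ring
  | smul r p _ hp => rw [smul_eval, smul_eval, smul_eval, hp]; ring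

variable {K : Type u} [Field K]
variable {A : (Fin 3 → Fin 3) → K} {B : (Fin 3 → Fin 3) → (Fin 3 → Fin 3) → K} {i : Fin 3}
  {c : Fin 3 → K}

variable (i) in
/-- Evaluation at the generic point of `P` of polynomials in the coordinates of the factors other
than `i`. -/
def evalBase (P : PrimeDivisor (idealX A B)) : BasePoly K i →+* CoordField P :=
  (algebraMap (CoordRing A B) (CoordField P)).comp (base A B i)

theorem restrictFibre_eq (P : PrimeDivisor (idealX A B)) (f : MvPolynomial (Fin 3 × Fin 3) K) :
    restrictFibre i P f =
      evalFib ((C : CoordField P →+* MvPolynomial (Fin 3) (CoordField P)).comp (evalBase i P))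
        X f := by
  have : eval₂Hom ((C : CoordField P →+* MvPolynomial (Fin 3) (CoordField P)).comp
      ((evalGen P).comp C)) (fun v => if v.1 = i then X v.2 else C (evalGen P (X v))) =
      evalFib ((C : CoordField P →+* MvPolynomial (Fin 3) (CoordField P)).comp (evalBase i P))
        X := by
    refine MvPolynomial.ringHom_ext (fun a => ?_) (fun v => ?_)
    · simp [evalFib, evalGen, evalBase, base]
    · by_cases hv : v.1 = i
      · simp [evalFib, hv]
      · simp [evalFib, hv, evalGen, evalBase, base]
  exact RingHom.congr_fun this f

theorem eval_restrictFibre (P : PrimeDivisor (idealX A B)) (a : Fin 3 → CoordField P)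
    (f : MvPolynomial (Fin 3 × Fin 3) K) :
    eval a (restrictFibre i P f) = evalFib (evalBase i P) a f := by
  have : (eval a).comp (evalFib ((C : CoordField P →+* MvPolynomial (Fin 3) (CoordField P)).comp
      (evalBase i P)) X) = evalFib (evalBase i P) a := by
    refine hom_ext_fib (i := i) (fun s => ?_) (fun k => ?_)
    · simp
    · simp
  rw [restrictFibre_eq]
  exact RingHom.congr_fun this f

theorem algebraMap_coordField_eq_zero (P : PrimeDivisor (idealX A B)) (f : CoordRing A B) :
    algebraMap (CoordRing A B) (CoordField P) f = 0 ↔ f ∈ P.ideal :=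
  Ideal.algebraMap_residueField_eq_zero

variable [hJ : (idealX A B).IsPrime]

theorem evalFib_conjX (P : PrimeDivisor (idealX A B)) (f : MvPolynomial (Fin 3 × Fin 3) K) :
    evalFib (evalBase i P) (fun k => algebraMap _ (CoordField P) (conjX A B i c k)) f =
      algebraMap _ (CoordField P) (conj A B i c (Ideal.Quotient.mk _ f)) := by
  have : evalFib (evalBase i P) (fun k => algebraMap _ (CoordField P) (conjX A B i c k)) =
      ((algebraMap _ (CoordField P)).comp (conj A B i c)).comp (Ideal.Quotient.mk _) := by
    refine hom_ext_fib (i := i) (fun s => ?_) (fun k => ?_)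
    · rw [evalFib_incl, RingHom.comp_apply, RingHom.comp_apply, mk_incl, conj_base]; rfl
    · rw [evalFib_X, RingHom.comp_apply, RingHom.comp_apply, mk_X, conj_fibX]
  exact RingHom.congr_fun this f

theorem mem_conjDiv_iff (P : PrimeDivisor (idealX A B))
    (hD : base A B i (discForm A B i c) ∉ P.ideal) (f : MvPolynomial (Fin 3 × Fin 3) K) :
    Ideal.Quotient.mk _ f ∈ (conjDiv P hD).ideal ↔
      evalFib (evalBase i P) (fun k => algebraMap _ (CoordField P) (conjX A B i c k)) f = 0 := by
  rw [mem_conjDiv, evalFib_conjX, algebraMap_coordField_eq_zero]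

/-- The data of the fibre through the generic point of a prime divisor. -/
theorem generic_fibre (P : PrimeDivisor (idealX A B))
    (hD : base A B i (discForm A B i c) ∉ P.ideal) :
    lin (fun k => evalBase i P (coeffL A i k))
      (fun k => algebraMap _ (CoordField P) (fibX A B i k)) = 0 ∧
    quad (fun k n => evalBase i P (coeffQ B i k n))
      (fun k => algebraMap _ (CoordField P) (fibX A B i k)) = 0 ∧
    lin (fun k => evalBase i P (C (c k)))
      (fun k => algebraMap _ (CoordField P) (fibX A B i k)) ≠ 0 ∧
    quad (fun k n => evalBase i P (coeffQ B i k n))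
      (cross (fun k => evalBase i P (C (c k))) (fun k => evalBase i P (coeffL A i k))) ≠ 0 ∧
    (∃ k, evalBase i P (coeffL A i k) ≠ 0) ∧
    ∀ k, algebraMap _ (CoordField P) (conjX A B i c k) =
      reflect (fun k n => evalBase i P (coeffQ B i k n))
        (cross (fun k => evalBase i P (C (c k))) (fun k => evalBase i P (coeffL A i k)))
        (fun k => algebraMap _ (CoordField P) (fibX A B i k)) k := by
  have hD' : quad (fun k n => evalBase i P (coeffQ B i k n))
      (cross (fun k => evalBase i P (C (c k))) (fun k => evalBase i P (coeffL A i k))) ≠ 0 := by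
    have : evalBase i P (discForm A B i c) ≠ 0 := fun h =>
      hD ((algebraMap_coordField_eq_zero P _).mp h)
    rwa [discForm, map_disc] at this
  refine ⟨?_, ?_, ?_, hD', ?_, fun k => ?_⟩
  · have := congrArg (algebraMap (CoordRing A B) (CoordField P)) (lin_fibX A B i)
    rwa [map_lin, map_zero] at this
  · have := congrArg (algebraMap (CoordRing A B) (CoordField P)) (quad_fibX A B i)
    rwa [map_quad, map_zero] at this
  · have : algebraMap (CoordRing A B) (CoordField P) (fibV A B i c) ≠ 0 := fun h =>
      fibV_notMem P hD ((algebraMap_coordField_eq_zero P _).mp h)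
    rwa [fibV, map_lin] at this
  · by_contra! h
    refine hD' ?_
    simp [quad, cross, h]
  · have : (fun k => evalBase i P (lineVec A i c k)) =
        cross (fun k => evalBase i P (C (c k))) (fun k => evalBase i P (coeffL A i k)) :=
      funext fun _ => map_cross _ _ _ _
    rw [← this, conjX, map_reflect]
    rfl

/-- At `x` a combination of `a` and `s = c × l`, the quadratic form has no `a`-square term because
`a` is isotropic. It thus splits off the linear form vanishing at `a`, and the other factor vanishes
at the reflection of `a`. -/
theorem isSigma_conjDiv (P : PrimeDivisor (idealX A B))
    (hD : base A B i (discForm A B i c) ∉ P.ideal) : IsSigma i P (conjDiv P hD) := by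
  obtain ⟨hl, hq, hv, hD', ⟨k, hk⟩, hconj⟩ := generic_fibre P hD
  set l := fun k => evalBase i P (coeffL A i k)
  set q := fun k n => evalBase i P (coeffQ B i k n)
  set c' := fun k => evalBase i P (C (c k))
  set a := fun k => algebraMap _ (CoordField P) (fibX A B i k) with ha
  refine ⟨fun k => algebraMap _ (CoordField P) (conjX A B i c k), ?_, ?_, ?_, ?_⟩
  · obtain ⟨n, hn⟩ := (conjDiv P hD).relevant i
    intro h
    refine hn ?_
    rw [mem_conjDiv_iff, evalFib_X]
    exact congrFun h n
  · rw [eval_restrictFibre, evalFib_formL]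
    have := congrArg (algebraMap (CoordRing A B) (CoordField P)) (lin_conjX A B i c)
    rwa [map_lin, map_zero] at this
  -- `α` and `β` are the coefficients of `a` and `s` in `cross_decomp`; the factors are `M = r β`
  -- and `M' = b α + D β`, and `r` removes the square of the common denominator.
  · set β : MvPolynomial (Fin 3) (CoordField P) := -cross (fun n => C (a n)) X k with hβ
    set α : MvPolynomial (Fin 3) (CoordField P) := C (l k) * lin (fun n => C (c' n)) X with hα
    set b := bil q a (cross c' l) with hb
    set D := quad q (cross c' l) with hDdef
    set r := ((lin c' a * l k) ^ 2)⁻¹ with hr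
    have hβ1 : β.IsHomogeneous 1 :=
      (((isHomogeneous_X _ _).C_mul _).sub ((isHomogeneous_X _ _).C_mul _)).neg
    have hα1 : α.IsHomogeneous 1 :=
      ((((isHomogeneous_X _ _).C_mul _).add ((isHomogeneous_X _ _).C_mul _)).add
        ((isHomogeneous_X _ _).C_mul _)).C_mul _
    refine ⟨C r * β, C b * α + C D * β, hβ1.C_mul _, (hα1.C_mul _).add (hβ1.C_mul _), ?_, ?_, ?_⟩
    · rw [restrictFibre_eq, restrictFibre_eq, evalFib_formL, evalFib_formQ]
      have hdiv := quad_decomp (l := fun n => C (l n)) (a := fun n => C (a n))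
        (q := fun m n => C (q m n))
        (by rw [← map_lin (C : CoordField P →+* MvPolynomial (Fin 3) (CoordField P)), hl, map_zero])
        (by rw [← map_quad (C : CoordField P →+* MvPolynomial (Fin 3) (CoordField P)), hq, map_zero])
        (fun n => C (c' n)) X k
      obtain ⟨w, hw⟩ := hdiv
      refine ⟨C r * w, ?_⟩
      have e1 : bil (fun m n => C (q m n)) (fun n => C (a n))
          (cross (fun n => C (c' n)) (fun n => C (l n))) =
          (C b : MvPolynomial (Fin 3) (CoordField P)) := by
        rw [hb, map_bil]; congr 1; ext1 n; exact (map_cross _ _ _ _).symm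
      have e2 : quad (fun m n => C (q m n)) (cross (fun n => C (c' n)) (fun n => C (l n))) =
          (C D : MvPolynomial (Fin 3) (CoordField P)) := by
        rw [hDdef, map_quad]; congr 1; ext1 n; exact (map_cross _ _ _ _).symm
      have e3 : C r * (lin (fun n => C (c' n)) (fun n => C (a n)) * C (l k)) ^ 2 =
          (1 : MvPolynomial (Fin 3) (CoordField P)) := by
        rw [← map_lin (C : CoordField P →+* MvPolynomial (Fin 3) (CoordField P)), ← C_mul,
          ← C_pow, ← C_mul, hr, inv_mul_cancel₀ (pow_ne_zero 2 (mul_ne_zero hv hk)), C_1]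
      rw [e1, e2] at hw
      have e4 : quad (fun m n => (C (q m n) : MvPolynomial (Fin 3) (CoordField P))) X - C r * β *
          (C b * α + C D * β) = lin (fun n => C (l n)) X * (C r * w) := by
        rw [hβ, hα]
        linear_combination (C r) * hw - (quad (fun m n => C (q m n)) X) * e3
      exact e4
    · have : eval (fun j => evalGen P (X (i, j))) β = 0 := by
        have : (fun j => evalGen P (X (i, j))) = a := rfl
        rw [this, hβ, map_neg, map_cross]
        simp [cross_self]
      rw [map_mul, this, mul_zero]
    · have hc : (fun k => algebraMap _ (CoordField P) (conjX A B i c k)) =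
          fun n => b * cross c' l n + (-D) * a n := by
        ext n; rw [hconj, reflect]; ring
      have ea : eval a β = 0 := by
        rw [hβ, map_neg, map_cross]; simp [cross_self]
      have es : eval (cross c' l) β = lin c' a * l k := by
        rw [hβ, map_neg, map_cross]; simp [cross_linePt hl]
      have ea' : eval a α = l k * lin c' a := by
        rw [hα, map_mul, map_lin]; simp
      have es' : eval (cross c' l) α = 0 := by
        rw [hα, map_mul, map_lin]; simp [lin_coord_cross]
      rw [hc, map_add, map_mul (eval _) (C b) α, map_mul (eval _) (C D) β, eval_linear_comb hα1, eval_linear_comb hβ1, ea, es, ea',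
        es', eval_C, eval_C]
      ring
  · intro d f _
    rw [mem_conjDiv_iff, eval_restrictFibre]

/-- On the line, `quad q = M * M'` with `M` vanishing at `a`. The values at `s` and `a + s`
determine `M'` on the line up to the factor `M(s)`, so its zero `a'` is proportional to the
reflection of `a`, whatever factorisation was chosen. -/
theorem eq_conjDiv_of_isSigma (P P' : PrimeDivisor (idealX A B))
    (hD : base A B i (discForm A B i c) ∉ P.ideal) (h : IsSigma i P P') : P' = conjDiv P hD := by
  obtain ⟨hl, hq, hv, hD', ⟨k, hk⟩, hconj⟩ := generic_fibre P hD
  obtain ⟨a', ha0, hla, ⟨M, M', hM, hM', hdvd, hMa, hMa'⟩, hf⟩ := h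
  set l := fun k => evalBase i P (coeffL A i k)
  set q := fun k n => evalBase i P (coeffQ B i k n)
  set c' := fun k => evalBase i P (C (c k))
  set a := fun k => algebraMap _ (CoordField P) (fibX A B i k) with ha
  set b := bil q a (cross c' l) with hb
  set D := quad q (cross c' l) with hDdef
  have hMa : eval a M = 0 := hMa
  rw [eval_restrictFibre, evalFib_formL] at hla
  have hprod : ∀ w, lin l w = 0 → quad q w = eval w M * eval w M' := by
    intro w hw
    obtain ⟨z, hz⟩ := hdvd
    have := congrArg (eval w) hz
    rw [map_sub, map_mul, map_mul, eval_restrictFibre, eval_restrictFibre, evalFib_formL,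
      evalFib_formQ] at this
    rw [show lin (fun k => evalBase i P (coeffL A i k)) w = 0 from hw, zero_mul, sub_eq_zero] at this
    exact this
  set s := cross c' l with hs
  have h1 : D = eval s M * eval s M' := hprod s (lin_cross l c')
  have h2 : b = eval s M * eval a M' := by
    -- As `M` and `quad q` vanish at `a`, the value at `a + s` is `b + D`, which isolates `b`.
    have h3 := hprod (fun n => 1 * a n + 1 * s n) (by
      have : lin l (fun n => 1 * a n + 1 * s n) = lin l a + lin l s := by simp only [lin]; ring
      rw [this, hl, lin_cross, add_zero])
    rw [eval_linear_comb hM, eval_linear_comb hM', hMa] at h3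
    have h4 : quad q (fun n => 1 * a n + 1 * s n) = b + D := by
      rw [quad_add, quad_smul, quad_smul, hq, bil_smul_left, bil_smul_right]; ring
    rw [h4] at h3
    linear_combination h3 - h1
  have h5 : ∀ n, a' n = (-(l k * lin c' a') / (D * (lin c' a * l k))) *
      algebraMap _ (CoordField P) (conjX A B i c n) := by
    have h6 : ∀ n, (lin c' a * l k) * a' n =
        l k * lin c' a' * a n + (-cross a a' k) * s n := fun n => by
      rw [cross_decomp hl c' a' k n, show lin l a' = 0 from hla]; ring
    have h7 : l k * lin c' a' * b + (-cross a a' k) * D = 0 := by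
      have h8 : eval (fun n => (lin c' a * l k) * a' n + 0 * a' n) M' = 0 := by
        rw [eval_linear_comb hM', hMa']; ring
      have h9 : (fun n => (lin c' a * l k) * a' n + 0 * a' n) =
          fun n => l k * lin c' a' * a n + (-cross a a' k) * s n := by
        ext n; rw [zero_mul, add_zero, h6]
      rw [h9, eval_linear_comb hM'] at h8
      linear_combination eval s M * h8 + (l k * lin c' a') * h2 + (-cross a a' k) * h1
    intro n
    rw [hconj, reflect]
    rw [div_mul_eq_mul_div, eq_div_iff (mul_ne_zero hD' (mul_ne_zero hv hk))]
    linear_combination D * h6 n + s n * h7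
  set r := -(l k * lin c' a') / (D * (lin c' a * l k))
  have hr : r ≠ 0 := fun h => ha0 (funext fun n => by rw [h5, h, zero_mul]; rfl)
  refine PrimeDivisor.ext_forms fun f d hfd => ?_
  rw [hf d f hfd, mem_conjDiv_iff, eval_restrictFibre, funext h5, evalFib_smul _ _ hfd, mul_eq_zero,
    or_iff_right (pow_ne_zero _ hr)]

theorem exists_discForm_of_memU (P : PrimeDivisor (idealX A B)) (h : MemU A B i P) :
    ∃ c, base A B i (discForm A B i c) ∉ P.ideal :=
  exists_discForm_notMem i (P.ideal.comap (base A B i)) h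

theorem conjDiv_eq_of_eq_conjDiv {P P' : PrimeDivisor (idealX A B)}
    {hD : base A B i (discForm A B i c) ∉ P'.ideal} (h : P = conjDiv P' hD)
    (hDP : base A B i (discForm A B i c) ∉ P.ideal) : conjDiv P hDP = P' := by
  subst h
  exact conjDiv_conjDiv P' hD hDP

/-- The involution of the prime divisors which meet `U_i`, if these are all prime divisors. -/
theorem exists_sigma (hU : ∀ P : PrimeDivisor (idealX A B), MemU A B i P)
    (P : PrimeDivisor (idealX A B)) :
    ∃ (c : Fin 3 → K) (hD : base A B i (discForm A B i c) ∉ P.ideal),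
      sigmaPrime i P = Finsupp.single (conjDiv P hD) 1 := by
  obtain ⟨c, hD⟩ := exists_discForm_of_memU P (hU P)
  refine ⟨c, hD, ?_⟩
  have hD1 : base A B i (discForm A B i c) ∉ (conjDiv P hD).ideal := by rwa [base_mem_conjDiv]
  have hex : ∃ P', MemU A B i P' ∧ IsSigma i P' P := by
    refine ⟨conjDiv P hD, hU _, ?_⟩
    have := isSigma_conjDiv (conjDiv P hD) hD1
    rwa [conjDiv_conjDiv] at this
  rw [sigmaPrime, dif_pos hex]
  congr 1
  set P'' := hex.choose with hP''
  obtain ⟨_, hs⟩ : MemU A B i P'' ∧ IsSigma i P'' P := hex.choose_spec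
  -- The chosen divisor may need another vector `c''` than `c`; uniqueness of the second
  -- intersection point reconciles the two.
  obtain ⟨c'', hD''⟩ := exists_discForm_of_memU P'' (hU P'')
  have h1 := eq_conjDiv_of_isSigma P'' P hD'' hs
  have hDP : base A B i (discForm A B i c'') ∉ P.ideal := by rw [h1]; rwa [base_mem_conjDiv]
  have h2 : IsSigma i P P'' := by
    have h3 := isSigma_conjDiv P hDP
    rwa [conjDiv_eq_of_eq_conjDiv h1 hDP] at h3
  exact eq_conjDiv_of_isSigma P P'' hD h2

end Sigma

/-! ## The action of the involutions on the coordinate divisors -/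

section Action

variable {K : Type u} [Field K]
variable {A : (Fin 3 → Fin 3) → K} {B : (Fin 3 → Fin 3) → (Fin 3 → Fin 3) → K} {i : Fin 3}

theorem mk_X_of_ne {j : Fin 3} (h : j ≠ i) (k : Fin 3) :
    Ideal.Quotient.mk (idealX A B) (X (j, k)) = base A B i (X (⟨j, h⟩, k)) := by
  rw [← mk_incl, incl_X]

variable [hJ : (idealX A B).IsPrime]

theorem sigmaPull_eq_mapDomain {σ : PrimeDivisor (idealX A B) → PrimeDivisor (idealX A B)}
    (h : ∀ P, sigmaPrime i P = Finsupp.single (σ P) 1) (D : WeilDiv (idealX A B)) :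
    sigmaPull A B i D = D.mapDomain σ := by
  rw [sigmaPull, Finsupp.liftAddHom_apply, Finsupp.mapDomain]
  refine Finsupp.sum_congr fun P _ => ?_
  rw [zmultiplesHom_apply, h, Finsupp.smul_single, smul_eq_mul, mul_one]

/-- On `U_i` the involution acts on Weil divisors by exchanging conjugate prime divisors. -/
theorem exists_sigmaPull_apply (hU : ∀ P : PrimeDivisor (idealX A B), MemU A B i P)
    (P : PrimeDivisor (idealX A B)) :
    ∃ (c : Fin 3 → K) (hD : base A B i (discForm A B i c) ∉ P.ideal),
      ∀ D, sigmaPull A B i D P = D (conjDiv P hD) := by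
  choose c hD hs using exists_sigma hU
  -- The vector `c` chosen at the conjugate may differ from the one chosen at P, so involutivity
  -- also rests on `eq_conjDiv_of_isSigma`.
  have hinv : Function.Involutive fun P => conjDiv P (hD P) := fun P => by
    have hD1 : base A B i (discForm A B i (c P)) ∉ (conjDiv P (hD P)).ideal := by
      rw [base_mem_conjDiv]; exact hD P
    have h1 := isSigma_conjDiv (conjDiv P (hD P)) hD1
    rw [conjDiv_conjDiv] at h1
    exact (eq_conjDiv_of_isSigma _ _ (hD _) h1).symm
  refine ⟨c P, hD P, fun D => ?_⟩
  have h := Finsupp.mapDomain_apply hinv.injective D (conjDiv P (hD P))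
  have h2 : conjDiv (conjDiv P (hD P)) (hD _) = P := hinv P
  rw [h2] at h
  rw [sigmaPull_eq_mapDomain hs, h]

theorem sigmaPull_coordDiv_of_ne (hU : ∀ P : PrimeDivisor (idealX A B), MemU A B i P) {j : Fin 3}
    (h : j ≠ i) : sigmaPull A B i (coordDiv A B j) = coordDiv A B j := by
  ext P
  obtain ⟨c, hD, hP⟩ := exists_sigmaPull_apply hU P
  rw [hP, coordDiv, divOf_apply, divOf_apply, mk_X_of_ne h, ordAt_base_conjDiv]

/-- Compared at each prime divisor, this is the additivity of orders in `ordAt_add_ordAt_conjDiv`.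
-/
theorem sigmaPull_coordDiv_self (hG : formG A B i 0 ≠ 0)
    (hU : ∀ P : PrimeDivisor (idealX A B), MemU A B i P) :
    sigmaPull A B i (coordDiv A B i) =
      divOf (base A B i (formG A B i 0)) - coordDiv A B i := by
  ext P
  obtain ⟨c, hD, hP⟩ := exists_sigmaPull_apply hU P
  have h := ordAt_add_ordAt_conjDiv P hD 0 hG
  rw [hP, Finsupp.sub_apply, coordDiv, divOf_apply, divOf_apply, divOf_apply, ← h]
  push_cast
  rw [fibX]
  ring

theorem isForm_prod_X (i : Fin 3) : IsForm
    (∏ t : {t : Fin 3 // t ≠ i}, (X (t, 0) : BasePoly K i) ^ 4) (fun _ => 4) := by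
  have h := IsWeightedHomogeneous.prod (w := multideg {t : Fin 3 // t ≠ i}) Finset.univ
    (fun t => (X (t, 0) : BasePoly K i) ^ 4) (fun t => 4 • (Pi.single t 1 : {t // t ≠ i} → ℕ))
    fun t _ => (isForm_X t 0).pow 4
  rw [← Finset.smul_sum] at h
  have e : (4 • ∑ t, (Pi.single t 1 : {t // t ≠ i} → ℕ)) = fun _ => 4 := by
    ext t
    simp [Finset.sum_apply, Pi.single_apply]
  rwa [e] at h

theorem prod_X_ne_zero (i : Fin 3) :
    (∏ t : {t : Fin 3 // t ≠ i}, (X (t, 0) : BasePoly K i) ^ 4) ≠ 0 :=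
  Finset.prod_ne_zero_iff.mpr fun _ _ => pow_ne_zero _ (X_ne_zero _)

theorem divOf_base_prod_X : divOf (base A B i (∏ t : {t : Fin 3 // t ≠ i}, X (t, 0) ^ 4)) =
    ∑ t : {t : Fin 3 // t ≠ i}, (4 : ℤ) • coordDiv A B t := by
  have h0 : ∀ t : {t : Fin 3 // t ≠ i}, base A B i (X (t, 0)) ≠ 0 := fun t =>
    base_ne_zero (X_ne_zero _)
  rw [map_prod, divOf_prod _ _ fun t _ => by rw [map_pow]; exact pow_ne_zero _ (h0 t)]
  refine Finset.sum_congr rfl fun t _ => ?_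
  rw [map_pow, divOf_pow (h0 t), coordDiv, mk_X_of_ne t.2]
  rfl

theorem linEquiv_sigmaPull_coordDiv (hG : formG A B i 0 ≠ 0)
    (hU : ∀ P : PrimeDivisor (idealX A B), MemU A B i P) :
    LinEquiv (sigmaPull A B i (coordDiv A B i))
      ((∑ t : {t : Fin 3 // t ≠ i}, (4 : ℤ) • coordDiv A B t) - coordDiv A B i) := by
  have hnot : ∀ s : BasePoly K i, s ≠ 0 → incl i s ∉ idealX A B := fun s hs h =>
    base_ne_zero (A := A) (B := B) hs (by rw [← mk_incl]; exact Ideal.Quotient.eq_zero_iff_mem.mpr h)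
  refine ⟨extDeg i (fun _ => 4), incl i (formG A B i 0), incl i (∏ t : {t : Fin 3 // t ≠ i}, X (t, 0) ^ 4),
    (isForm_formG A B i 0).incl, (isForm_prod_X i).incl, hnot _ hG, hnot _ (prod_X_ne_zero i), ?_⟩
  rw [sigmaPull_coordDiv_self hG hU, mk_incl, mk_incl, divOf_base_prod_X]
  abel

end Action

/-! ## Primes over a prime with a finite fibre -/

section Fibre

open IsLocalRing Module PrimeSpectrum

variable {S R : Type*} [CommRing S] [CommRing R] [Algebra S R] (p : Ideal S) [p.IsPrime]

/-- The fundamental identity for the primes over `p`, if the fibre over `p` is finite. -/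
theorem sum_ramificationIdx_mul_inertiaDeg [Module.Finite p.ResidueField (p.Fiber R)]
    [Fintype (p.primesOver R)] :
    ∑ q : p.primesOver R, q.1.ramificationIdx S * q.1.inertiaDeg S =
      finrank p.ResidueField (p.Fiber R) := by
  have : IsArtinianRing (p.Fiber R) := isArtinian_of_tower p.ResidueField inferInstance
  let := Fintype.ofFinite (PrimeSpectrum (p.Fiber R))
  rw [IsArtinianRing.finrank_eq_sum_primeSpectrum, ← (primesOverOrderIsoFiber S R p).symm.sum_comp]
  apply Finset.sum_congr rfl
  intro q _
  simp_rw [OrderIso.toEquiv_symm, OrderIso.coe_symm_toEquiv,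
    coe_primesOverOrderIsoFiber_symm_apply]
  set r := q.1.comap Algebra.TensorProduct.includeRight
  let := Localization.AtPrime.algebraOfLiesOver p r
  rw [Ideal.ramificationIdx_eq p r, Ideal.inertiaDeg_eq p r]
  let Rp := Localization.AtPrime p
  let Sq := Localization.AtPrime q.1
  let Sr := Localization.AtPrime r
  let κp := p.ResidueField
  let κr := r.ResidueField
  let A := Sr ⧸ p.map (algebraMap S Sr)
  have : Algebra.QuasiFinite κp (p.Fiber R) := inferInstance
  have : Algebra.QuasiFinite κp Sq := inferInstance
  have := Module.Finite.of_quasiFinite (R := κp) (S := Sq)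
  -- The local ring of the fibre is `A`; its length over the residue field of `p` is its own length,
  -- the ramification index, times the residue degree.
  have hlen : length Sr A * length κp κr = length κp Sq := calc
    length Sr A * length κp κr = length Rp A := (length_restrictScalars Rp Sr A).symm
    _ = length Rp Sq := (Ideal.Fiber.localizationAlgEquivQuotient p q.1).toLinearEquiv.length_eq.symm
    _ = length κp Sq := length_eq_of_surjective residue_surjective
  have : Nontrivial A :=
    (Ideal.Fiber.localizationAlgEquivQuotient p q.1).toEquiv.symm.nontrivial
  -- An infinite residue degree must be excluded, since `finrank` would then be 0 by convention.
  have hfin : length κp κr ≠ ⊤ := fun h => by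
    rw [h, ENat.mul_top (length_pos (R := Sr) (M := A)).ne', length_eq_finrank] at hlen
    exact ENat.natCast_ne_top _ hlen.symm
  have : IsNoetherian κp κr :=
    (isFiniteLength_iff_isNoetherian_isArtinian.mp (length_ne_top_iff.mp hfin)).1
  rw [length_eq_finrank, length_eq_finrank] at hlen
  suffices length Sr A * finrank κp κr = finrank κp Sq by simpa using congr_arg ENat.toNat this
  exact hlen

theorem finite_primesOver_of_finite_fiber [Module.Finite p.ResidueField (p.Fiber R)] :
    (p.primesOver R).Finite := by
  have : IsArtinianRing (p.Fiber R) := isArtinian_of_tower p.ResidueField inferInstance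
  exact Set.finite_coe_iff.mp (Finite.of_equiv _ (primesOverOrderIsoFiber S R p).symm.toEquiv)

theorem eq_of_le_of_finite_fiber [Module.Finite p.ResidueField (p.Fiber R)] {P Q : Ideal R}
    (hP : P ∈ p.primesOver R) (hQ : Q ∈ p.primesOver R) (h : P ≤ Q) : P = Q := by
  have : IsArtinianRing (p.Fiber R) := isArtinian_of_tower p.ResidueField inferInstance
  set e := primesOverOrderIsoFiber S R p
  have h1 : e ⟨P, hP⟩ ≤ e ⟨Q, hQ⟩ := e.monotone h
  have h2 : e ⟨P, hP⟩ = e ⟨Q, hQ⟩ := PrimeSpectrum.ext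
    ((IsArtinianRing.isMaximal_of_isPrime (e ⟨P, hP⟩).asIdeal).eq_of_le
      (e ⟨Q, hQ⟩).isPrime.ne_top h1)
  exact congrArg Subtype.val (e.injective h2)

theorem span_fiber_eq_top (x : R)
    (hx : ∀ r : R, ∃ m ∉ p, ∃ a b : S,
      algebraMap S R m * r = algebraMap S R a + algebraMap S R b * x) :
    Submodule.span p.ResidueField (Set.range
      ![(1 : p.Fiber R), Algebra.TensorProduct.includeRight x]) = ⊤ := by
  set N := Submodule.span p.ResidueField (Set.range
      ![(1 : p.Fiber R), Algebra.TensorProduct.includeRight x])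
  have h1 : (1 : p.Fiber R) ∈ N := Submodule.subset_span ⟨0, rfl⟩
  have h2 : (Algebra.TensorProduct.includeRight x : p.Fiber R) ∈ N := Submodule.subset_span ⟨1, rfl⟩
  have hr : ∀ r : R, (Algebra.TensorProduct.includeRight r : p.Fiber R) ∈ N := by
    intro r
    obtain ⟨m, hm, a, b, h⟩ := hx r
    have hm0 : algebraMap S p.ResidueField m ≠ 0 := fun h0 =>
      hm (Ideal.algebraMap_residueField_eq_zero.mp h0)
    have hS : ∀ (s : S) (y : p.Fiber R),
        (Algebra.TensorProduct.includeRight (algebraMap S R s) : p.Fiber R) * y =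
          algebraMap S p.ResidueField s • y := by
      intro s y
      rw [AlgHom.commutes, ← Algebra.smul_def, algebraMap_smul]
    have h3 := congrArg (Algebra.TensorProduct.includeRight :
      R →ₐ[S] p.Fiber R) h
    rw [map_mul, map_add, map_mul, hS, hS, ← mul_one (Algebra.TensorProduct.includeRight
      (algebraMap S R a)), hS] at h3
    have h4 : (Algebra.TensorProduct.includeRight r : p.Fiber R) =
        (algebraMap S p.ResidueField m)⁻¹ • (algebraMap S p.ResidueField a • (1 : p.Fiber R) +
          algebraMap S p.ResidueField b • Algebra.TensorProduct.includeRight x) := by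
      rw [← h3, inv_smul_smul₀ hm0]
    rw [h4]
    exact N.smul_mem _ (N.add_mem (N.smul_mem _ h1) (N.smul_mem _ h2))
  rw [eq_top_iff]
  rintro z -
  induction z using TensorProduct.induction_on with
  | zero => exact N.zero_mem
  | add y z hy hz => exact N.add_mem hy hz
  | tmul a r =>
    have : a ⊗ₜ[S] r = a • (Algebra.TensorProduct.includeRight r : p.Fiber R) := by
      rw [Algebra.TensorProduct.includeRight_apply, TensorProduct.smul_tmul', smul_eq_mul, mul_one]
    rw [this]
    exact N.smul_mem _ (hr r)

theorem finite_fiber (x : R)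
    (hx : ∀ r : R, ∃ m ∉ p, ∃ a b : S,
      algebraMap S R m * r = algebraMap S R a + algebraMap S R b * x) :
    Module.Finite p.ResidueField (p.Fiber R) :=
  ⟨Submodule.fg_def.mpr ⟨_, Set.finite_range _, span_fiber_eq_top p x hx⟩⟩

/-- The classes of 1 and `x` span the fibre, which gives the upper bound. The homomorphism `χ`
induces a surjection onto `AdjoinRoot f`, of dimension two, which gives the lower one. -/
theorem finrank_fiber_eq_two (x : R)
    (hx : ∀ r : R, ∃ m ∉ p, ∃ a b : S,
      algebraMap S R m * r = algebraMap S R a + algebraMap S R b * x)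
    (f : Polynomial p.ResidueField) (hf : f.natDegree = 2) (χ : R →+* AdjoinRoot f)
    (hχ : ∀ s, χ (algebraMap S R s) = AdjoinRoot.of f (algebraMap S p.ResidueField s))
    (hχx : χ x = AdjoinRoot.root f) : finrank p.ResidueField (p.Fiber R) = 2 := by
  have := finite_fiber p x hx
  have hf0 : f ≠ 0 := by rintro rfl; simp at hf
  apply le_antisymm
  · have h := finrank_range_le_card (R := p.ResidueField)
      ![(1 : p.Fiber R), Algebra.TensorProduct.includeRight x]
    rw [Set.finrank, span_fiber_eq_top p x hx, finrank_top] at h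
    simpa using h
  · let χ' : R →ₐ[S] AdjoinRoot f := AlgHom.mk χ fun s => by
      change χ (algebraMap S R s) = _
      rw [hχ, IsScalarTower.algebraMap_apply S p.ResidueField (AdjoinRoot f)]
      rfl
    let ξ : p.Fiber R →ₐ[p.ResidueField] AdjoinRoot f :=
      Algebra.TensorProduct.lift (Algebra.ofId _ _) χ' fun _ _ => Commute.all _ _
    have hξ : Function.Surjective ξ := by
      rw [← AlgHom.range_eq_top, eq_top_iff, ← AdjoinRoot.adjoinRoot_eq_top]
      refine Algebra.adjoin_le ?_
      rintro _ rfl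
      exact ⟨Algebra.TensorProduct.includeRight x, by
        rw [← hχx]; simp [ξ, χ']⟩
    have h := LinearMap.finrank_le_finrank_of_surjective (f := ξ.toLinearMap) hξ
    rwa [(AdjoinRoot.powerBasis hf0).finrank, AdjoinRoot.powerBasis_dim, hf] at h

end Fibre

/-! ## Quadratic field extensions -/

section QuadraticField

open IntermediateField Polynomial

theorem finrank_adjoin_of_quadratic {k E : Type*} [Field k] [Field E] [Algebra k E] {θ : E}
    {a b c : k} (ha : a ≠ 0)
    (h : algebraMap k E a * θ ^ 2 + algebraMap k E b * θ + algebraMap k E c = 0)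
    [Decidable (θ ∈ (algebraMap k E).range)] :
    Module.finrank k k⟮θ⟯ = if θ ∈ (algebraMap k E).range then 1 else 2 := by
  set f : k[X] := Polynomial.C a * Polynomial.X ^ 2 + Polynomial.C b * Polynomial.X + Polynomial.C c
  have hdeg : f.natDegree = 2 := natDegree_quadratic ha
  have hf0 : f ≠ 0 := by intro h0; rw [h0] at hdeg; simp at hdeg
  have hroot : aeval θ f = 0 := by simpa [f] using h
  have hint : IsIntegral k θ := (show IsAlgebraic k θ from ⟨f, hf0, hroot⟩).isIntegral
  have hmem : θ ∈ (algebraMap k E).range ↔ Module.finrank k k⟮θ⟯ = 1 := by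
    rw [IntermediateField.finrank_adjoin_simple_eq_one_iff, IntermediateField.mem_bot]; rfl
  have hle : Module.finrank k k⟮θ⟯ ≤ 2 := by
    rw [adjoin.finrank hint, ← hdeg]
    exact natDegree_le_natDegree (minpoly.degree_le_of_ne_zero k θ hf0 hroot)
  have hpos : 0 < Module.finrank k k⟮θ⟯ := by
    rw [adjoin.finrank hint]; exact minpoly.natDegree_pos hint
  split_ifs with hθ
  · exact hmem.mp hθ
  · have := fun h1 => hθ (hmem.mpr h1)
    refine le_antisymm hle ?_
    exact Nat.lt_of_le_of_ne hpos (Ne.symm this)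

/-- The degree of an extension of subfields generated by a root of a quadratic equation. -/
theorem relfinrank_of_quadratic {E : Type*} [Field E] {k F : Subfield E} {θ : E} (hkF : k ≤ F)
    (hF : ∀ F' : Subfield E, k ≤ F' → θ ∈ F' → F ≤ F') (hθF : θ ∈ F) {a b c : E} (ha0 : a ≠ 0)
    (ha : a ∈ k) (hb : b ∈ k) (hc : c ∈ k) (h : a * θ ^ 2 + b * θ + c = 0) [Decidable (θ ∈ k)] :
    Subfield.relfinrank k F = if θ ∈ k then 1 else 2 := by
  classical
  have e : Subfield.extendScalars hkF = k⟮θ⟯ := by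
    apply le_antisymm
    · intro y hy
      exact hF k⟮θ⟯.toSubfield (fun z hz => k⟮θ⟯.algebraMap_mem ⟨z, hz⟩)
        (mem_adjoin_simple_self k θ) hy
    · rw [adjoin_simple_le_iff]
      exact hθF
  rw [Subfield.relfinrank_eq_finrank_of_le hkF, e,
    finrank_adjoin_of_quadratic (a := (⟨a, ha⟩ : k)) (b := ⟨b, hb⟩) (c := ⟨c, hc⟩)
      (fun h0 => ha0 (congrArg Subtype.val h0)) h]
  refine if_congr ⟨?_, fun h => ⟨⟨θ, h⟩, rfl⟩⟩ rfl rfl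
  rintro ⟨y, rfl⟩
  exact y.2

end QuadraticField

/-! ## The polynomial subring generated by the base and a linear form in the fibre -/

section PolyBase

variable {K : Type u} [Field K] {i : Fin 3}

variable (i) in
/-- The linear form with constant coefficients `c` in the coordinates of the factor `i`. -/
def linForm (c : Fin 3 → K) : MvPolynomial (Fin 3 × Fin 3) K :=
  lin (fun k => C (c k)) (fun k => X (i, k))

theorem isForm_linForm (c : Fin 3 → K) : IsForm (linForm i c) (Pi.single i 1) :=
  (((isForm_X i 0).C_mul _).add ((isForm_X i 1).C_mul _)).add ((isForm_X i 2).C_mul _)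

theorem isForm_linForm_pow (c : Fin 3 → K) (n : ℕ) :
    IsForm (linForm i c ^ n) (Pi.single i n) := by
  have h := (isForm_linForm (i := i) c).pow n
  rwa [← Pi.single_smul, smul_eq_mul, mul_one] at h

theorem extDeg_add_single_injective {d e : {t : Fin 3 // t ≠ i} → ℕ} {m n : ℕ}
    (h : extDeg i d + Pi.single i m = extDeg i e + Pi.single i n) : d = e ∧ m = n := by
  constructor
  · ext t
    have := congrFun h t
    simpa [extDeg, t.2] using this
  · have := congrFun h i
    simpa [extDeg] using this

theorem component_eq_zero_of_form {ι : Type} [Fintype ι] [DecidableEq ι]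
    {f : MvPolynomial (ι × Fin 3) K} {d e : ι → ℕ} (hf : IsForm f e) (h : e ≠ d) :
    weightedHomogeneousComponent (multideg ι) d f = 0 :=
  IsWeightedHomogeneous.weightedHomogeneousComponent_ne d hf h.symm

variable (i) in
/-- The polynomial with coefficients in the base evaluated at a linear form in the factor `i`. -/
def polyIncl (c : Fin 3 → K) : Polynomial (BasePoly K i) →+* MvPolynomial (Fin 3 × Fin 3) K :=
  Polynomial.eval₂RingHom (incl i) (linForm i c)

/-- The degree in the variable of the polynomial ring becomes the degree in the factor `i`, so
homogeneous components separate the coefficients. -/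
theorem component_polyIncl (c : Fin 3 → K) (f : Polynomial (BasePoly K i))
    (d : {t : Fin 3 // t ≠ i} → ℕ) (m : ℕ) :
    weightedHomogeneousComponent (multideg (Fin 3)) (extDeg i d + Pi.single i m) (polyIncl i c f) =
      incl i (weightedHomogeneousComponent (multideg _) d (f.coeff m)) * linForm i c ^ m := by
  induction f using Polynomial.induction_on' with
  | add p q hp hq =>
    rw [map_add, map_add, hp, hq, Polynomial.coeff_add, map_add, map_add, add_mul]
  | monomial n b =>
    rw [polyIncl, Polynomial.coe_eval₂RingHom, Polynomial.eval₂_monomial]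
    by_cases hmn : n = m
    · subst hmn
      rw [component_mul_form _ _ _ _ (isForm_linForm_pow c n), component_incl,
        Polynomial.coeff_monomial_same]
    · rw [Polynomial.coeff_monomial_of_ne _ (Ne.symm hmn), map_zero, map_zero, zero_mul]
      induction b using induction_on_forms {t : Fin 3 // t ≠ i} with
      | form b e hb =>
        have h1 : IsForm (incl i b * linForm i c ^ n) (extDeg i e + Pi.single i n) :=
          IsWeightedHomogeneous.mul hb.incl (isForm_linForm_pow c n)
        exact component_eq_zero_of_form h1 fun h => hmn (extDeg_add_single_injective h).2
      | add a b ha hb => rw [map_add, add_mul, map_add, ha, hb, add_zero]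

variable {A : (Fin 3 → Fin 3) → K} {B : (Fin 3 → Fin 3) → (Fin 3 → Fin 3) → K}

variable (A B) in
variable (i) in
/-- The polynomials with coefficients in the base in a linear form in the factor `i`, on `X`. -/
def polyBase (c : Fin 3 → K) : Polynomial (BasePoly K i) →+* CoordRing A B :=
  Polynomial.eval₂RingHom (base A B i) (fibV A B i c)

@[simp] theorem polyBase_C (c : Fin 3 → K) (s : BasePoly K i) :
    polyBase i A B c (Polynomial.C s) = base A B i s := by
  simp [polyBase]

@[simp] theorem polyBase_X (c : Fin 3 → K) : polyBase i A B c Polynomial.X = fibV A B i c := by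
  simp [polyBase]

theorem mk_linForm (c : Fin 3 → K) :
    Ideal.Quotient.mk (idealX A B) (linForm i c) = fibV A B i c := by
  rw [linForm, map_lin, fibV]
  congr 1
  ext k
  rw [← mk_incl, incl_C]

theorem mk_polyIncl (c : Fin 3 → K) (f : Polynomial (BasePoly K i)) :
    Ideal.Quotient.mk (idealX A B) (polyIncl i c f) = polyBase i A B c f := by
  have : (Ideal.Quotient.mk (idealX A B)).comp (polyIncl i c) = polyBase i A B c := by
    refine Polynomial.ringHom_ext (fun s => ?_) ?_
    · simp [polyIncl, mk_incl]
    · simp [polyIncl, mk_linForm]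
  exact RingHom.congr_fun this f

variable {c : Fin 3 → K} {k : Fin 3} (P : PrimeDivisor (idealX A B))

theorem base_mem_iff (s : BasePoly K i) : base A B i s ∈ P.ideal ↔
    ∀ d, base A B i (weightedHomogeneousComponent (multideg _) d s) ∈ P.ideal := by
  constructor
  · intro h d
    rw [← mk_incl, ← component_incl]
    exact P.homogeneous _ h _
  · exact fun h => mem_of_component_mem (I := P.ideal.comap (base A B i)) h

/-- By homogeneity, powers of `fibV` cannot cancel against each other modulo P: it behaves as a free
variable over the image of P in the base. -/
theorem polyBase_mem_iff (hv : fibV A B i c ∉ P.ideal) (f : Polynomial (BasePoly K i)) :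
    polyBase i A B c f ∈ P.ideal ↔ ∀ n, base A B i (f.coeff n) ∈ P.ideal := by
  constructor
  · intro h n
    rw [base_mem_iff]
    intro d
    have h1 := P.homogeneous (polyIncl i c f) (by rwa [mk_polyIncl]) (extDeg i d + Pi.single i n)
    rw [component_polyIncl, map_mul, map_pow, mk_linForm, mk_incl] at h1
    exact (P.isPrime.mem_or_mem h1).resolve_right fun h2 => hv (P.isPrime.mem_of_pow_mem _ h2)
  · intro h
    rw [polyBase, Polynomial.coe_eval₂RingHom, Polynomial.eval₂_eq_sum_range]
    exact Ideal.sum_mem _ fun n _ => P.ideal.mul_mem_right _ (h n)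

/-- The point of the fibre of the projection `i` given by the generic point of `P` is rational over
the function field of the image. -/
def RatPt (c : Fin 3 → K) (k : Fin 3) (P : PrimeDivisor (idealX A B)) : Prop :=
  ∃ (d : {t : Fin 3 // t ≠ i} → ℕ) (α β : BasePoly K i), IsForm α d ∧ IsForm β d ∧
    base A B i β ∉ P.ideal ∧ base A B i β * fibX A B i k - base A B i α * fibV A B i c ∈ P.ideal

/-- Since P is multihomogeneous, one component of the relation, chosen with nonzero denominator,
already expresses the coordinate as a ratio of forms of the base times `fibV`. Enlarging the base by
the variable `fibV` thus does not create rationality. -/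
theorem ratPt_of_polyBase (hv : fibV A B i c ∉ P.ideal) {a b : Polynomial (BasePoly K i)}
    (hb : polyBase i A B c b ∉ P.ideal)
    (h : polyBase i A B c b * fibX A B i k - polyBase i A B c a ∈ P.ideal) :
    RatPt (i := i) c k P := by
  rw [polyBase_mem_iff P hv] at hb
  push Not at hb
  obtain ⟨n, hn⟩ := hb
  rw [base_mem_iff] at hn
  push Not at hn
  obtain ⟨d, hd⟩ := hn
  -- The shift to `n + 1` matches the degree one of the fibre coordinate that multiplies `b`.
  refine ⟨d, weightedHomogeneousComponent (multideg _) d (a.coeff (n + 1)),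
    weightedHomogeneousComponent (multideg _) d (b.coeff n), isForm_component _ _,
    isForm_component _ _, hd, ?_⟩
  have h1 := P.homogeneous (polyIncl i c b * X (i, k) - polyIncl i c a)
    (by rwa [map_sub, map_mul, mk_polyIncl, mk_polyIncl, mk_X])
    (extDeg i d + Pi.single i (n + 1))
  have e : extDeg i d + Pi.single i (n + 1) = extDeg i d + Pi.single i n + Pi.single i 1 := by
    rw [add_assoc, ← Pi.single_add]
  rw [map_sub, component_polyIncl, e, component_mul_form _ _ _ _ (isForm_X i k),
    component_polyIncl, map_sub, map_mul, map_mul, map_mul, map_pow, map_pow, mk_linForm, mk_incl,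
    mk_incl, mk_X] at h1
  have h2 : fibV A B i c ^ n * (base A B i (weightedHomogeneousComponent (multideg _) d
      (b.coeff n)) * fibX A B i k - base A B i (weightedHomogeneousComponent (multideg _) d
      (a.coeff (n + 1))) * fibV A B i c) ∈ P.ideal := by
    convert h1 using 1
    ring
  exact (P.isPrime.mem_or_mem h2).resolve_left fun h2 => hv (P.isPrime.mem_of_pow_mem _ h2)

theorem ratPt_of_ratPt_conjDiv [hJ : (idealX A B).IsPrime]
    (hD : base A B i (discForm A B i c) ∉ P.ideal) (h : RatPt (i := i) c k (conjDiv P hD)) :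
    RatPt (i := i) c k P := by
  obtain ⟨d, α, β, hα, hβ, hβP, h⟩ := h
  rw [base_mem_conjDiv] at hβP
  rw [mem_conjDiv, map_sub, map_mul, map_mul, conj_base, conj_base, conj_fibX, conj_fibV,
    conjX_eq] at h
  have hd : d + (fun _ => 4) = (fun _ => 4) + d := add_comm _ _
  -- The two roots have a sum in the field of the base. The witnesses come from substituting
  -- `conjX_eq` and `conj_fibV` into the relation for the conjugate.
  refine ⟨d + (fun _ => 4), -(β * midForm A B i c k + α * discForm A B i c),
    β * discForm A B i c, ?_, hβ.mul (isForm_discForm A B i c), ?_, ?_⟩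
  · exact ((hβ.mul (isForm_midForm A B i c k)).add (hα.mul (isForm_discForm A B i c))).neg
  · rw [map_mul]
    exact fun h => (P.isPrime.mem_or_mem h).elim hβP hD
  · convert h using 1
    simp only [map_mul, map_neg, map_add]
    ring

theorem ratPt_conjDiv_iff [hJ : (idealX A B).IsPrime]
    (hD : base A B i (discForm A B i c) ∉ P.ideal) :
    RatPt (i := i) c k (conjDiv P hD) ↔ RatPt (i := i) c k P := by
  refine ⟨ratPt_of_ratPt_conjDiv P hD, fun h => ?_⟩
  have hD' : base A B i (discForm A B i c) ∉ (conjDiv P hD).ideal := by rwa [base_mem_conjDiv]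
  refine ratPt_of_ratPt_conjDiv _ hD' ?_
  rwa [conjDiv_conjDiv]

end PolyBase

/-! ## Residue degrees -/

section ResidueDegree

open IntermediateField

/-- The residue degree of a prime whose residue field is generated by a root of a quadratic
equation. -/
theorem inertiaDeg_of_quadratic {S R : Type*} [CommRing S] [CommRing R] [Algebra S R] (p : Ideal S)
    [p.IsPrime] (P : Ideal R) [P.IsPrime] [P.LiesOver p] (x : R)
    (hx : ∀ r : R, ∃ m ∉ p, ∃ a b : S,
      algebraMap S R m * r = algebraMap S R a + algebraMap S R b * x) {a b c : S} (ha : a ∉ p)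
    (h : algebraMap S R a * x ^ 2 + algebraMap S R b * x + algebraMap S R c = 0)
    [Decidable (∃ a b : S, b ∉ p ∧ algebraMap S R b * x - algebraMap S R a ∈ P)] :
    P.inertiaDeg S =
      if ∃ a b : S, b ∉ p ∧ algebraMap S R b * x - algebraMap S R a ∈ P then 1 else 2 := by
  classical
  let := Localization.AtPrime.algebraOfLiesOver p P
  rw [Ideal.inertiaDeg_eq p P]
  set θ := algebraMap R P.ResidueField x with hθ
  have hne : ∀ s ∉ p, algebraMap S p.ResidueField s ≠ 0 := fun s hs h0 =>
    hs (Ideal.algebraMap_residueField_eq_zero.mp h0)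
  have hS : ∀ s : S, algebraMap R P.ResidueField (algebraMap S R s) =
      algebraMap p.ResidueField P.ResidueField (algebraMap S p.ResidueField s) := fun s => by
    rw [← IsScalarTower.algebraMap_apply, ← IsScalarTower.algebraMap_apply]
  have hne' : ∀ s ∉ p, algebraMap R P.ResidueField (algebraMap S R s) ≠ 0 := fun s hs => by
    rw [hS]; exact (map_ne_zero _).mpr (hne s hs)
  have htop : (p.ResidueField)⟮θ⟯ = ⊤ := by
    rw [eq_top_iff]
    rintro y -
    have hr : ∀ r : R, algebraMap R P.ResidueField r ∈ (p.ResidueField)⟮θ⟯ := by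
      intro r
      obtain ⟨m, hm, a', b', e⟩ := hx r
      have e' := congrArg (algebraMap R P.ResidueField) e
      rw [map_mul, map_add, map_mul] at e'
      rw [eq_div_of_mul_eq (hne' m hm) ((mul_comm _ _).trans e'), hS, hS, hS]
      exact div_mem (add_mem (_root_.algebraMap_mem _ _)
        (mul_mem (_root_.algebraMap_mem _ _) (mem_adjoin_simple_self _ _))) (_root_.algebraMap_mem _ _)
    obtain ⟨r, s, -, rfl⟩ := IsFractionRing.div_surjective (A := R ⧸ P) y
    obtain ⟨r, rfl⟩ := Ideal.Quotient.mk_surjective r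
    obtain ⟨s, rfl⟩ := Ideal.Quotient.mk_surjective s
    exact div_mem (hr r) (hr s)
  have h1 := finrank_adjoin_of_quadratic (k := p.ResidueField) (θ := θ) (hne a ha)
    (b := algebraMap S p.ResidueField b) (c := algebraMap S p.ResidueField c) (by
      have := congrArg (algebraMap R P.ResidueField) h
      simpa only [map_add, map_mul, map_pow, map_zero, hS] using this)
  rw [htop, finrank_top'] at h1
  rw [h1]
  refine if_congr ⟨?_, ?_⟩ rfl rfl
  · rintro ⟨y, hy⟩
    obtain ⟨r, s, hs, rfl⟩ := IsFractionRing.div_surjective (A := S ⧸ p) y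
    obtain ⟨r, rfl⟩ := Ideal.Quotient.mk_surjective r
    obtain ⟨s, rfl⟩ := Ideal.Quotient.mk_surjective s
    have hsp : s ∉ p := fun h0 =>
      nonZeroDivisors.ne_zero hs (Ideal.Quotient.eq_zero_iff_mem.mpr h0)
    refine ⟨r, s, hsp, ?_⟩
    rw [← Ideal.algebraMap_residueField_eq_zero, map_sub, map_mul, sub_eq_zero, ← hθ, ← hy, hS, hS,
      ← map_mul]
    congr 1
    exact mul_div_cancel₀ _ (hne s hsp)
  · rintro ⟨a', b', hb', h'⟩
    rw [← Ideal.algebraMap_residueField_eq_zero, map_sub, map_mul, sub_eq_zero, ← hθ, hS, hS] at h'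
    refine ⟨algebraMap S p.ResidueField a' / algebraMap S p.ResidueField b', ?_⟩
    rw [map_div₀, div_eq_iff ((map_ne_zero _).mpr (hne b' hb')), mul_comm, h']

variable {K : Type u} [Field K] {i : Fin 3}
variable {A : (Fin 3 → Fin 3) → K} {B : (Fin 3 → Fin 3) → (Fin 3 → Fin 3) → K}
  {c : Fin 3 → K} {k : Fin 3} (P : PrimeDivisor (idealX A B))

theorem evalGen_eq_zero (f : MvPolynomial (Fin 3 × Fin 3) K) :
    evalGen P f = 0 ↔ Ideal.Quotient.mk _ f ∈ P.ideal :=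
  algebraMap_coordField_eq_zero P _

theorem evalGen_incl (s : BasePoly K i) : evalGen P (incl i s) = evalBase i P s := rfl

theorem evalBase_eq_zero (s : BasePoly K i) : evalBase i P s = 0 ↔ base A B i s ∈ P.ideal :=
  algebraMap_coordField_eq_zero P _

theorem div_mem_ratioField_incl {f g : BasePoly K i} {d : {t : Fin 3 // t ≠ i} → ℕ}
    (hf : IsForm f d) (hg : IsForm g d) :
    evalBase i P f / evalBase i P g ∈ ratioField P (incl i) :=
  Subfield.subset_closure ⟨d, f, g, hf, hg, rfl⟩

theorem ratioField_incl_le : ratioField P (incl i) ≤ ratioField P (RingHom.id _) :=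
  Subfield.closure_mono fun _ ⟨d, f, g, hf, hg, hu⟩ =>
    ⟨extDeg i d, incl i f, incl i g, hf.incl, hg.incl, hu⟩

/-- The function field of `P` is generated by that of its image and one ratio of coordinates. -/
theorem ratioField_id_le (hv : fibV A B i c ∉ P.ideal)
    (hs : base A B i (lineVec A i c k) ∉ P.ideal) {F' : Subfield (CoordField P)}
    (hF' : ratioField P (incl i) ≤ F')
    (hθ : evalGen P (X (i, k)) / evalGen P (linForm i c) ∈ F') :
    ratioField P (RingHom.id _) ≤ F' := by
  have hv0 : evalGen P (linForm i c) ≠ 0 := by rwa [Ne, evalGen_eq_zero, mk_linForm]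
  have hs0 : evalBase i P (lineVec A i c k) ≠ 0 := by rwa [Ne, evalBase_eq_zero]
  choose j hj using P.relevant
  -- One nonvanishing normalising coordinate per factor, so that quotients of forms of equal
  -- multidegree can be computed in the normalised coordinates.
  set N : Fin 3 → CoordField P := fun t =>
    if t = i then evalGen P (linForm i c) else evalGen P (X (t, j t)) with hN
  have hN0 : ∀ t, N t ≠ 0 := by
    intro t
    simp only [hN]
    split_ifs
    · exact hv0
    · rw [Ne, evalGen_eq_zero]; exact hj t
  set ev : MvPolynomial (Fin 3 × Fin 3) K →+* CoordField P :=
    eval₂Hom ((evalGen P).comp C) (fun v => evalGen P (X v) / N v.1)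
  have hX : ∀ v, evalGen P (X v) / N v.1 ∈ F' := by
    rintro ⟨t, n⟩
    by_cases ht : t = i
    · subst ht
      have h := congrArg (algebraMap (CoordRing A B) (CoordField P))
        (lineVec_mul_fibX A B t c k n)
      have h' : evalBase t P (lineVec A t c k) * evalGen P (X (t, n)) =
          evalGen P (X (t, k)) * evalBase t P (lineVec A t c n) +
          evalGen P (linForm t c) * evalBase t P (cross (coeffL A t) (Pi.single k 1) n) := by
        rw [map_mul, map_add, map_mul, map_mul, ← mk_linForm] at h
        exact h
      have e : evalGen P (X (t, n)) / N t =
          evalGen P (X (t, k)) / evalGen P (linForm t c) *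
            (evalBase t P (lineVec A t c n) / evalBase t P (lineVec A t c k)) +
          evalBase t P (cross (coeffL A t) (Pi.single k 1) n) /
            evalBase t P (lineVec A t c k) := by
        simp only [hN, if_true]
        field_simp
        linear_combination h'
      rw [e]
      have hcr : IsForm (cross (coeffL A t) (Pi.single k 1) n) (fun _ => 1) := by
        have := isForm_cross (isForm_coeffL A t) (isForm_single (K := K) k) n
        rwa [add_zero] at this
      exact F'.add_mem (F'.mul_mem hθ (hF' (div_mem_ratioField_incl P (isForm_lineVec A t c n)
        (isForm_lineVec A t c k)))) (hF' (div_mem_ratioField_incl P hcr (isForm_lineVec A t c k)))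
    · simp only [hN, if_neg ht]
      have := div_mem_ratioField_incl (i := i) P 
        (isForm_X (K := K) (⟨t, ht⟩ : {t : Fin 3 // t ≠ i}) n) (isForm_X _ (j t))
      rw [← evalGen_incl, ← evalGen_incl, incl_X, incl_X] at this
      exact hF' this
  have hev : ∀ f, ev f ∈ F' := by
    intro f
    induction f using MvPolynomial.induction_on with
    | C a =>
      have := div_mem_ratioField_incl (i := i) P (isForm_C a) (isForm_C 1)
      rw [← evalGen_incl, ← evalGen_incl, incl_C, incl_C, C_1, map_one, div_one] at this
      simpa [ev] using hF' this
    | add p q hp hq => rw [map_add]; exact F'.add_mem hp hq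
    | mul_X p v hp =>
      rw [map_mul]
      exact F'.mul_mem hp (by simpa [ev] using hX v)
  refine Subfield.closure_le.mpr ?_
  rintro _ ⟨d, f, g, hf, hg, rfl⟩
  have hscale : ∀ {f}, IsForm f d → evalGen P f = (∏ t, N t ^ d t) * ev f := fun hf =>
    map_form_scale (evalGen P) ev N (fun a => by simp [ev])
      (fun v => by simp only [ev, coe_eval₂Hom, eval₂_X]; rw [mul_div_cancel₀ _ (hN0 _)]) hf
  have hprod : (∏ t, N t ^ d t) ≠ 0 := Finset.prod_ne_zero_iff.mpr fun t _ => pow_ne_zero _ (hN0 t)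
  rw [RingHom.id_apply, RingHom.id_apply, hscale hf, hscale hg, mul_div_mul_left _ _ hprod]
  exact F'.div_mem (hev f) (hev g)

/-- A ratio in the field of the base is embedded in the field of fractions of polynomials in `fibV`;
elements of that field are quotients of two such polynomials, to which `ratPt_of_polyBase` applies.
-/
theorem mem_ratioField_iff_ratPt (hv : fibV A B i c ∉ P.ideal) :
    evalGen P (X (i, k)) / evalGen P (linForm i c) ∈ ratioField P (incl i) ↔
      RatPt (i := i) c k P := by
  have hv0 : evalGen P (linForm i c) ≠ 0 := by rwa [Ne, evalGen_eq_zero, mk_linForm]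
  constructor
  · intro h
    set ψ : Polynomial (BasePoly K i) →+* CoordField P :=
      (algebraMap (CoordRing A B) (CoordField P)).comp (polyBase i A B c) with hψ
    have hk1 : ratioField P (incl i) ≤ Subfield.closure (ψ.range : Set (CoordField P)) := by
      refine Subfield.closure_le.mpr ?_
      have hb : ∀ s : BasePoly K i, evalGen P (incl i s) ∈ (ψ.range : Set (CoordField P)) :=
        fun s => ⟨Polynomial.C s, by rw [hψ, RingHom.comp_apply, polyBase_C]; rfl⟩
      rintro _ ⟨d, f, g, -, -, rfl⟩
      exact div_mem (Subfield.subset_closure (hb f)) (Subfield.subset_closure (hb g))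
    have hvm : evalGen P (linForm i c) ∈ Subfield.closure (ψ.range : Set (CoordField P)) :=
      Subfield.subset_closure ⟨Polynomial.X, by
        rw [hψ, RingHom.comp_apply, polyBase_X, ← mk_linForm]; rfl⟩
    have h1 := mul_mem (hk1 h) hvm
    rw [div_mul_cancel₀ _ hv0, Subfield.mem_closure_iff, Subring.closure_eq] at h1
    obtain ⟨_, ⟨a, rfl⟩, _, ⟨b, rfl⟩, e⟩ := h1
    -- Here the formal quotient has denominator 0 and so is 0 by convention; the coordinate then
    -- vanishes and is trivially rational.
    by_cases hb : polyBase i A B c b ∈ P.ideal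
    · refine ratPt_of_polyBase P hv (a := 0) (b := 1) ?_ ?_
      · rw [map_one]
        exact fun h => P.isPrime.ne_top ((Ideal.eq_top_iff_one _).mpr h)
      · rw [map_one, map_zero, sub_zero, one_mul, ← mk_X, ← evalGen_eq_zero, ← e]
        have : ψ b = 0 := (algebraMap_coordField_eq_zero P _).mpr hb
        rw [this, div_zero]
    · refine ratPt_of_polyBase P hv (a := a) hb ?_
      have hb0 : ψ b ≠ 0 := fun h => hb ((algebraMap_coordField_eq_zero P _).mp h)
      rw [← algebraMap_coordField_eq_zero, map_sub, map_mul, sub_eq_zero, mul_comm]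
      exact ((div_eq_iff hb0).mp e).symm
  · rintro ⟨d, α, β, hα, hβ, hβP, h⟩
    have hβ0 : evalBase i P β ≠ 0 := by rwa [Ne, evalBase_eq_zero]
    rw [← algebraMap_coordField_eq_zero, map_sub, map_mul, map_mul, sub_eq_zero, ← mk_linForm] at h
    have e : evalGen P (X (i, k)) / evalGen P (linForm i c) =
        evalBase i P α / evalBase i P β := by
      rw [div_eq_div_iff hv0 hβ0, mul_comm]
      exact h
    rw [e]
    exact div_mem_ratioField_incl P hα hβ

open Classical in
/-- The degree of the function field of `P` over that of its image. -/
theorem relfinrank_ratioField (hD : base A B i (discForm A B i c) ∉ P.ideal)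
    (hs : base A B i (lineVec A i c k) ∉ P.ideal) :
    Subfield.relfinrank (ratioField P (incl i)) (ratioField P (RingHom.id _)) =
      if RatPt (i := i) c k P then 1 else 2 := by
  have hv := fibV_notMem P hD
  have hv0 : evalGen P (linForm i c) ≠ 0 := by rwa [Ne, evalGen_eq_zero, mk_linForm]
  have hD0 : evalBase i P (discForm A B i c) ≠ 0 := by rwa [Ne, evalBase_eq_zero]
  rw [relfinrank_of_quadratic (θ := evalGen P (X (i, k)) / evalGen P (linForm i c))
    (ratioField_incl_le P) (fun F' h1 h2 => ratioField_id_le P hv hs h1 h2)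
    (Subfield.subset_closure ⟨_, _, _, isForm_X i k, isForm_linForm c, rfl⟩) one_ne_zero
    (Subfield.one_mem _)
    (div_mem_ratioField_incl P (isForm_midForm A B i c k) (isForm_discForm A B i c))
    (div_mem_ratioField_incl P (isForm_formG A B i k) (isForm_discForm A B i c))]
  · exact if_congr (mem_ratioField_iff_ratPt P hv) rfl rfl
  · have h := congrArg (algebraMap (CoordRing A B) (CoordField P)) (quad_eq_fibX A B i c k)
    have h' : evalBase i P (discForm A B i c) * evalGen P (X (i, k)) ^ 2 +
        evalBase i P (midForm A B i c k) * evalGen P (linForm i c) * evalGen P (X (i, k)) +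
        evalBase i P (formG A B i k) * evalGen P (linForm i c) ^ 2 = 0 := by
      simp only [map_add, map_mul, map_pow, map_zero, ← mk_linForm] at h
      exact h
    field_simp
    linear_combination h'

end ResidueDegree

/-! ## The prime divisors over a prime divisor of the base -/

section PrimesOver

/-! ### Ramification, residue degrees and heights over a principal prime. -/

section Abstract

variable {S R : Type*} [CommRing S] [CommRing R] [Algebra S R] (p : Ideal S) [p.IsPrime]

theorem ramificationIdx_eq_ordLoc {g : S} (hp : p = Ideal.span {g}) (P : Ideal R) [P.IsPrime]
    [P.LiesOver p] : P.ramificationIdx S = ordLoc P (algebraMap S R g) := by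
  rw [Ideal.ramificationIdx_eq p P, hp, Ideal.map_span, Set.image_singleton,
    IsScalarTower.algebraMap_apply S R (Localization.AtPrime P)]
  rfl

open Classical in
theorem sum_ordLoc_primesOver {g : S} (hp : p = Ideal.span {g}) (x : R)
    (hx : ∀ r : R, ∃ m ∉ p, ∃ a b : S,
      algebraMap S R m * r = algebraMap S R a + algebraMap S R b * x) {a b c : S} (ha : a ∉ p)
    (h : algebraMap S R a * x ^ 2 + algebraMap S R b * x + algebraMap S R c = 0)
    (f : Polynomial p.ResidueField) (hf : f.natDegree = 2) (χ : R →+* AdjoinRoot f)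
    (hχ : ∀ s, χ (algebraMap S R s) = AdjoinRoot.of f (algebraMap S p.ResidueField s))
    (hχx : χ x = AdjoinRoot.root f) [Fintype (p.primesOver R)] :
    ∑ P : p.primesOver R, ordLoc P.1 (algebraMap S R g) *
      (if ∃ a b : S, b ∉ p ∧ algebraMap S R b * x - algebraMap S R a ∈ P.1 then 1 else 2) = 2 := by
  have := finite_fiber p x hx
  refine Eq.trans ?_ ((sum_ramificationIdx_mul_inertiaDeg p).trans
    (finrank_fiber_eq_two p x hx f hf χ hχ hχx))
  refine Finset.sum_congr rfl fun P _ => ?_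
  rw [ramificationIdx_eq_ordLoc p hp, inertiaDeg_of_quadratic p P.1 x hx ha h]

/-- A minimal prime of `(g)` below P also contracts to `p`, hence equals P as the fibre is finite;
Krull's theorem bounds its height. -/
theorem height_eq_one_of_mem_primesOver [IsDomain R] [IsNoetherianRing R]
    [Module.Finite p.ResidueField (p.Fiber R)] {g : S} (hp : p = Ideal.span {g})
    (hg : algebraMap S R g ≠ 0) {P : Ideal R} (hP : P ∈ p.primesOver R) : P.height = 1 := by
  have hPp := hP.1
  have hover : p = P.comap (algebraMap S R) := hP.2.over
  have hgP : algebraMap S R g ∈ P := by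
    have : g ∈ P.comap (algebraMap S R) := hover ▸ hp ▸ Ideal.mem_span_singleton_self g
    exact this
  apply le_antisymm
  · obtain ⟨P', hP', hle⟩ := Ideal.exists_minimalPrimes_le
      ((Ideal.span_singleton_le_iff_mem P).mpr hgP)
    have hP'p := hP'.1.1
    have hover' : p = P'.comap (algebraMap S R) := by
      apply le_antisymm
      · rw [hp, Ideal.span_singleton_le_iff_mem]
        exact hP'.1.2 (Ideal.mem_span_singleton_self _)
      · rw [hover]; exact Ideal.comap_mono hle
    have := eq_of_le_of_finite_fiber p (P := P') ⟨hP'p, ⟨hover'⟩⟩ hP hle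
    rw [← this]
    exact Ideal.height_le_one_of_isPrincipal_of_mem_minimalPrimes _ _ hP'
  · rw [Order.one_le_iff_ne_zero, Ne, Ideal.height_eq_zero_iff_eq_bot]
    rintro rfl
    exact hg ((Ideal.mem_bot).mp hgP)

end Abstract

variable {K : Type u} [Field K] {i : Fin 3}
variable {A : (Fin 3 → Fin 3) → K} {B : (Fin 3 → Fin 3) → (Fin 3 → Fin 3) → K}
  {c : Fin 3 → K} {k : Fin 3}

/-- A common zero of `lin l` and `quad q` is given by a root of a quadratic equation. -/
theorem lin_quad_of_root {S : Type*} [CommRing S] {l c : Fin 3 → S} {q : Fin 3 → Fin 3 → S}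
    {k : Fin 3} {θ V u : S} (hθ : disc l q c * θ ^ 2 + midCoeff l q c k * V * θ +
      gCoeff l q k * V ^ 2 = 0) :
    lin l (fun n => u * (θ * cross c l n + V * cross l (Pi.single k 1) n)) = 0 ∧
    quad q (fun n => u * (θ * cross c l n + V * cross l (Pi.single k 1) n)) = 0 ∧
    lin c (fun n => u * (θ * cross c l n + V * cross l (Pi.single k 1) n)) =
      u * cross c l k * V := by
  have hl : ∀ b : Fin 3 → S, lin b (fun n => θ * cross c l n + V * cross l (Pi.single k 1) n) =
      θ * lin b (cross c l) + V * lin b (cross l (Pi.single k 1)) := fun b => by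
    simp only [lin]; ring
  refine ⟨?_, ?_, ?_⟩
  · rw [lin_smul, hl, lin_cross, lin_cross']; ring
  · rw [quad_smul, quad_add, quad_smul, quad_smul, bil_smul_left, bil_smul_right,
      ← gCoeff_eq_quad]
    rw [disc, midCoeff] at hθ
    linear_combination u ^ 2 * hθ
  · rw [lin_smul, hl, lin_coord_cross, cross_coord]; ring

/-- A root `θ` of the quadratic equation determines the point `u (θ (c × l) + V (l × e_k))` of the
fibre, normalised by the inverse `u` of the `k`-th entry of `c × l`. It supplies the homomorphism to
`AdjoinRoot f` that detects rank two. -/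
theorem exists_fibrePoint {R' : Type*} [CommRing R'] (φ : BasePoly K i →+* R') {θ V u : R'}
    (hu : u * φ (lineVec A i c k) = 1)
    (hθ : φ (discForm A B i c) * θ ^ 2 + φ (midForm A B i c k) * V * θ +
      φ (formG A B i k) * V ^ 2 = 0) :
    ∃ χ : CoordRing A B →+* R', (∀ s, χ (base A B i s) = φ s) ∧ χ (fibX A B i k) = θ ∧
      χ (fibV A B i c) = V := by
  have hs : ∀ n, φ (lineVec A i c n) = cross (fun k => φ (C (c k))) (fun k => φ (coeffL A i k)) n :=
    fun n => map_cross _ _ _ _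
  rw [discForm, map_disc, midForm, map_midCoeff, formG_eq, map_gCoeff] at hθ
  obtain ⟨h1, h2, h3⟩ := lin_quad_of_root (u := u) hθ
  refine ⟨fibLift φ _ h1 h2, fun s => ?_, ?_, ?_⟩
  · rw [← mk_incl, fibLift_mk, evalFib_incl]
  · rw [← mk_X, fibLift_mk, evalFib_X, cross_single_self, ← hs]
    linear_combination θ * hu
  · rw [← mk_linForm, fibLift_mk, linForm, map_lin]
    simp only [evalFib_X, evalFib_C]
    rw [h3, ← hs, hu, one_mul]

variable {g : BasePoly K i}

theorem base_mem_of_comap {P : Ideal (CoordRing A B)}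
    (hP : P.comap (base A B i) = Ideal.span {g}) (s : BasePoly K i) : base A B i s ∈ P ↔ g ∣ s := by
  rw [← Ideal.mem_span_singleton, ← hP, Ideal.mem_comap]

/-- Up to a denominator, `X` is generated over the polynomials in a linear form in the fibre by one
coordinate. -/
theorem exists_polyBase_mul_eq (hg : Prime g) (hD : ¬ g ∣ discForm A B i c)
    (hs : ¬ g ∣ lineVec A i c k) (r : CoordRing A B) :
    ∃ m ∉ Ideal.span {(Polynomial.C g : Polynomial (BasePoly K i))},
      ∃ a b, polyBase i A B c m * r = polyBase i A B c a + polyBase i A B c b * fibX A B i k := by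
  have hpr : (Ideal.span {(Polynomial.C g : Polynomial (BasePoly K i))}).IsPrime :=
    (Ideal.span_singleton_prime (Polynomial.prime_C_iff.mpr hg).ne_zero).mpr
      (Polynomial.prime_C_iff.mpr hg)
  have hmem : ∀ {s : BasePoly K i}, ¬ g ∣ s →
      Polynomial.C s ∉ Ideal.span {(Polynomial.C g : Polynomial (BasePoly K i))} := fun hs h => by
    rw [Ideal.mem_span_singleton, Polynomial.C_dvd_iff_dvd_coeff] at h
    exact hs (by simpa using h 0)
  have h1 : (1 : Polynomial (BasePoly K i)) ∉ Ideal.span {(Polynomial.C g)} :=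
    fun h => hpr.ne_top ((Ideal.eq_top_iff_one _).mpr h)
  have hbase : ∀ s, ∃ m ∉ Ideal.span {(Polynomial.C g : Polynomial (BasePoly K i))},
      ∃ a b, polyBase i A B c m * base A B i s =
        polyBase i A B c a + polyBase i A B c b * fibX A B i k := fun s =>
    ⟨1, h1, Polynomial.C s, 0, by simp⟩
  obtain ⟨f, rfl⟩ := Ideal.Quotient.mk_surjective r
  induction f using MvPolynomial.induction_on with
  | C a => rw [← incl_C i, mk_incl]; exact hbase _
  | add p q hp hq =>
    obtain ⟨m, hm, a, b, e⟩ := hp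
    obtain ⟨m', hm', a', b', e'⟩ := hq
    refine ⟨m * m', fun h => (hpr.mem_or_mem h).elim hm hm', m' * a + m * a', m' * b + m * b', ?_⟩
    simp only [map_add, map_mul]
    linear_combination polyBase i A B c m' * e + polyBase i A B c m * e'
  | mul_X p v hp =>
    obtain ⟨m, hm, a, b, e⟩ := hp
    have hv : ∃ m ∉ Ideal.span {(Polynomial.C g : Polynomial (BasePoly K i))},
        ∃ a b, polyBase i A B c m * Ideal.Quotient.mk _ (X v) =
          polyBase i A B c a + polyBase i A B c b * fibX A B i k := by
      obtain ⟨t, n⟩ := v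
      by_cases ht : t = i
      · subst ht
        refine ⟨Polynomial.C (lineVec A t c k), hmem hs,
          Polynomial.X * Polynomial.C (cross (coeffL A t) (Pi.single k 1) n),
          Polynomial.C (lineVec A t c n), ?_⟩
        rw [mk_X]
        simp only [map_mul, polyBase_C, polyBase_X]
        linear_combination lineVec_mul_fibX A B t c k n
      · rw [mk_X_of_ne ht]; exact hbase _
    obtain ⟨m', hm', a', b', e'⟩ := hv
    -- The square of the fibre coordinate in the product is reduced by its quadratic equation, at
    -- the cost of the denominator `discForm`.
    have hq := quad_eq_fibX A B i c k
    refine ⟨Polynomial.C (discForm A B i c) * (m * m'),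
      fun h => (hpr.mem_or_mem h).elim (hmem hD) fun h => (hpr.mem_or_mem h).elim hm hm',
      Polynomial.C (discForm A B i c) * (a * a') -
        b * b' * (Polynomial.C (formG A B i k) * Polynomial.X ^ 2),
      Polynomial.C (discForm A B i c) * (a * b' + b * a') -
        b * b' * (Polynomial.C (midForm A B i c k) * Polynomial.X), ?_⟩
    simp only [map_mul, map_sub, map_add, map_pow, polyBase_C, polyBase_X]
    linear_combination (base A B i (discForm A B i c)) * (polyBase i A B c m' *
      Ideal.Quotient.mk _ (X v) * e + (polyBase i A B c a + polyBase i A B c b * fibX A B i k) * e')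
      + polyBase i A B c b * polyBase i A B c b' * hq

end PrimesOver

/-! ### The degree of X over the base along a prime divisor. -/

section PrimesOverBase

variable {K : Type u} [Field K] {i : Fin 3}
variable {A : (Fin 3 → Fin 3) → K} {B : (Fin 3 → Fin 3) → (Fin 3 → Fin 3) → K}
  {c : Fin 3 → K} {k : Fin 3} {g : BasePoly K i}

theorem C_mem_span_C (s : BasePoly K i) :
    Polynomial.C s ∈ Ideal.span {(Polynomial.C g : Polynomial (BasePoly K i))} ↔ g ∣ s := by
  rw [Ideal.mem_span_singleton, Polynomial.C_dvd_iff_dvd_coeff]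
  refine ⟨fun h => by simpa using h 0, fun h n => ?_⟩
  rw [Polynomial.coeff_C]
  split_ifs
  · exact h
  · exact dvd_zero g

theorem isPrime_span_C (hg : Prime g) :
    (Ideal.span {(Polynomial.C g : Polynomial (BasePoly K i))}).IsPrime :=
  (Ideal.span_singleton_prime (Polynomial.prime_C_iff.mpr hg).ne_zero).mpr
    (Polynomial.prime_C_iff.mpr hg)

theorem comap_polyBase (P : PrimeDivisor (idealX A B))
    (hP : P.ideal.comap (base A B i) = Ideal.span {g}) (hD : ¬ g ∣ discForm A B i c) :
    P.ideal.comap (polyBase i A B c) = Ideal.span {Polynomial.C g} := by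
  ext f
  rw [Ideal.mem_comap, polyBase_mem_iff P (fibV_notMem P (by rwa [base_mem_of_comap hP])),
    Ideal.mem_span_singleton, Polynomial.C_dvd_iff_dvd_coeff]
  exact forall_congr' fun n => base_mem_of_comap hP _

theorem comap_base_of_comap_polyBase {P : Ideal (CoordRing A B)}
    (hP : P.comap (polyBase i A B c) = Ideal.span {Polynomial.C g}) :
    P.comap (base A B i) = Ideal.span {g} := by
  ext s
  rw [Ideal.mem_comap, ← polyBase_C c, ← Ideal.mem_comap, hP, C_mem_span_C,
    Ideal.mem_span_singleton]

/-- A height one prime containing the nonzero form `g₀` is multihomogeneous. It is relevant in the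
factor `i` because it does not contain `fibV`, and in the others by contraction to `(g)`. So primes
found algebraically are genuine prime divisors. -/
theorem exists_primeDivisor [hJ : (idealX A B).IsPrime] (hg : Prime g)
    (hrel : ∀ t : {t : Fin 3 // t ≠ i}, ∃ j, ¬ g ∣ X (t, j))
    {g₀ : BasePoly K i} {d : {t : Fin 3 // t ≠ i} → ℕ} (hg₀ : IsForm g₀ d) (hg₀0 : g₀ ≠ 0)
    (hgg₀ : g ∣ g₀) {P : Ideal (CoordRing A B)} [hPp : P.IsPrime] (hPh : P.height = 1)
    (hP : P.comap (polyBase i A B c) = Ideal.span {Polynomial.C g}) :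
    ∃ P' : PrimeDivisor (idealX A B), P'.ideal = P := by
  have hPb := comap_base_of_comap_polyBase hP
  refine ⟨⟨P, hPp, ?_, fun t => ?_, hPh⟩, rfl⟩
  · refine homogeneous_of_height_eq_one (J := idealX A B) (G := {formL A, formQ B}) rfl ?_ P hPh hg₀.incl ?_ ?_
    · rintro _ (rfl | rfl)
      · exact ⟨_, isForm_formL A⟩
      · exact ⟨_, isForm_formQ B⟩
    · exact fun h => base_ne_zero (A := A) (B := B) hg₀0
        (by rw [← mk_incl]; exact Ideal.Quotient.eq_zero_iff_mem.mpr h)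
    · rw [mk_incl, base_mem_of_comap hPb]; exact hgg₀
  · by_cases ht : t = i
    · subst ht
      by_contra! h
      have hv : fibV A B t c ∈ P := P.add_mem (P.add_mem (P.mul_mem_left _ (h 0))
        (P.mul_mem_left _ (h 1))) (P.mul_mem_left _ (h 2))
      rw [← polyBase_X, ← Ideal.mem_comap, hP, Ideal.mem_span_singleton,
        Polynomial.C_dvd_iff_dvd_coeff] at hv
      exact hg.not_isUnit (isUnit_of_dvd_one (by simpa using hv 1))
    · obtain ⟨j, hj⟩ := hrel ⟨t, ht⟩
      exact ⟨j, by rwa [mk_X_of_ne ht, base_mem_of_comap hPb]⟩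

/-- The degree of `X` over the base is `2`, as computed along a prime divisor of the base. -/
theorem sum_ordAt_base_mul_relfinrank [hJ : (idealX A B).IsPrime] (hg : Prime g)
    (hrel : ∀ t : {t : Fin 3 // t ≠ i}, ∃ j, ¬ g ∣ X (t, j))
    {g₀ : BasePoly K i} {d : {t : Fin 3 // t ≠ i} → ℕ} (hg₀ : IsForm g₀ d) (hg₀0 : g₀ ≠ 0)
    (hgg₀ : g ∣ g₀) (hD : ¬ g ∣ discForm A B i c) (hs : ¬ g ∣ lineVec A i c k) :
    ∃ Φ : Finset (PrimeDivisor (idealX A B)),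
      (∀ P, P ∈ Φ ↔ P.ideal.comap (base A B i) = Ideal.span {g}) ∧
      ∑ P ∈ Φ, ordAt P (base A B i g) *
        Subfield.relfinrank (ratioField P (incl i)) (ratioField P (RingHom.id _)) = 2 := by
  classical
  -- Over the base alone the coordinate ring has relative dimension one because of scaling in the
  -- factor `i`; adjoining `fibV` makes it finite of rank two over `p`.
  let alg : Algebra (Polynomial (BasePoly K i)) (CoordRing A B) := (polyBase i A B c).toAlgebra
  have halg : ∀ s, algebraMap (Polynomial (BasePoly K i)) (CoordRing A B) s =
    polyBase i A B c s := fun _ => rfl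
  set p : Ideal (Polynomial (BasePoly K i)) := Ideal.span {Polynomial.C g} with hp
  have hpp : p.IsPrime := isPrime_span_C hg
  have hx := exists_polyBase_mul_eq hg hD hs (A := A) (B := B)
  have ha : Polynomial.C (discForm A B i c) ∉ p := by rwa [hp, C_mem_span_C]
  have hs' : Polynomial.C (lineVec A i c k) ∉ p := by rwa [hp, C_mem_span_C]
  have hquad : algebraMap (Polynomial (BasePoly K i)) (CoordRing A B)
      (Polynomial.C (discForm A B i c)) * fibX A B i k ^ 2 +
      algebraMap (Polynomial (BasePoly K i)) (CoordRing A B)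
        (Polynomial.C (midForm A B i c k) * Polynomial.X) * fibX A B i k +
      algebraMap (Polynomial (BasePoly K i)) (CoordRing A B)
        (Polynomial.C (formG A B i k) * Polynomial.X ^ 2) = 0 := by
    simp only [halg, map_mul, map_pow, polyBase_C, polyBase_X]
    exact quad_eq_fibX A B i c k
  set ρ : Polynomial (BasePoly K i) →+* p.ResidueField := algebraMap _ _ with hρ
  have hρ0 : ∀ s ∉ p, ρ s ≠ 0 := fun s hs h => hs (Ideal.algebraMap_residueField_eq_zero.mp h)
  set D := ρ (Polynomial.C (discForm A B i c))
  set f : Polynomial p.ResidueField := Polynomial.C D * Polynomial.X ^ 2 +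
    Polynomial.C (ρ (Polynomial.C (midForm A B i c k) * Polynomial.X)) * Polynomial.X +
    Polynomial.C (ρ (Polynomial.C (formG A B i k) * Polynomial.X ^ 2)) with hf
  have hdeg : f.natDegree = 2 := Polynomial.natDegree_quadratic (hρ0 _ ha)
  obtain ⟨χ, hχ, hχx, hχv⟩ := exists_fibrePoint (A := A) (B := B) (c := c) (k := k)
    ((AdjoinRoot.of f).comp (ρ.comp Polynomial.C)) (θ := AdjoinRoot.root f)
    (V := AdjoinRoot.of f (ρ Polynomial.X))
    (u := AdjoinRoot.of f (ρ (Polynomial.C (lineVec A i c k)))⁻¹)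
    (by
      rw [RingHom.comp_apply, RingHom.comp_apply, ← map_mul, inv_mul_cancel₀ (hρ0 _ hs'), map_one])
    (by
      have h := AdjoinRoot.eval₂_root f
      rw [hf] at h
      simp only [Polynomial.eval₂_add, Polynomial.eval₂_mul, Polynomial.eval₂_C,
        Polynomial.eval₂_X, Polynomial.eval₂_pow, map_mul, map_pow] at h
      exact h)
  have hχ' : ∀ s, χ (algebraMap (Polynomial (BasePoly K i)) (CoordRing A B) s) =
      AdjoinRoot.of f (algebraMap _ p.ResidueField s) := by
    have : χ.comp (polyBase i A B c) = (AdjoinRoot.of f).comp ρ := by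
      refine Polynomial.ringHom_ext (fun s => ?_) ?_
      · rw [RingHom.comp_apply, polyBase_C, hχ]; rfl
      · rw [RingHom.comp_apply, polyBase_X, hχv]; rfl
    exact fun s => RingHom.congr_fun this s
  have hfin : Module.Finite p.ResidueField (p.Fiber (CoordRing A B)) := finite_fiber p _ hx
  have hover : ∀ P : PrimeDivisor (idealX A B), P.ideal.comap (base A B i) = Ideal.span {g} ↔
      P.ideal ∈ p.primesOver (CoordRing A B) := fun P =>
    ⟨fun h => ⟨P.isPrime, ⟨(comap_polyBase P h hD).symm⟩⟩,
      fun h => comap_base_of_comap_polyBase h.2.over.symm⟩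
  have hΦ : {P : PrimeDivisor (idealX A B) |
      P.ideal.comap (base A B i) = Ideal.span {g}}.Finite :=
    Set.Finite.of_finite_image ((finite_primesOver_of_finite_fiber p).subset (by
      rintro _ ⟨P, hP, rfl⟩
      exact (hover P).mp hP)) (fun P _ Q _ h => PrimeDivisor.ext h)
  have : Fintype (p.primesOver (CoordRing A B)) :=
    (finite_primesOver_of_finite_fiber p).fintype
  refine ⟨hΦ.toFinset, fun P => by simp, ?_⟩
  rw [← sum_ordLoc_primesOver p hp _ hx ha hquad f hdeg χ hχ' hχx]
  refine Finset.sum_bij (fun P hP => ⟨P.ideal, (hover P).mp (by simpa using hP)⟩)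
    (fun _ _ => Finset.mem_univ _) (fun P _ Q _ h => PrimeDivisor.ext (congrArg Subtype.val h))
    ?_ ?_
  · rintro ⟨P, hP⟩ -
    have := hP.1
    obtain ⟨P', rfl⟩ := exists_primeDivisor (A := A) (B := B) (c := c) hg hrel hg₀ hg₀0 hgg₀
      (height_eq_one_of_mem_primesOver p hp
        (by rw [halg, polyBase_C]; exact base_ne_zero hg.ne_zero) hP) hP.2.over.symm
    exact ⟨P', by simpa using (hover P').mpr hP, rfl⟩
  · intro P hP
    have hP' : P.ideal.comap (base A B i) = Ideal.span {g} := by simpa using hP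
    have hDP : base A B i (discForm A B i c) ∉ P.ideal := by rwa [base_mem_of_comap hP']
    have hsP : base A B i (lineVec A i c k) ∉ P.ideal := by rwa [base_mem_of_comap hP']
    -- Both residue degrees, the geometric one from ratios of forms and the one over `p`, are 1 or 2
    -- according to rationality of the same coordinate.
    rw [relfinrank_ratioField P hDP hsP, halg, polyBase_C, ordAt_eq_ordLoc]
    congr 1
    refine if_congr ⟨?_, ?_⟩ rfl rfl
    · rintro ⟨_, α, β, -, -, hβ, h⟩
      refine ⟨Polynomial.C α * Polynomial.X, Polynomial.C β, ?_, ?_⟩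
      · rwa [hp, C_mem_span_C, ← base_mem_of_comap hP']
      · rwa [halg, halg, map_mul, polyBase_C, polyBase_C, polyBase_X]
    · rintro ⟨a, b, hb, h⟩
      rw [hp, ← comap_polyBase P hP' hD] at hb
      exact ratPt_of_polyBase P (fibV_notMem P hDP) hb h

end PrimesOverBase

/-! ## Divisors on the base -/

section BaseDivisors

variable {K : Type u} [Field K] {ι : Type} [Fintype ι] [DecidableEq ι]

theorem mk_bot_eq_zero {s : MvPolynomial (ι × Fin 3) K} :
    Ideal.Quotient.mk (⊥ : Ideal (MvPolynomial (ι × Fin 3) K)) s = 0 ↔ s = 0 := by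
  rw [Ideal.Quotient.eq_zero_iff_mem, Ideal.mem_bot]

theorem mk_bot_dvd_iff {s t : MvPolynomial (ι × Fin 3) K} :
    Ideal.Quotient.mk (⊥ : Ideal (MvPolynomial (ι × Fin 3) K)) s ∣ Ideal.Quotient.mk ⊥ t ↔
      s ∣ t :=
  map_dvd_iff (RingEquiv.quotientBot (MvPolynomial (ι × Fin 3) K)).symm

theorem prime_mk_bot {s : MvPolynomial (ι × Fin 3) K} (hs : Prime s) :
    Prime (Ideal.Quotient.mk (⊥ : Ideal (MvPolynomial (ι × Fin 3) K)) s) :=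
  (MulEquiv.prime_iff (RingEquiv.quotientBot (MvPolynomial (ι × Fin 3) K)).symm).mpr hs

variable (q : PrimeDivisor (⊥ : Ideal (MvPolynomial (ι × Fin 3) K)))

/-- The polynomial ring is factorial, so a nonzero prime contains a prime element, which generates
it when the height is one. -/
theorem exists_generator : ∃ g : MvPolynomial (ι × Fin 3) K, Prime g ∧
    q.ideal = Ideal.span {Ideal.Quotient.mk ⊥ g} := by
  have hne : q.ideal.comap (Ideal.Quotient.mk ⊥) ≠ ⊥ := by
    intro h
    refine q.ideal.ne_bot_of_height_eq_one q.height_eq_one ?_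
    rw [eq_bot_iff]
    intro y hy
    obtain ⟨s, rfl⟩ := Ideal.Quotient.mk_surjective y
    have hs : s ∈ q.ideal.comap (Ideal.Quotient.mk ⊥) := hy
    rw [h, Ideal.mem_bot] at hs
    rw [hs, map_zero]
    exact Ideal.zero_mem _
  obtain ⟨g, hg, hgp⟩ := Ideal.IsPrime.exists_mem_prime_of_ne_bot
    (inferInstanceAs (q.ideal.comap (Ideal.Quotient.mk ⊥)).IsPrime) hne
  exact ⟨g, hgp, Ideal.eq_span_singleton_of_height_eq_one q.height_eq_one hg (prime_mk_bot hgp)⟩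

variable {q} {g : MvPolynomial (ι × Fin 3) K}

theorem mk_mem_iff_dvd (hq : q.ideal = Ideal.span {Ideal.Quotient.mk ⊥ g})
    (s : MvPolynomial (ι × Fin 3) K) : Ideal.Quotient.mk ⊥ s ∈ q.ideal ↔ g ∣ s := by
  rw [hq, Ideal.mem_span_singleton, mk_bot_dvd_iff]

theorem ordAt_pow_mul (hq : q.ideal = Ideal.span {Ideal.Quotient.mk ⊥ g}) (hg : g ≠ 0)
    {h : MvPolynomial (ι × Fin 3) K} (hh : ¬ g ∣ h) (n : ℕ) :
    ordAt q (Ideal.Quotient.mk ⊥ (g ^ n * h)) = n := by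
  rw [map_mul, map_pow]
  exact ordLoc_pow_mul q.ideal hq (fun h => hg (mk_bot_eq_zero.mp h))
    (fun hm => hh ((mk_mem_iff_dvd hq h).mp hm)) n

theorem X_not_dvd_X {t t' : ι} {j : Fin 3} (hj : j ≠ 0) :
    ¬ (X (t, 0) : MvPolynomial (ι × Fin 3) K) ∣ X (t', j) := by
  rw [X_dvd_X]
  exact fun h => hj (Prod.ext_iff.mp h).2.symm

/-- The prime divisor where the first coordinate of the factor `t` vanishes. -/
def hyperplanePrime (K : Type u) [Field K] (t : ι) :
    PrimeDivisor (⊥ : Ideal (MvPolynomial (ι × Fin 3) K)) :=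
  have hX : Prime (Ideal.Quotient.mk (⊥ : Ideal (MvPolynomial (ι × Fin 3) K)) (X (t, 0))) :=
    prime_mk_bot X_prime
  have hpr := (Ideal.span_singleton_prime hX.ne_zero).mpr hX
  have hht : (Ideal.span {Ideal.Quotient.mk (⊥ : Ideal (MvPolynomial (ι × Fin 3) K))
      (X (t, 0))}).height = 1 :=
    Ideal.height_span_singleton_eq_one_of_mem_nonZeroDivisors
      (mem_nonZeroDivisors_of_ne_zero hX.ne_zero) hX.not_isUnit
  { ideal := Ideal.span {Ideal.Quotient.mk ⊥ (X (t, 0))}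
    isPrime := hpr
    homogeneous := homogeneous_of_height_eq_one (J := ⊥) (G := ∅) Ideal.span_empty.symm (by simp)
      _ hht (isForm_X t 0) (fun h => X_ne_zero _ (Ideal.mem_bot.mp h))
      (Ideal.mem_span_singleton_self _)
    relevant := fun t' => ⟨1, fun h => X_not_dvd_X (K := K) one_ne_zero
      (mk_bot_dvd_iff.mp (Ideal.mem_span_singleton.mp h))⟩
    height_eq_one := hht }

theorem divOf_X (t : ι) : divOf (Ideal.Quotient.mk (⊥ : Ideal (MvPolynomial (ι × Fin 3) K))
    (X (t, 0))) = Finsupp.single (hyperplanePrime K t) 1 := by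
  ext q
  rw [divOf_apply]
  by_cases hq : hyperplanePrime K t = q
  · subst hq
    rw [Finsupp.single_eq_same]
    have h1 : ¬ (X (t, 0) : MvPolynomial (ι × Fin 3) K) ∣ 1 := fun h =>
      X_prime.not_isUnit (isUnit_of_dvd_one h)
    have := ordAt_pow_mul (q := hyperplanePrime K t) rfl (X_ne_zero _) h1 1
    rw [pow_one, mul_one] at this
    rw [this, Nat.cast_one]
  · rw [Finsupp.single_eq_of_ne (Ne.symm hq), ordAt_of_notMem, Nat.cast_zero]
    intro h
    exact hq (PrimeDivisor.ext
      (Ideal.eq_span_singleton_of_height_eq_one q.height_eq_one h (prime_mk_bot X_prime)).symm)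

theorem ordLoc_eq_of_associated {R : Type*} [CommRing R] (P : Ideal R) [P.IsPrime] {f g : R}
    (h : Associated f g) : ordLoc P f = ordLoc P g := by
  obtain ⟨w, rfl⟩ := h
  rw [ordLoc, ordLoc, map_mul, Ring.ord_mul_of_isUnit_right (w.isUnit.map _)]

theorem divOf_eq_of_associated {J : Ideal (MvPolynomial (ι × Fin 3) K)} [J.IsPrime]
    {f g : MvPolynomial (ι × Fin 3) K ⧸ J} (h : Associated f g) : divOf f = divOf g := by
  ext P
  rw [divOf_apply, divOf_apply]
  exact congrArg _ (ordLoc_eq_of_associated P.ideal h)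

variable {i : Fin 3}

/-- The pull-back of a hyperplane divisor. -/
theorem pull_hyperplane (A : (Fin 3 → Fin 3) → K) (B : (Fin 3 → Fin 3) → (Fin 3 → Fin 3) → K)
    [(idealX A B).IsPrime]
    (t : {t : Fin 3 // t ≠ i}) :
    pull (idealX A B) i (hyperplane K i t) = coordDiv A B t := by
  have h : ∃ g, (hyperplanePrime K t).ideal = Ideal.span {g} := ⟨_, rfl⟩
  rw [hyperplane, divOf_X, pull, Finsupp.liftAddHom_apply_single, zmultiplesHom_apply, one_smul,
    pullPrime, dif_pos h, coordDiv, mk_X_of_ne t.2, ← projHom_mk]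
  -- The equation chosen in `pullPrime` differs from the coordinate by a unit only, which does not
  -- change the divisor.
  have h1 : Ideal.span {Ideal.Quotient.mk ⊥ (X (t, 0))} = Ideal.span {h.choose} := h.choose_spec
  exact divOf_eq_of_associated ((Ideal.span_singleton_eq_span_singleton.mp h1).symm.map _)

open Classical in
theorem pushPrime_apply {J : Ideal (MvPolynomial (Fin 3 × Fin 3) K)} (P : PrimeDivisor J)
    (q : PrimeDivisor (⊥ : Ideal (BasePoly K i))) :
    pushPrime i P q = if P.ideal.comap (projHom J i) = q.ideal then
      ((Subfield.relfinrank (ratioField P (incl i)) (ratioField P (RingHom.id _)) : ℕ) : ℤ)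
    else 0 := by
  rw [pushPrime]
  split_ifs with h1 h2 h2
  · have : h1.choose = q := PrimeDivisor.ext (h1.choose_spec.trans h2)
    rw [this, Finsupp.single_eq_same]
  · have : h1.choose ≠ q := fun h => h2 (h ▸ h1.choose_spec.symm)
    rw [Finsupp.single_eq_of_ne (Ne.symm this)]
  · exact absurd ⟨q, h2.symm⟩ h1
  · rfl

theorem push_apply {J : Ideal (MvPolynomial (Fin 3 × Fin 3) K)} (D : WeilDiv J)
    (q : PrimeDivisor (⊥ : Ideal (BasePoly K i))) (Φ : Finset (PrimeDivisor J))
    (hΦ : ∀ P, P ∈ Φ ↔ P.ideal.comap (projHom J i) = q.ideal) :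
    push i D q = ∑ P ∈ Φ, D P *
      ((Subfield.relfinrank (ratioField P (incl i)) (ratioField P (RingHom.id _)) : ℕ) : ℤ) := by
  classical
  rw [push, Finsupp.liftAddHom_apply, Finsupp.sum_of_support_subset D
    (Finset.subset_union_left (s₂ := Φ)) _ (fun P _ => by simp), Finsupp.finsetSum_apply,
    ← Finset.sum_subset (Finset.subset_union_right (s₁ := D.support))]
  · refine Finset.sum_congr rfl fun P hP => ?_
    rw [zmultiplesHom_apply, Finsupp.smul_apply, pushPrime_apply, if_pos ((hΦ P).mp hP),
      smul_eq_mul]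
  · intro P _ hP
    rw [zmultiplesHom_apply, Finsupp.smul_apply, pushPrime_apply, if_neg (mt (hΦ P).mpr hP),
      smul_zero]

end BaseDivisors

/-! ## The push-forward of the coordinate divisors -/

section PushForward

variable {K : Type u} [Field K] {i : Fin 3}
variable {A : (Fin 3 → Fin 3) → K} {B : (Fin 3 → Fin 3) → (Fin 3 → Fin 3) → K}

/-- A finite set of prime divisors which is stable under the involution has conjugate prime divisors
of equal degree over their images. -/
theorem two_mul_sum_ordAt [hJ : (idealX A B).IsPrime] {g : BasePoly K i} {c : Fin 3 → K}
    {k : Fin 3} (hD : ¬ g ∣ discForm A B i c) (hs : ¬ g ∣ lineVec A i c k) (n : Fin 3)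
    (hG : formG A B i n ≠ 0)
    (Φ : Finset (PrimeDivisor (idealX A B)))
    (hΦ : ∀ P, P ∈ Φ ↔ P.ideal.comap (base A B i) = Ideal.span {g}) :
    2 * ∑ P ∈ Φ, ordAt P (fibX A B i n) *
        Subfield.relfinrank (ratioField P (incl i)) (ratioField P (RingHom.id _)) =
      ∑ P ∈ Φ, ordAt P (base A B i (formG A B i n)) *
        Subfield.relfinrank (ratioField P (incl i)) (ratioField P (RingHom.id _)) := by
  classical
  have hDP : ∀ P ∈ Φ, base A B i (discForm A B i c) ∉ P.ideal := fun P hP => by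
    rwa [base_mem_of_comap ((hΦ P).mp hP)]
  have hsP : ∀ P ∈ Φ, base A B i (lineVec A i c k) ∉ P.ideal := fun P hP => by
    rwa [base_mem_of_comap ((hΦ P).mp hP)]
  have hmem : ∀ P (hP : P ∈ Φ), conjDiv P (hDP P hP) ∈ Φ := fun P hP => by
    rw [hΦ, ← (hΦ P).mp hP]
    ext s
    exact base_mem_conjDiv P (hDP P hP) s
  -- Reindexing by conjugation: it permutes the primes above `g`, and conjugate points are rational
  -- over the base field simultaneously.
  have hconj : ∑ P ∈ Φ, ordAt P (fibX A B i n) *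
        Subfield.relfinrank (ratioField P (incl i)) (ratioField P (RingHom.id _)) =
      ∑ P ∈ Φ.attach, ordAt (conjDiv P.1 (hDP P.1 P.2)) (fibX A B i n) *
        Subfield.relfinrank (ratioField P.1 (incl i)) (ratioField P.1 (RingHom.id _)) := by
    refine (Finset.sum_bij (fun P _ => conjDiv P.1 (hDP P.1 P.2)) (fun P _ => hmem P.1 P.2)
      (fun P _ Q _ h => Subtype.ext ?_) (fun P hP => ?_) (fun P _ => ?_)).symm
    · have h1 := conjDiv_conjDiv P.1 (hDP P.1 P.2) (hDP _ (hmem P.1 P.2))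
      exact h1.symm.trans (conjDiv_eq_of_eq_conjDiv h _)
    · exact ⟨⟨conjDiv P (hDP P hP), hmem P hP⟩, Finset.mem_attach _ _,
        conjDiv_conjDiv P (hDP P hP) (hDP _ (hmem P hP))⟩
    · rw [relfinrank_ratioField P.1 (hDP P.1 P.2) (hsP P.1 P.2),
        relfinrank_ratioField _ (hDP _ (hmem P.1 P.2)) (hsP _ (hmem P.1 P.2))]
      congr 1
      exact if_congr (ratPt_conjDiv_iff P.1 (hDP P.1 P.2)).symm rfl rfl
  rw [two_mul]
  nth_rewrite 2 [hconj]
  rw [← Finset.sum_attach, ← Finset.sum_attach Φ fun P => ordAt P (base A B i (formG A B i n)) * _,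
    ← Finset.sum_add_distrib]
  refine Finset.sum_congr rfl fun P _ => ?_
  rw [← add_mul, ordAt_add_ordAt_conjDiv P.1 (hDP P.1 P.2) n hG]

/-- At the prime `g`, twice the coefficient is the weighted sum of orders of `G_0 = g ^ n * h`. As
`h` is a unit above `g`, this is `n` times the weighted sum for `g`, which is the degree two of X
over the base. -/
theorem push_coordDiv (hprime : (idealX A B).IsPrime) (hcodim : (idealX A B).height = 2)
    (i : Fin 3) : push i (coordDiv A B i) = divOf (Ideal.Quotient.mk _ (formG A B i 0)) := by
  ext q
  obtain ⟨g, hg, hq⟩ := exists_generator q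
  have hmem := mk_mem_iff_dvd hq
  have hG0 := formG_ne_zero hprime hcodim i 0
  obtain ⟨c, hD⟩ := exists_not_dvd_discForm hprime hcodim i hg
  -- `discForm` is a quadratic form in the entries of `c × l`, so a common factor of these would
  -- divide it.
  obtain ⟨k, hs⟩ : ∃ k, ¬ g ∣ lineVec A i c k := by
    by_contra! h
    refine hD (Ideal.mem_span_singleton.mp ?_)
    have h' : ∀ k, lineVec A i c k ∈ Ideal.span {g} := fun k =>
      Ideal.mem_span_singleton.mpr (h k)
    have e : discForm A B i c = quad (coeffQ B i) (lineVec A i c) := rfl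
    rw [e, quad, sq, sq, sq]
    exact add_mem (add_mem (add_mem (add_mem (add_mem
      (Ideal.mul_mem_left _ _ (Ideal.mul_mem_left _ _ (h' 0)))
      (Ideal.mul_mem_left _ _ (Ideal.mul_mem_left _ _ (h' 1))))
      (Ideal.mul_mem_left _ _ (Ideal.mul_mem_left _ _ (h' 2))))
      (Ideal.mul_mem_left _ _ (Ideal.mul_mem_left _ _ (h' 2))))
      (Ideal.mul_mem_left _ _ (Ideal.mul_mem_left _ _ (h' 0))))
      (Ideal.mul_mem_left _ _ (Ideal.mul_mem_left _ _ (h' 1)))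
  have hrel : ∀ t : {t : Fin 3 // t ≠ i}, ∃ j, ¬ g ∣ X (t, j) := fun t => by
    obtain ⟨j, hj⟩ := q.relevant t
    exact ⟨j, by rwa [← hmem]⟩
  -- The generator `g` is not known to be a form. Any nonzero component of it is a form that lies in
  -- the homogeneous ideal `q`, hence is divisible by `g`.
  obtain ⟨d, hd⟩ : ∃ d, weightedHomogeneousComponent (multideg _) d g ≠ 0 := by
    by_contra! h
    exact hg.ne_zero (by
      have := mem_of_component_mem (I := (⊥ : Ideal (BasePoly K i))) (f := g)
        (fun d => Ideal.mem_bot.mpr (h d))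
      exact Ideal.mem_bot.mp this)
  obtain ⟨Φ, hΦ, hsum⟩ := sum_ordAt_base_mul_relfinrank (A := A) (B := B) hg hrel
    (isForm_component g d) hd ((hmem _).mp (q.homogeneous g ((hmem g).mpr dvd_rfl) d)) hD hs
  have hΦ' : ∀ P, P ∈ Φ ↔ P.ideal.comap (projHom (idealX A B) i) = q.ideal := by
    intro P
    rw [hΦ]
    constructor
    · intro h
      ext y
      obtain ⟨s, rfl⟩ := Ideal.Quotient.mk_surjective y
      rw [hmem, Ideal.mem_comap, projHom_mk, base_mem_of_comap h]
    · intro h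
      ext s
      rw [Ideal.mem_span_singleton, ← hmem, ← h]
      rfl
  rw [push_apply _ q Φ hΦ', divOf_apply]
  have hfin : FiniteMultiplicity g (formG A B i 0) :=
    FiniteMultiplicity.of_prime_left hg hG0
  obtain ⟨h, hGe, hh⟩ := hfin.exists_eq_pow_mul_and_not_dvd
  set n := multiplicity g (formG A B i 0)
  have h0 : h ≠ 0 := fun h0 => hh (h0 ▸ dvd_zero g)
  have hord : ∀ P ∈ Φ, ordAt P (base A B i (formG A B i 0)) = n * ordAt P (base A B i g) := by
    intro P hP
    rw [hGe, map_mul, map_pow, ordAt_mul P (pow_ne_zero _ (base_ne_zero hg.ne_zero))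
      (base_ne_zero h0), ordAt_pow P (base_ne_zero hg.ne_zero),
      ordAt_of_notMem P (f := base A B i h) (by rwa [base_mem_of_comap ((hΦ P).mp hP)]), add_zero]
  have h2 := two_mul_sum_ordAt hD hs 0 hG0 Φ hΦ
  have h4 : ∑ P ∈ Φ, ordAt P (base A B i (formG A B i 0)) *
      Subfield.relfinrank (ratioField P (incl i)) (ratioField P (RingHom.id _)) = 2 * n := by
    refine Eq.trans ?_ ((congrArg (n * ·) hsum).trans (mul_comm n 2))
    rw [Finset.mul_sum]
    exact Finset.sum_congr rfl fun P hP => by rw [hord P hP, mul_assoc]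
  have h3 := Nat.eq_of_mul_eq_mul_left two_pos (h2.trans h4)
  rw [hGe, ordAt_pow_mul hq hg.ne_zero hh n, ← h3]
  push_cast
  rfl

theorem linEquiv_divOf_formG {A : (Fin 3 → Fin 3) → K}
    {B : (Fin 3 → Fin 3) → (Fin 3 → Fin 3) → K} (hG : formG A B i 0 ≠ 0) :
    LinEquiv (divOf (Ideal.Quotient.mk ⊥ (formG A B i 0)))
      (∑ t : {t : Fin 3 // t ≠ i}, (4 : ℤ) • hyperplane K i t) := by
  refine ⟨fun _ => 4, formG A B i 0, ∏ t : {t : Fin 3 // t ≠ i}, X (t, 0) ^ 4,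
    isForm_formG A B i 0, isForm_prod_X i, fun h => hG (Ideal.mem_bot.mp h),
    fun h => prod_X_ne_zero i (Ideal.mem_bot.mp h), ?_⟩
  have h0 : ∀ t : {t : Fin 3 // t ≠ i},
      Ideal.Quotient.mk (⊥ : Ideal (BasePoly K i)) (X (t, 0)) ≠ 0 := fun t h =>
    X_ne_zero _ (mk_bot_eq_zero.mp h)
  rw [map_prod, divOf_prod _ _ fun t _ => by rw [map_pow]; exact pow_ne_zero _ (h0 t)]
  congr 1
  refine Finset.sum_congr rfl fun t _ => ?_
  rw [map_pow, divOf_pow (h0 t), hyperplane]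
  rfl

end PushForward

end ThreeInvolutions

end

open ThreeInvolutions
/-- Push-forwards of the coordinate hyperplane sections of `X^{A,B}` along the projections, and the
action of the involutions `σ_i` on these sections. The factors `x, y, z` are numbered `0, 1, 2`. -/
theorem mainTheorem6 {K : Type u} [Field K]
    (A : (Fin 3 → Fin 3) → K) (B : (Fin 3 → Fin 3) → (Fin 3 → Fin 3) → K)
    (hprime : (idealX A B).IsPrime) (hcodim : (idealX A B).height = 2) :
    (∀ i : Fin 3, IsForm (formG A B i 0) (fun _ => 4) ∧ formG A B i 0 ≠ 0) ∧
    (∀ i j : Fin 3, ∀ h : i ≠ j,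
      push i (pull (idealX A B) j (hyperplane K j ⟨i, h⟩)) =
        divOf (Ideal.Quotient.mk _ (formG A B i 0)) ∧
      LinEquiv (push i (pull (idealX A B) j (hyperplane K j ⟨i, h⟩)))
        (∑ t : {t : Fin 3 // t ≠ i}, (4 : ℤ) • hyperplane K i t)) ∧
    (∀ i : Fin 3, (∀ P : PrimeDivisor (idealX A B), MemU A B i P) →
      LinEquiv (sigmaPull A B i (coordDiv A B i))
        ((∑ t : {t : Fin 3 // t ≠ i}, (4 : ℤ) • coordDiv A B t) - coordDiv A B i) ∧
      ∀ j : Fin 3, j ≠ i → sigmaPull A B i (coordDiv A B j) = coordDiv A B j) := by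
  have hG : ∀ i, formG A B i 0 ≠ 0 := fun i => formG_ne_zero hprime hcodim i 0
  refine ⟨fun i => ⟨isForm_formG A B i 0, hG i⟩, fun i j h => ?_, fun i hU =>
    ⟨linEquiv_sigmaPull_coordDiv (hG i) hU, fun j hj => sigmaPull_coordDiv_of_ne hU hj⟩⟩
  have hpush : push i (pull (idealX A B) j (hyperplane K j ⟨i, h⟩)) =
      divOf (Ideal.Quotient.mk _ (formG A B i 0)) := by
    -- The pulled back divisor is `D_i` for either choice of `j`, which is why both expressions have
    -- the same push-forward.
    rw [pull_hyperplane, push_coordDiv hprime hcodim]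
  exact ⟨hpush, hpush ▸ linEquiv_divOf_formG (hG i)⟩
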